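/- **Setting.** Let $\gamma$ be a piecewise regular $C^1$ simple closed curve in $\mathbb C$ which starts at $0$, encircles the point at infinity once in the positive direction, and returns to $0$. Thus infinity lies on the left of $\gamma$: $\gamma$ has winding number $0$ about the points of its left ($+$) side, which is the component of $\mathbb C\setminus\gamma$ containing infinity, and $-1$ about the points of its right ($-$) side. Write $\log z$ for a continuous determination of the logarithm along $\gamma\setminus\{0\}$, and $z^{p}=e^{p\log z}$. An $N\times N$ matrix weight $W$ on $\gamma$ is of *Bessel type* if each entry is a finite sum $$W^{(j,k)}(z)=\sum_{m\in I_{j,k}}\varphi_m(z)\,z^{p_m}\log^{q_m}(z)\,e^{-\lambda_m/z},\qquad z\in\gamma\setminus\{0\},$$ with $p_m,\lambda_m\in\mathbb C$, $\operatorname{Re}\lambda_m\ge 0$, $q_m\in\mathbb N=\{0,1,\dots\}$, and $\varphi_m$ Hölder continuous, bounded and nonvanishing on $\gamma$, where each term has an integrable power bound at the origin: for some $\delta_m>0$, $|z^{p_m}e^{-\lambda_m/z}|=O(|z|^{\delta_m-1})$ as $z\to0$ along $\gamma$. (For $\lambda_m=0$ this means $\operatorname{Re}p_m>-1$; it is automatic,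 for every $p_m$, if $\operatorname{Re}(\lambda_m/z)\ge c/|z|$ on $\gamma$ near $0$ for some $c>0$.) The weight $W$ is *regular* if its moments $W_n=\frac1{2\pi i}\int_\gamma z^nW(z)\,dz$ satisfy $\det[W_{j+k}]_{j,k=0}^n\ne0$ for all $n\in\mathbb N$. **Theorem.** Let $W$ be a regular weight of Bessel type on $\gamma$. Then there are unique sequences of monic matrix polynomials $P_n^{\mathsf L},P_n^{\mathsf R}$ of degree $n$ and of nonsingular matrices $C_n$ such that, for all $n\in\mathbb N$ and $0\le k\le n$, $$\frac1{2\pi i}\int_\gamma P_n^{\mathsf L}(z)W(z)z^k\,dz=\delta_{n,k}C_n^{-1},\qquad \frac1{2\pi i}\int_\gamma z^kW(z)P_n^{\mathsf R}(z)\,dz=\delta_{n,k}C_n^{-1}.$$ Put, for $z\notin\gamma$, $$Q_n^{\mathsf L}(z)=\frac1{2\pi i}\int_\gamma\frac{P_n^{\mathsf L}(t)W(t)}{t-z}\,dt,\qquad Q_n^{\mathsf R}(z)=\frac1{2\pi i}\int_\gamma\frac{W(t)P_n^{\mathsf R}(t)}{t-z}\,dt,$$ $$Y_n^{\mathsf L}=\begin{bmatrix}P_n^{\mathsf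 L}&Q_n^{\mathsf L}\\-C_{n-1}P_{n-1}^{\mathsf L}&-C_{n-1}Q_{n-1}^{\mathsf L}\end{bmatrix},\qquad Y_n^{\mathsf R}=\begin{bmatrix}P_n^{\mathsf R}&-P_{n-1}^{\mathsf R}C_{n-1}\\Q_n^{\mathsf R}&-Q_{n-1}^{\mathsf R}C_{n-1}\end{bmatrix},$$ where for $n=0$ the second block row of $Y_0^{\mathsf L}$ is $(0,\ I)$ and the second block column of $Y_0^{\mathsf R}$ is $(0,\ I)^{\top}$ (the conventions $P_{-1}=0$, $Q_{-1}=-C_{-1}^{-1}$). Then, for each $n\in\mathbb N$, $Y_n^{\mathsf L}$ (respectively $Y_n^{\mathsf R}$) is the unique $2N\times2N$ matrix function on $\mathbb C\setminus\gamma$ such that: 1. (RH1) it is holomorphic in $\mathbb C\setminus\gamma$; 2. (RH2) at every $z\in\gamma\setminus\{0\}$ it has limits $(\cdot)_\pm$ from the $+$ side and the $-$ side of $\gamma$, and $$(Y_n^{\mathsf L})_+=(Y_n^{\mathsf L})_-\begin{bmatrix}I&W(z)\\0&I\end{bmatrix},\qquad (Y_n^{\mathsf R})_+=\begin{bmatrix}I&0\\W(z)&I\end{bmatrix}(Y_n^{\mathsf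 R})_-;$$ 3. (RH3) as $|z|\to\infty$, $$Y_n^{\mathsf L}(z)=\Bigl(I+O\bigl(\tfrac1z\bigr)\Bigr)\begin{bmatrix}z^nI&0\\0&z^{-n}I\end{bmatrix},\qquad Y_n^{\mathsf R}(z)=\begin{bmatrix}z^nI&0\\0&z^{-n}I\end{bmatrix}\Bigl(I+O\bigl(\tfrac1z\bigr)\Bigr);$$ 4. (RH4) as $z\to0$, $z\notin\gamma$, $$Y_n^{\mathsf L}(z)=\begin{bmatrix}O(1)&s_1^{\mathsf L}(z)\\O(1)&s_2^{\mathsf L}(z)\end{bmatrix},\qquad Y_n^{\mathsf R}(z)=\begin{bmatrix}O(1)&O(1)\\s_1^{\mathsf R}(z)&s_2^{\mathsf R}(z)\end{bmatrix},$$ with $z\,s_j^{\mathsf L}(z)\to0$ and $z\,s_j^{\mathsf R}(z)\to0$ for $j=1,2$. -/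

import Mathlib

open Set Filter Topology Asymptotics Polynomial
open scoped NNReal

noncomputable section

namespace MatrixBessel

/-- `(1 / 2πi) ∮ f(z) dz` along the parametrised curve `c : [0, 1] → ℂ`. -/
def loopIntegral (c : ℝ → ℂ) (f : ℂ → ℂ) : ℂ :=
  (2 * (Real.pi : ℂ) * Complex.I)⁻¹ * ∫ s in (0 : ℝ)..1, f (c s) * deriv c s

/-- The winding number of the closed curve `c` about a point `z` off the curve. -/
def windingNumber (c : ℝ → ℂ) (z : ℂ) : ℂ :=
  loopIntegral c (fun t => (t - z)⁻¹)

/-- A piecewise regular `C¹` simple loop which starts at the origin, encircles the point at infinity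
once in the positive direction, and returns to the origin. Keeping infinity on its left, the loop
runs clockwise in the plane: the winding number is `0` in the component of infinity and `-1` at the
other points off the loop. The two ends of the loop may meet at the origin at any angle. -/
structure Loop where
  /-- The parametrisation; only its values on `[0, 1]` matter. -/
  toFun : ℝ → ℂ
  continuousOn : ContinuousOn toFun (Icc 0 1)
  map_zero : toFun 0 = 0
  map_one : toFun 1 = 0
  injOn : InjOn toFun (Ico 0 1)
  piecewise_regular : ∃ (k : ℕ) (s : ℕ → ℝ), s 0 = 0 ∧ s k = 1 ∧
    ∀ i < k, s i < s (i + 1) ∧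
      ContDiffOn ℝ 1 toFun (Icc (s i) (s (i + 1))) ∧
      ∀ t ∈ Icc (s i) (s (i + 1)), derivWithin toFun (Icc (s i) (s (i + 1))) t ≠ 0
  winding : ∀ z ∉ toFun '' Icc 0 1,
    windingNumber toFun z = 0 ∨ windingNumber toFun z = -1

namespace Loop

/-- The set of points of the loop. -/
def trace (γ : Loop) : Set ℂ := γ.toFun '' Icc 0 1

/-- The region to the left of the loop (the `+` side), which contains infinity. -/
def plusSide (γ : Loop) : Set ℂ := {z | z ∉ γ.trace ∧ windingNumber γ.toFun z = 0}

/-- The region to the right of the loop (the `-` side). -/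
def minusSide (γ : Loop) : Set ℂ := {z | z ∉ γ.trace ∧ windingNumber γ.toFun z = -1}

/-- `(1 / 2πi) ∫_γ F(z) dz` for a matrix-valued function, entry by entry. -/
def matrixIntegral {N : ℕ} (γ : Loop) (F : ℂ → Matrix (Fin N) (Fin N) ℂ) :
    Matrix (Fin N) (Fin N) ℂ :=
  Matrix.of fun i j => loopIntegral γ.toFun (fun z => F z i j)

end Loop

/-- `ℓ` is a continuous determination of the logarithm along the loop. -/
def IsLogBranch (γ : Loop) (ℓ : ℂ → ℂ) : Prop :=
  ContinuousOn ℓ (γ.trace \ {0}) ∧ ∀ z ∈ γ.trace \ {0}, Complex.exp (ℓ z) = z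

/-- Matrix weights of Bessel type on `γ`: every entry is a finite sum of terms
`φ(z) z ^ p (log z) ^ q exp (-Λ / z)`, with `Re Λ ≥ 0`, `q ∈ ℕ` and `φ` Hölder continuous, bounded
and nonvanishing on `γ`. The last condition on a term says that it has an integrable power bound at
the origin along `γ` (whatever `q` is), so that the moments converge absolutely. -/
def IsBesselType {N : ℕ} (γ : Loop) (W : ℂ → Matrix (Fin N) (Fin N) ℂ) : Prop :=
  ∃ ℓ : ℂ → ℂ, IsLogBranch γ ℓ ∧ ∀ i j : Fin N,
    ∃ (M : ℕ) (φ : Fin M → ℂ → ℂ) (p : Fin M → ℂ) (q : Fin M → ℕ) (Λ : Fin M → ℂ),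
      (∀ m,
        0 ≤ (Λ m).re ∧
        (∃ K r : ℝ≥0, 0 < r ∧ r ≤ 1 ∧ HolderOnWith K r (φ m) γ.trace) ∧
        (∃ B : ℝ, ∀ z ∈ γ.trace, ‖φ m z‖ ≤ B) ∧
        (∀ z ∈ γ.trace, φ m z ≠ 0) ∧
        ∃ δ : ℝ, 0 < δ ∧
          (fun z => Complex.exp (p m * ℓ z) * Complex.exp (-Λ m / z))
            =O[𝓝[γ.trace \ {0}] 0] fun z => ‖z‖ ^ (δ - 1)) ∧
      ∀ z ∈ γ.trace \ {0},
        W z i j =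
          ∑ m, φ m z * Complex.exp (p m * ℓ z) * ℓ z ^ q m * Complex.exp (-Λ m / z)

/-- The moments `W_n = (1 / 2πi) ∫_γ z ^ n W(z) dz`. -/
def moment {N : ℕ} (γ : Loop) (W : ℂ → Matrix (Fin N) (Fin N) ℂ) (n : ℕ) :
    Matrix (Fin N) (Fin N) ℂ :=
  γ.matrixIntegral fun z => z ^ n • W z

/-- The block Hankel matrix `[W_{j+k}]` with `0 ≤ j, k ≤ n`. -/
def blockHankel {N : ℕ} (γ : Loop) (W : ℂ → Matrix (Fin N) (Fin N) ℂ) (n : ℕ) :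
    Matrix (Fin (n + 1) × Fin N) (Fin (n + 1) × Fin N) ℂ :=
  Matrix.of fun a b => moment γ W ((a.1 : ℕ) + (b.1 : ℕ)) a.2 b.2

def IsRegular {N : ℕ} (γ : Loop) (W : ℂ → Matrix (Fin N) (Fin N) ℂ) : Prop :=
  ∀ n : ℕ, (blockHankel γ W n).det ≠ 0

/-- The value at the scalar `z` of a polynomial with matrix coefficients. -/
def polyVal {N : ℕ} (P : (Matrix (Fin N) (Fin N) ℂ)[X]) (z : ℂ) : Matrix (Fin N) (Fin N) ℂ :=
  P.eval (Matrix.scalar (Fin N) z)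

/-- `PL n` and `PR n` are monic of degree `n` and left, respectively right, orthogonal with respect
to `W`, with nonsingular `C n`. -/
def IsBiorthogonal {N : ℕ} (γ : Loop) (W : ℂ → Matrix (Fin N) (Fin N) ℂ)
    (PL PR : ℕ → (Matrix (Fin N) (Fin N) ℂ)[X]) (C : ℕ → Matrix (Fin N) (Fin N) ℂ) : Prop :=
  ∀ n : ℕ,
    ((PL n).natDegree ≤ n ∧ (PL n).coeff n = 1) ∧
    ((PR n).natDegree ≤ n ∧ (PR n).coeff n = 1) ∧
    (C n).det ≠ 0 ∧
    ∀ k ≤ n,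
      (γ.matrixIntegral fun z => z ^ k • (polyVal (PL n) z * W z))
        = (if n = k then (C n)⁻¹ else 0) ∧
      (γ.matrixIntegral fun z => z ^ k • (W z * polyVal (PR n) z))
        = (if n = k then (C n)⁻¹ else 0)

/-- Left second kind functions. -/
def secondKindL {N : ℕ} (γ : Loop) (W : ℂ → Matrix (Fin N) (Fin N) ℂ)
    (P : (Matrix (Fin N) (Fin N) ℂ)[X]) (z : ℂ) : Matrix (Fin N) (Fin N) ℂ :=
  γ.matrixIntegral fun t => (t - z)⁻¹ • (polyVal P t * W t)

/-- Right second kind functions. -/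
def secondKindR {N : ℕ} (γ : Loop) (W : ℂ → Matrix (Fin N) (Fin N) ℂ)
    (P : (Matrix (Fin N) (Fin N) ℂ)[X]) (z : ℂ) : Matrix (Fin N) (Fin N) ℂ :=
  γ.matrixIntegral fun t => (t - z)⁻¹ • (W t * polyVal P t)

/-- The matrices `Y_n^L`. For `n = 0` the conventions `P_{-1} = 0` and `Q_{-1} = -C_{-1}⁻¹` make the
second block row `(0, I)`. -/
def YL {N : ℕ} (γ : Loop) (W : ℂ → Matrix (Fin N) (Fin N) ℂ)
    (PL : ℕ → (Matrix (Fin N) (Fin N) ℂ)[X]) (C : ℕ → Matrix (Fin N) (Fin N) ℂ) :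
    ℕ → ℂ → Matrix (Fin N ⊕ Fin N) (Fin N ⊕ Fin N) ℂ
  | 0, z => Matrix.fromBlocks (polyVal (PL 0) z) (secondKindL γ W (PL 0) z) 0 1
  | n + 1, z => Matrix.fromBlocks
      (polyVal (PL (n + 1)) z) (secondKindL γ W (PL (n + 1)) z)
      (-(C n * polyVal (PL n) z)) (-(C n * secondKindL γ W (PL n) z))

/-- The matrices `Y_n^R`; for `n = 0` the second block column is `(0, I)`. -/
def YR {N : ℕ} (γ : Loop) (W : ℂ → Matrix (Fin N) (Fin N) ℂ)
    (PR : ℕ → (Matrix (Fin N) (Fin N) ℂ)[X]) (C : ℕ → Matrix (Fin N) (Fin N) ℂ) :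
    ℕ → ℂ → Matrix (Fin N ⊕ Fin N) (Fin N ⊕ Fin N) ℂ
  | 0, z => Matrix.fromBlocks (polyVal (PR 0) z) 0 (secondKindR γ W (PR 0) z) 1
  | n + 1, z => Matrix.fromBlocks
      (polyVal (PR (n + 1)) z) (-(polyVal (PR n) z * C n))
      (secondKindR γ W (PR (n + 1)) z) (-(secondKindR γ W (PR n) z * C n))

/-- `diag (z ^ n I, z ^ (-n) I)`. -/
def diagPower (N n : ℕ) (z : ℂ) : Matrix (Fin N ⊕ Fin N) (Fin N ⊕ Fin N) ℂ :=
  Matrix.fromBlocks (z ^ n • 1) 0 0 ((z ^ n)⁻¹ • 1)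

/-- `Y` solves the left Riemann–Hilbert problem. The boundary values are the unrestricted limits
from the two sides of the loop. -/
structure SolvesLeftRHP {N : ℕ} (γ : Loop) (W : ℂ → Matrix (Fin N) (Fin N) ℂ) (n : ℕ)
    (Y : ℂ → Matrix (Fin N ⊕ Fin N) (Fin N ⊕ Fin N) ℂ) : Prop where
  holomorphic : ∀ a b, DifferentiableOn ℂ (fun z => Y z a b) γ.traceᶜ
  jump : ∀ z ∈ γ.trace \ {0}, ∃ Yp Ym : Matrix (Fin N ⊕ Fin N) (Fin N ⊕ Fin N) ℂ,
    Tendsto Y (𝓝[γ.plusSide] z) (𝓝 Yp) ∧ Tendsto Y (𝓝[γ.minusSide] z) (𝓝 Ym) ∧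
      Yp = Ym * Matrix.fromBlocks 1 (W z) 0 1
  infinity : ∃ E : ℂ → Matrix (Fin N ⊕ Fin N) (Fin N ⊕ Fin N) ℂ,
    (∀ a b, (fun z => E z a b) =O[Bornology.cobounded ℂ] fun z => z⁻¹) ∧
      ∀ᶠ z in Bornology.cobounded ℂ, Y z = (1 + E z) * diagPower N n z
  origin_first_column : ∀ a (j : Fin N),
    (fun z => Y z a (Sum.inl j)) =O[𝓝[γ.traceᶜ] 0] fun _ => (1 : ℂ)
  origin_second_column : ∀ a (j : Fin N),
    Tendsto (fun z => z * Y z a (Sum.inr j)) (𝓝[γ.traceᶜ] 0) (𝓝 0)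

/-- `Y` solves the right Riemann–Hilbert problem. -/
structure SolvesRightRHP {N : ℕ} (γ : Loop) (W : ℂ → Matrix (Fin N) (Fin N) ℂ) (n : ℕ)
    (Y : ℂ → Matrix (Fin N ⊕ Fin N) (Fin N ⊕ Fin N) ℂ) : Prop where
  holomorphic : ∀ a b, DifferentiableOn ℂ (fun z => Y z a b) γ.traceᶜ
  jump : ∀ z ∈ γ.trace \ {0}, ∃ Yp Ym : Matrix (Fin N ⊕ Fin N) (Fin N ⊕ Fin N) ℂ,
    Tendsto Y (𝓝[γ.plusSide] z) (𝓝 Yp) ∧ Tendsto Y (𝓝[γ.minusSide] z) (𝓝 Ym) ∧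
      Yp = Matrix.fromBlocks 1 0 (W z) 1 * Ym
  infinity : ∃ E : ℂ → Matrix (Fin N ⊕ Fin N) (Fin N ⊕ Fin N) ℂ,
    (∀ a b, (fun z => E z a b) =O[Bornology.cobounded ℂ] fun z => z⁻¹) ∧
      ∀ᶠ z in Bornology.cobounded ℂ, Y z = diagPower N n z * (1 + E z)
  origin_first_row : ∀ (i : Fin N) b,
    (fun z => Y z (Sum.inl i) b) =O[𝓝[γ.traceᶜ] 0] fun _ => (1 : ℂ)
  origin_second_row : ∀ (i : Fin N) b,
    Tendsto (fun z => z * Y z (Sum.inr i) b) (𝓝[γ.traceᶜ] 0) (𝓝 0)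

end MatrixBessel

end

/-! Everything about the weight is reduced to one regularity class, `IsDensity`: a density is Hölder
continuous near each point of the loop other than the origin, and `t g(t)` is Hölder continuous in
the parameter on the two arcs that meet at the origin. The second condition cannot simply be
replaced by smoothness of `g` up to a power: a factor `exp (-Λ / z)` may oscillate without decaying,
and each derivative then costs `u ^ (-2)`. Balancing that loss against the integrable power bound
leaves a Hölder function with half the exponent (`isHolderOn_of_deriv_bound`,
`IsBesselType.isDensity`). Existence. Orthogonality is a linear system for the coefficients whose
matrix is the block Hankel matrix, so regularity solves it uniquely and makes the norms nonsingular
(`exists_isLeftOrthogonal`); the right norms equal the left ones because both compute the integral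
of `P^L W P^R`. The second kind functions are Cauchy transforms of densities. They have the Plemelj
jump (`exists_tendsto_cauchyTransform`), are `o(1/z)` at the origin (`tendsto_mul_cauchyTransform`),
and decay at infinity as fast as the number of vanishing moments allows
(`IsDensity.pow_mul_cauchyTransform`). The right problem is the left problem for the transposed
weight. Uniqueness. The determinant is of no help: its `N` singular columns only give `o(z ^ (-N))`
at the origin, which is not removable. Instead a left solution `Y` is paired with a right solution
`Z` through `Y J Z`, where `J = [[0, 1], [-1, 0]]`. The jumps cancel, every entry is a sum of
products of a bounded function and an `o(1/z)` function at the origin, and the limit at infinity is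
`J`. Such a function extends continuously across the loop off the origin; Painlevé's theorem for
Lipschitz curves, Riemann's theorem at the origin and Liouville's theorem give `Y J Z = J`
(`Loop.eq_of_no_jump`, `SolvesLeftRHP.mul_symplecticUnit_mul`). So each left solution is determined
by any one right solution, and conversely. -/

noncomputable section

namespace MatrixBessel

/-! ### Removability of Lipschitz curves for continuous functions -/

/-- The integral of `f` over the boundary of the rectangle `[x₀, x₁] × [y₀, y₁]`. -/
def rectIntegral (f : ℂ → ℂ) (x₀ x₁ y₀ y₁ : ℝ) : ℂ :=
  (∫ x : ℝ in x₀..x₁, f (x + y₀ * Complex.I)) - (∫ x : ℝ in x₀..x₁, f (x + y₁ * Complex.I)) +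
    Complex.I • (∫ y : ℝ in y₀..y₁, f (x₁ + y * Complex.I)) -
    Complex.I • (∫ y : ℝ in y₀..y₁, f (x₀ + y * Complex.I))

lemma rectIntegral_swap_re (f : ℂ → ℂ) (x₀ x₁ y₀ y₁ : ℝ) :
    rectIntegral f x₁ x₀ y₀ y₁ = -rectIntegral f x₀ x₁ y₀ y₁ := by
  simp only [rectIntegral, intervalIntegral.integral_symm x₀ x₁]
  ring

lemma rectIntegral_swap_im (f : ℂ → ℂ) (x₀ x₁ y₀ y₁ : ℝ) :
    rectIntegral f x₀ x₁ y₁ y₀ = -rectIntegral f x₀ x₁ y₀ y₁ := by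
  simp only [rectIntegral, intervalIntegral.integral_symm y₀ y₁, smul_eq_mul]
  ring

lemma intervalIntegrable_horizontal {f : ℂ → ℂ} {x₀ x₁ y : ℝ} {S : Set ℂ} (hf : ContinuousOn f S)
    (h : ∀ x ∈ uIcc x₀ x₁, (x + y * Complex.I : ℂ) ∈ S) :
    IntervalIntegrable (fun x : ℝ => f (x + y * Complex.I)) MeasureTheory.volume x₀ x₁ :=
  (hf.comp (f := fun x : ℝ => (x + y * Complex.I : ℂ)) (by fun_prop) h).intervalIntegrable

lemma intervalIntegrable_vertical {f : ℂ → ℂ} {x y₀ y₁ : ℝ} {S : Set ℂ} (hf : ContinuousOn f S)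
    (h : ∀ y ∈ uIcc y₀ y₁, (x + y * Complex.I : ℂ) ∈ S) :
    IntervalIntegrable (fun y : ℝ => f (x + y * Complex.I)) MeasureTheory.volume y₀ y₁ :=
  (hf.comp (f := fun y : ℝ => (x + y * Complex.I : ℂ)) (by fun_prop) h).intervalIntegrable

lemma mem_reProdIm_mk {S T : Set ℝ} {x y : ℝ} (hx : x ∈ S) (hy : y ∈ T) :
    (x + y * Complex.I : ℂ) ∈ S ×ℂ T := by
  simp [Complex.mem_reProdIm, hx, hy]

/-- The contributions of the vertical sides telescope, since neighbouring rectangles share a side.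
-/
lemma sum_rectIntegral_re {f : ℂ → ℂ} {xs : ℕ → ℝ} {y₀ y₁ : ℝ} {n : ℕ}
    (h₀ : ∀ i < n, IntervalIntegrable (fun x : ℝ => f (x + y₀ * Complex.I))
      MeasureTheory.volume (xs i) (xs (i + 1)))
    (h₁ : ∀ i < n, IntervalIntegrable (fun x : ℝ => f (x + y₁ * Complex.I))
      MeasureTheory.volume (xs i) (xs (i + 1))) :
    ∑ i ∈ Finset.range n, rectIntegral f (xs i) (xs (i + 1)) y₀ y₁
      = rectIntegral f (xs 0) (xs n) y₀ y₁ := by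
  have key : ∀ i, rectIntegral f (xs i) (xs (i + 1)) y₀ y₁ =
      (∫ x : ℝ in xs i..xs (i + 1), f (x + y₀ * Complex.I)) -
      (∫ x : ℝ in xs i..xs (i + 1), f (x + y₁ * Complex.I)) +
      ((fun i => Complex.I • (∫ y : ℝ in y₀..y₁, f (xs i + y * Complex.I))) (i + 1) -
       (fun i => Complex.I • (∫ y : ℝ in y₀..y₁, f (xs i + y * Complex.I))) i) := by
    intro i; simp only [rectIntegral]; ring
  rw [Finset.sum_congr rfl fun i _ => key i, Finset.sum_add_distrib, Finset.sum_sub_distrib,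
    intervalIntegral.sum_integral_adjacent_intervals h₀,
    intervalIntegral.sum_integral_adjacent_intervals h₁,
    Finset.sum_range_sub fun i => Complex.I • (∫ y : ℝ in y₀..y₁, f (xs i + y * Complex.I))]
  simp only [rectIntegral]; ring

lemma sum_rectIntegral_im {f : ℂ → ℂ} {ys : ℕ → ℝ} {x₀ x₁ : ℝ} {n : ℕ}
    (h₀ : ∀ i < n, IntervalIntegrable (fun y : ℝ => f (x₀ + y * Complex.I))
      MeasureTheory.volume (ys i) (ys (i + 1)))
    (h₁ : ∀ i < n, IntervalIntegrable (fun y : ℝ => f (x₁ + y * Complex.I))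
      MeasureTheory.volume (ys i) (ys (i + 1))) :
    ∑ i ∈ Finset.range n, rectIntegral f x₀ x₁ (ys i) (ys (i + 1))
      = rectIntegral f x₀ x₁ (ys 0) (ys n) := by
  have key : ∀ i, rectIntegral f x₀ x₁ (ys i) (ys (i + 1)) =
      Complex.I • (∫ y : ℝ in ys i..ys (i + 1), f (x₁ + y * Complex.I)) -
      Complex.I • (∫ y : ℝ in ys i..ys (i + 1), f (x₀ + y * Complex.I)) -
      ((fun i => (∫ x : ℝ in x₀..x₁, f (x + ys i * Complex.I))) (i + 1) -
       (fun i => (∫ x : ℝ in x₀..x₁, f (x + ys i * Complex.I))) i) := by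
    intro i; simp only [rectIntegral]; ring
  rw [Finset.sum_congr rfl fun i _ => key i, Finset.sum_sub_distrib, Finset.sum_sub_distrib,
    ← Finset.smul_sum, ← Finset.smul_sum,
    intervalIntegral.sum_integral_adjacent_intervals h₀,
    intervalIntegral.sum_integral_adjacent_intervals h₁,
    Finset.sum_range_sub fun i => (∫ x : ℝ in x₀..x₁, f (x + ys i * Complex.I))]
  simp only [rectIntegral]; ring

/-- A constant has zero boundary integral, so only the oscillation of `f` counts, multiplied by the
perimeter. -/
lemma norm_rectIntegral_le {f : ℂ → ℂ} {x₀ x₁ y₀ y₁ ε : ℝ} (hx : x₀ ≤ x₁) (hy : y₀ ≤ y₁)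
    (hf : ContinuousOn f (Icc x₀ x₁ ×ℂ Icc y₀ y₁)) (c : ℂ)
    (h : ∀ z ∈ Icc x₀ x₁ ×ℂ Icc y₀ y₁, ‖f z - c‖ ≤ ε) :
    ‖rectIntegral f x₀ x₁ y₀ y₁‖ ≤ 2 * ε * ((x₁ - x₀) + (y₁ - y₀)) := by
  have key : rectIntegral f x₀ x₁ y₀ y₁ = rectIntegral (fun z => f z - c) x₀ x₁ y₀ y₁ := by
    simp only [rectIntegral]
    rw [intervalIntegral.integral_sub, intervalIntegral.integral_sub,
      intervalIntegral.integral_sub, intervalIntegral.integral_sub]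
    · simp; ring
    all_goals first | exact intervalIntegrable_const | skip
    · exact intervalIntegrable_vertical hf fun y h' =>
        mem_reProdIm_mk ⟨le_rfl, hx⟩ (uIcc_of_le hy ▸ h')
    · exact intervalIntegrable_vertical hf fun y h' =>
        mem_reProdIm_mk ⟨hx, le_rfl⟩ (uIcc_of_le hy ▸ h')
    · exact intervalIntegrable_horizontal hf fun y h' =>
        mem_reProdIm_mk (uIcc_of_le hx ▸ h') ⟨hy, le_rfl⟩
    · exact intervalIntegrable_horizontal hf fun y h' =>
        mem_reProdIm_mk (uIcc_of_le hx ▸ h') ⟨le_rfl, hy⟩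
  have hor : ∀ y ∈ Icc y₀ y₁, ‖∫ x : ℝ in x₀..x₁, (f (x + y * Complex.I) - c)‖
      ≤ ε * (x₁ - x₀) := by
    intro y hy'
    have := intervalIntegral.norm_integral_le_of_norm_le_const (a := x₀) (b := x₁)
      (f := fun x : ℝ => f (x + y * Complex.I) - c) (C := ε) fun x hx' =>
        h _ (mem_reProdIm_mk (Ioc_subset_Icc_self (uIoc_of_le hx ▸ hx')) hy')
    rwa [abs_of_nonneg (by linarith)] at this
  have ver : ∀ x ∈ Icc x₀ x₁, ‖Complex.I • ∫ y : ℝ in y₀..y₁, (f (x + y * Complex.I) - c)‖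
      ≤ ε * (y₁ - y₀) := by
    intro x hx'
    have := intervalIntegral.norm_integral_le_of_norm_le_const (a := y₀) (b := y₁)
      (f := fun y : ℝ => f (x + y * Complex.I) - c) (C := ε) fun y hy' =>
        h _ (mem_reProdIm_mk hx' (Ioc_subset_Icc_self (uIoc_of_le hy ▸ hy')))
    rw [abs_of_nonneg (by linarith)] at this
    simpa [norm_smul] using this
  rw [key, rectIntegral]
  refine (norm_sub_le _ _).trans ?_
  have h1 := hor y₀ ⟨le_rfl, hy⟩
  have h2 := hor y₁ ⟨hy, le_rfl⟩
  have h3 := ver x₀ ⟨le_rfl, hx⟩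
  have h4 := ver x₁ ⟨hx, le_rfl⟩
  have h5 := norm_add_le ((∫ x : ℝ in x₀..x₁, (f (x + y₀ * Complex.I) - c)) -
    (∫ x : ℝ in x₀..x₁, (f (x + y₁ * Complex.I) - c)))
    (Complex.I • ∫ y : ℝ in y₀..y₁, (f (x₁ + y * Complex.I) - c))
  have h6 := norm_sub_le (∫ x : ℝ in x₀..x₁, (f (x + y₀ * Complex.I) - c))
    (∫ x : ℝ in x₀..x₁, (f (x + y₁ * Complex.I) - c))
  linarith

/-! ### Counting the grid cells met by a Lipschitz curve. -/

lemma card_le_of_forall_le_add {S : Finset ℕ} {D : ℕ} (h : ∀ i ∈ S, ∀ j ∈ S, i ≤ j + D) :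
    S.card ≤ D + 1 := by
  rcases S.eq_empty_or_nonempty with rfl | hS
  · simp
  · have : S ⊆ Finset.Icc (S.min' hS) (S.min' hS + D) := fun i hi =>
      Finset.mem_Icc.2 ⟨S.min'_le i hi, h i hi _ (S.min'_mem hS)⟩
    refine (Finset.card_le_card this).trans ?_
    simp; omega

/-- Among the intervals of length `A / n`, those hit by a function of small oscillation are few. -/
lemma card_cells_hit_le {g : ℝ → ℝ} {T : Set ℝ} {a A M : ℝ} {n : ℕ} (hA : 0 < A) (hn : 0 < n)
    (hg : ∀ s ∈ T, ∀ t ∈ T, |g s - g t| ≤ M / n) (S : Finset ℕ)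
    (hS : ∀ i ∈ S, ∃ s ∈ T, g s ∈ Icc (a + i * (A / n)) (a + (i + 1 : ℕ) * (A / n))) :
    S.card ≤ ⌊M / A⌋₊ + 2 := by
  -- If cells `i` and `j` are both hit, the gap `(i - j - 1) * (A / n)` between them is at most the
  -- oscillation `M / n`.
  refine card_le_of_forall_le_add (D := ⌊M / A⌋₊ + 1) fun i hi j hj => ?_
  obtain ⟨s, hs, h1, -⟩ := hS i hi
  obtain ⟨t, ht, -, h2⟩ := hS j hj
  have hn' : (0 : ℝ) < n := by exact_mod_cast hn
  have h3 := (abs_le.1 (hg s hs t ht)).2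
  push_cast at h2
  have h4 : ((i : ℝ) - j - 1) * (A / n) ≤ M / n := by nlinarith
  have h5 : ((i : ℝ) - j - 1) ≤ M / A := by
    rw [le_div_iff₀ hA]
    have : ((i : ℝ) - j - 1) * A / n ≤ M / n := by rw [mul_div_assoc]; exact h4
    exact (div_le_div_iff_of_pos_right hn').1 this
  have h6 := Nat.lt_floor_add_one (M / A)
  have h7 : (i : ℝ) < j + (⌊M / A⌋₊ + 1) + 1 := by linarith
  have h8 : i < j + (⌊M / A⌋₊ + 1) + 1 := by exact_mod_cast h7
  omega

/-- A Lipschitz curve meets only `O(n)` cells of an `n × n` grid. -/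
lemma card_grid_hit_le {c : ℝ → ℂ} {M a b A B : ℝ}
    (hc : ∀ s ∈ Icc (0 : ℝ) 1, ∀ t ∈ Icc (0 : ℝ) 1, ‖c s - c t‖ ≤ M * |s - t|) (hM : 0 ≤ M)
    (hA : 0 < A) (hB : 0 < B) {n : ℕ} (hn : 0 < n) (S : Finset (ℕ × ℕ))
    (hS : ∀ p ∈ S, ∃ s ∈ Icc (0 : ℝ) 1,
      c s ∈ Icc (a + p.1 * (A / n)) (a + (p.1 + 1 : ℕ) * (A / n)) ×ℂ
        Icc (b + p.2 * (B / n)) (b + (p.2 + 1 : ℕ) * (B / n))) :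
    S.card ≤ n * ((⌊M / A⌋₊ + 2) * (⌊M / B⌋₊ + 2)) := by
  classical
  have hn' : (0 : ℝ) < n := by exact_mod_cast hn
  -- The parameter interval is cut into `n` pieces. On each the curve moves by at most `M / n`,
  -- hence meets a number of cells independent of `n`.
  let J : ℕ → Set ℝ := fun k => Icc 0 1 ∩ Icc ((k : ℝ) / n) ((k + 1 : ℝ) / n)
  have hJ : ∀ s ∈ Icc (0 : ℝ) 1, ∃ k < n, s ∈ J k := by
    intro s hs
    rcases hs.2.lt_or_eq with h1 | h1
    · refine ⟨⌊s * n⌋₊, ?_, hs, ?_, ?_⟩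
      · rw [Nat.floor_lt (by nlinarith [hs.1])]; nlinarith
      · rw [div_le_iff₀ hn']; exact Nat.floor_le (by nlinarith [hs.1])
      · rw [le_div_iff₀ hn']; exact (Nat.lt_floor_add_one _).le
    -- At `s = 1` the floor would be `n`, which is out of range; the last piece contains this point.
    · refine ⟨n - 1, by omega, hs, ?_, ?_⟩
      · rw [div_le_iff₀ hn', h1, Nat.cast_sub (by omega)]; push_cast; linarith
      · rw [le_div_iff₀ hn', h1, Nat.cast_sub (by omega)]; push_cast; linarith
  have hosc : ∀ k, ∀ s ∈ J k, ∀ t ∈ J k, ‖c s - c t‖ ≤ M / n := by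
    intro k s hs t ht
    refine (hc s hs.1 t ht.1).trans ?_
    rw [div_eq_mul_one_div]
    refine mul_le_mul_of_nonneg_left ?_ hM
    have h1 := hs.2.1; have h2 := hs.2.2; have h3 := ht.2.1; have h4 := ht.2.2
    have h5 : ((k : ℝ) + 1) / n = k / n + 1 / n := by ring
    rw [abs_le]; constructor <;> linarith
  let Sk : ℕ → Finset (ℕ × ℕ) := fun k => S.filter fun p => ∃ s ∈ J k,
    c s ∈ Icc (a + p.1 * (A / n)) (a + (p.1 + 1 : ℕ) * (A / n)) ×ℂ
        Icc (b + p.2 * (B / n)) (b + (p.2 + 1 : ℕ) * (B / n))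
  have hcover : S ⊆ (Finset.range n).biUnion Sk := by
    intro p hp
    obtain ⟨s, hs, hps⟩ := hS p hp
    obtain ⟨k, hk, hsk⟩ := hJ s hs
    exact Finset.mem_biUnion.2 ⟨k, Finset.mem_range.2 hk, Finset.mem_filter.2 ⟨hp, s, hsk, hps⟩⟩
  have hcard : ∀ k, (Sk k).card ≤ (⌊M / A⌋₊ + 2) * (⌊M / B⌋₊ + 2) := by
    intro k
    have h1 : Sk k ⊆ (Sk k).image Prod.fst ×ˢ (Sk k).image Prod.snd := fun p hp =>
      Finset.mem_product.2 ⟨Finset.mem_image_of_mem _ hp, Finset.mem_image_of_mem _ hp⟩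
    refine (Finset.card_le_card h1).trans ?_
    rw [Finset.card_product]
    refine Nat.mul_le_mul ?_ ?_
    · refine card_cells_hit_le (g := fun s => (c s).re) (T := J k) (a := a) hA hn
        (fun s hs t ht => ?_) _ fun i hi => ?_
      · rw [← Complex.sub_re]; exact (Complex.abs_re_le_norm _).trans (hosc k s hs t ht)
      · obtain ⟨p, hp, rfl⟩ := Finset.mem_image.1 hi
        obtain ⟨s, hs, hps⟩ := (Finset.mem_filter.1 hp).2
        exact ⟨s, hs, hps.1⟩
    · refine card_cells_hit_le (g := fun s => (c s).im) (T := J k) (a := b) hB hn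
        (fun s hs t ht => ?_) _ fun i hi => ?_
      · rw [← Complex.sub_im]; exact (Complex.abs_im_le_norm _).trans (hosc k s hs t ht)
      · obtain ⟨p, hp, rfl⟩ := Finset.mem_image.1 hi
        obtain ⟨s, hs, hps⟩ := (Finset.mem_filter.1 hp).2
        exact ⟨s, hs, hps.2⟩
  calc S.card ≤ ((Finset.range n).biUnion Sk).card := Finset.card_le_card hcover
    _ ≤ (Finset.range n).card * ((⌊M / A⌋₊ + 2) * (⌊M / B⌋₊ + 2)) :=
        Finset.card_biUnion_le_card_mul _ _ _ fun k _ => hcard k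
    _ = _ := by rw [Finset.card_range]

lemma rectIntegral_eq_zero_of_differentiable {f : ℂ → ℂ} {x₀ x₁ y₀ y₁ : ℝ} (hx : x₀ ≤ x₁)
    (hy : y₀ ≤ y₁) (hf : ∀ z ∈ Icc x₀ x₁ ×ℂ Icc y₀ y₁, DifferentiableAt ℂ f z) :
    rectIntegral f x₀ x₁ y₀ y₁ = 0 := by
  refine Complex.integral_boundary_rect_eq_zero_of_differentiableOn f ⟨x₀, y₀⟩ ⟨x₁, y₁⟩ ?_
  simp only [uIcc_of_le hx, uIcc_of_le hy]
  exact fun z hz => (hf z hz).differentiableWithinAt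

/-- In an `n × n` subdivision the cells off the curve contribute zero by Cauchy's theorem. At most
`n * K` cells meet the curve, and each contributes at most a small oscillation times a perimeter of
order `1 / n`, so the total is arbitrarily small. -/
lemma rectIntegral_eq_zero_of_lipschitz_curve {c : ℝ → ℂ} {M : ℝ}
    (hc : ∀ s ∈ Icc (0 : ℝ) 1, ∀ t ∈ Icc (0 : ℝ) 1, ‖c s - c t‖ ≤ M * |s - t|) (hM : 0 ≤ M)
    {f : ℂ → ℂ} {a b A B : ℝ} (hA : 0 < A) (hB : 0 < B)
    (hf : ContinuousOn f (Icc a (a + A) ×ℂ Icc b (b + B)))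
    (hd : ∀ z ∈ Icc a (a + A) ×ℂ Icc b (b + B), z ∉ c '' Icc 0 1 → DifferentiableAt ℂ f z) :
    rectIntegral f a (a + A) b (b + B) = 0 := by
  classical
  rw [← norm_le_zero_iff]
  refine le_of_forall_pos_le_add fun ε hε => ?_
  set K : ℕ := (⌊M / A⌋₊ + 2) * (⌊M / B⌋₊ + 2) with hK
  have hKpos : (0 : ℝ) < K := by rw [hK]; positivity
  -- Chosen so that `n * K` cells, each contributing `2 * ε' * (A + B) / n`, add up to exactly `ε`.
  set ε' : ℝ := ε / (2 * K * (A + B)) with hε'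
  have hε'pos : 0 < ε' := by positivity
  have hcomp : IsCompact (Icc a (a + A) ×ℂ Icc b (b + B)) := isCompact_Icc.reProdIm isCompact_Icc
  obtain ⟨δ, hδ, huc⟩ := Metric.uniformContinuousOn_iff_le.1
    (hcomp.uniformContinuousOn_of_continuous hf) ε' hε'pos
  obtain ⟨n, hn⟩ := exists_nat_gt ((A + B) / δ)
  have hn0' : (0 : ℝ) < n := lt_of_le_of_lt (by positivity) hn
  have hn0 : 0 < n := by exact_mod_cast hn0'
  have hmesh : A / n + B / n ≤ δ := by
    rw [← add_div, div_le_iff₀ hn0']; rw [div_lt_iff₀ hδ] at hn; linarith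
  let xs : ℕ → ℝ := fun i => a + i * (A / n)
  let ys : ℕ → ℝ := fun i => b + i * (B / n)
  have hX : ∀ i ≤ n, xs i ∈ Icc a (a + A) := by
    intro i hi
    have hi' : (i : ℝ) ≤ n := by exact_mod_cast hi
    refine ⟨by simp only [xs, le_add_iff_nonneg_right]; positivity, ?_⟩
    have : (i : ℝ) * (A / n) ≤ n * (A / n) := by gcongr
    rw [mul_div_cancel₀ _ hn0'.ne'] at this
    simp only [xs]; linarith
  have hY : ∀ i ≤ n, ys i ∈ Icc b (b + B) := by
    intro i hi
    have hi' : (i : ℝ) ≤ n := by exact_mod_cast hi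
    refine ⟨by simp only [ys, le_add_iff_nonneg_right]; positivity, ?_⟩
    have : (i : ℝ) * (B / n) ≤ n * (B / n) := by gcongr
    rw [mul_div_cancel₀ _ hn0'.ne'] at this
    simp only [ys]; linarith
  have hXs : ∀ i, xs (i + 1) = xs i + A / n := fun i => by simp only [xs]; push_cast; ring
  have hYs : ∀ i, ys (i + 1) = ys i + B / n := fun i => by simp only [ys]; push_cast; ring
  have hAn : 0 < A / n := by positivity
  have hBn : 0 < B / n := by positivity
  have hsub : ∀ i < n, ∀ j < n, Icc (xs i) (xs (i + 1)) ×ℂ Icc (ys j) (ys (j + 1)) ⊆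
      Icc a (a + A) ×ℂ Icc b (b + B) := by
    intro i hi j hj z hz
    exact ⟨Icc_subset_Icc (hX i hi.le).1 (hX (i + 1) hi).2 hz.1,
      Icc_subset_Icc (hY j hj.le).1 (hY (j + 1) hj).2 hz.2⟩
  have hgrid : rectIntegral f a (a + A) b (b + B) = ∑ p ∈ Finset.range n ×ˢ Finset.range n,
      rectIntegral f (xs p.1) (xs (p.1 + 1)) (ys p.2) (ys (p.2 + 1)) := by
    have e1 : rectIntegral f a (a + A) b (b + B) = rectIntegral f (xs 0) (xs n) (ys 0) (ys n) := by
      simp only [xs, ys, mul_div_cancel₀ _ hn0'.ne']; simp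
    rw [e1, Finset.sum_product, ← sum_rectIntegral_re]
    · refine Finset.sum_congr rfl fun i hi => (sum_rectIntegral_im ?_ ?_).symm
      all_goals
        intro j hj
        have hi := Finset.mem_range.1 hi
        refine intervalIntegrable_vertical hf fun y hy => mem_reProdIm_mk ?_ ?_
        · first | exact hX i hi.le | exact hX (i + 1) hi
        · rw [uIcc_of_le (by rw [hYs]; linarith)] at hy
          exact Icc_subset_Icc (hY j hj.le).1 (hY (j + 1) hj).2 hy
    all_goals
      intro i hi
      refine intervalIntegrable_horizontal hf fun x hx => mem_reProdIm_mk ?_ ?_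
      · rw [uIcc_of_le (by rw [hXs]; linarith)] at hx
        exact Icc_subset_Icc (hX i hi.le).1 (hX (i + 1) hi).2 hx
      · first | exact hY 0 (Nat.zero_le n) | exact hY n le_rfl
  set S : Finset (ℕ × ℕ) := (Finset.range n ×ˢ Finset.range n).filter fun p =>
    ∃ s ∈ Icc (0 : ℝ) 1, c s ∈ Icc (xs p.1) (xs (p.1 + 1)) ×ℂ Icc (ys p.2) (ys (p.2 + 1)) with hSdef
  have hScard : S.card ≤ n * K :=
    card_grid_hit_le (a := a) (b := b) hc hM hA hB hn0 S fun p hp => (Finset.mem_filter.1 hp).2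
  have hsum : rectIntegral f a (a + A) b (b + B) = ∑ p ∈ S,
      rectIntegral f (xs p.1) (xs (p.1 + 1)) (ys p.2) (ys (p.2 + 1)) := by
    rw [hgrid]
    refine (Finset.sum_subset (Finset.filter_subset _ _) fun p hp hpS => ?_).symm
    have hp' := Finset.mem_product.1 hp
    refine rectIntegral_eq_zero_of_differentiable (by rw [hXs]; linarith) (by rw [hYs]; linarith)
      fun z hz => hd z (hsub _ (Finset.mem_range.1 hp'.1) _ (Finset.mem_range.1 hp'.2) hz) ?_
    rintro ⟨s, hs, rfl⟩
    exact hpS (Finset.mem_filter.2 ⟨hp, s, hs, hz⟩)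
  have hbound : ∀ p ∈ S, ‖rectIntegral f (xs p.1) (xs (p.1 + 1)) (ys p.2) (ys (p.2 + 1))‖ ≤
      2 * ε' * (A / n + B / n) := by
    intro p hp
    have hp' := Finset.mem_product.1 (Finset.mem_filter.1 hp).1
    have hs := hsub _ (Finset.mem_range.1 hp'.1) _ (Finset.mem_range.1 hp'.2)
    have hcorner : (⟨xs p.1, ys p.2⟩ : ℂ) ∈
        Icc (xs p.1) (xs (p.1 + 1)) ×ℂ Icc (ys p.2) (ys (p.2 + 1)) :=
      ⟨⟨le_rfl, by rw [hXs]; linarith⟩, ⟨le_rfl, by rw [hYs]; linarith⟩⟩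
    have := norm_rectIntegral_le (f := f) (x₀ := xs p.1) (x₁ := xs (p.1 + 1)) (y₀ := ys p.2)
      (y₁ := ys (p.2 + 1)) (ε := ε') (by rw [hXs]; linarith) (by rw [hYs]; linarith) (hf.mono hs)
      (f ⟨xs p.1, ys p.2⟩) fun z hz => by
        rw [← dist_eq_norm]
        refine huc z (hs hz) _ (hs hcorner) ?_
        rw [Complex.dist_eq]
        refine (Complex.norm_le_abs_re_add_abs_im _).trans (le_trans ?_ hmesh)
        obtain ⟨⟨h1, h2⟩, ⟨h3, h4⟩⟩ := hz
        rw [hXs] at h2; rw [hYs] at h4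
        refine add_le_add ?_ ?_
        · rw [Complex.sub_re, abs_le]; constructor <;> simp only <;> linarith
        · rw [Complex.sub_im, abs_le]; constructor <;> simp only <;> linarith
    refine this.trans (le_of_eq ?_)
    rw [hXs, hYs]; ring
  rw [hsum, zero_add]
  refine (norm_sum_le_of_le _ hbound).trans ?_
  rw [Finset.sum_const, nsmul_eq_mul]
  have h1 : (S.card : ℝ) ≤ n * K := by exact_mod_cast hScard
  calc (S.card : ℝ) * (2 * ε' * (A / n + B / n)) ≤ n * K * (2 * ε' * (A / n + B / n)) := by
        gcongr
    _ = ε := by rw [hε']; field_simp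

/-- **Painlevé's theorem** for Lipschitz curves: a continuous function on an open set that is
holomorphic off a Lipschitz curve is holomorphic. -/
theorem differentiableOn_of_lipschitz_curve {c : ℝ → ℂ} {M : ℝ}
    (hc : ∀ s ∈ Icc (0 : ℝ) 1, ∀ t ∈ Icc (0 : ℝ) 1, ‖c s - c t‖ ≤ M * |s - t|) (hM : 0 ≤ M)
    {U : Set ℂ} (hU : IsOpen U) {f : ℂ → ℂ} (hf : ContinuousOn f U)
    (hd : ∀ z ∈ U, z ∉ c '' Icc 0 1 → DifferentiableAt ℂ f z) : DifferentiableOn ℂ f U := by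
  -- Morera's theorem: it is enough that the boundary integrals over rectangles vanish. Degenerate
  -- rectangles are trivial, and reversed ones differ by a sign.
  refine (Complex.isConservativeOn_and_continuousOn_iff_isDifferentiableOn hU).1 ⟨?_, hf⟩
  have key : ∀ x₀ x₁ y₀ y₁ : ℝ, x₀ < x₁ → y₀ < y₁ → Icc x₀ x₁ ×ℂ Icc y₀ y₁ ⊆ U →
      rectIntegral f x₀ x₁ y₀ y₁ = 0 := by
    intro x₀ x₁ y₀ y₁ hx hy hsub
    have := rectIntegral_eq_zero_of_lipschitz_curve (f := f) (a := x₀) (b := y₀) hc hM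
      (sub_pos.2 hx) (sub_pos.2 hy) (hf.mono (by simpa using hsub))
      (fun z hz => hd z (hsub (by simpa using hz)))
    simpa using this
  intro z w hzw
  rw [← add_eq_zero_iff_eq_neg, Complex.wedgeIntegral_add_wedgeIntegral_eq]
  change rectIntegral f z.re w.re z.im w.im = 0
  rw [Complex.Rectangle] at hzw
  rcases lt_trichotomy z.re w.re with h1 | h1 | h1
  · rcases lt_trichotomy z.im w.im with h2 | h2 | h2
    · exact key _ _ _ _ h1 h2 (by rwa [uIcc_of_le h1.le, uIcc_of_le h2.le] at hzw)
    · simp [rectIntegral, h2]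
    · rw [rectIntegral_swap_im, key _ _ _ _ h1 h2, neg_zero]
      rwa [uIcc_of_le h1.le, uIcc_of_ge h2.le] at hzw
  · simp [rectIntegral, h1]
  · rcases lt_trichotomy z.im w.im with h2 | h2 | h2
    · rw [rectIntegral_swap_re, key _ _ _ _ h1 h2, neg_zero]
      rwa [uIcc_of_ge h1.le, uIcc_of_le h2.le] at hzw
    · simp [rectIntegral, h2]
    · rw [rectIntegral_swap_re, rectIntegral_swap_im, key _ _ _ _ h1 h2, neg_zero, neg_zero]
      rwa [uIcc_of_ge h1.le, uIcc_of_ge h2.le] at hzw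

/-! ### Short arcs -/

/-- A short arc: the derivative is bounded and stays in a half plane away from the origin. -/
structure IsArc (c : ℝ → ℂ) (η M m : ℝ) (τ : ℂ) : Prop where
  length_pos : 0 < η
  continuousOn : ContinuousOn c (Icc 0 η)
  differentiableAt : ∀ u ∈ Ioo 0 η, DifferentiableAt ℝ c u
  continuousOn_deriv : ContinuousOn (deriv c) (Ioo 0 η)
  norm_deriv_le : ∀ u ∈ Ioo 0 η, ‖deriv c u‖ ≤ M
  slope_pos : 0 < m
  norm_direction_le : ‖τ‖ ≤ 1
  le_re_deriv : ∀ u ∈ Ioo 0 η, m ≤ (τ * deriv c u).re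

namespace IsArc

variable {c : ℝ → ℂ} {η M m : ℝ} {τ : ℂ}

lemma mono (h : IsArc c η M m τ) {η' : ℝ} (h0 : 0 < η') (h1 : η' ≤ η) : IsArc c η' M m τ where
  length_pos := h0
  continuousOn := h.continuousOn.mono (Icc_subset_Icc_right h1)
  differentiableAt u hu := h.differentiableAt u (Ioo_subset_Ioo_right h1 hu)
  continuousOn_deriv := h.continuousOn_deriv.mono (Ioo_subset_Ioo_right h1)
  norm_deriv_le u hu := h.norm_deriv_le u (Ioo_subset_Ioo_right h1 hu)
  slope_pos := h.slope_pos
  norm_direction_le := h.norm_direction_le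
  le_re_deriv u hu := h.le_re_deriv u (Ioo_subset_Ioo_right h1 hu)

lemma bound_nonneg (h : IsArc c η M m τ) : 0 ≤ M :=
  (norm_nonneg _).trans (h.norm_deriv_le (η / 2) ⟨half_pos h.length_pos, half_lt_self h.length_pos⟩)

lemma intervalIntegrable_deriv (h : IsArc c η M m τ) {u v : ℝ} (hu : 0 ≤ u) (huv : u ≤ v)
    (hv : v ≤ η) : IntervalIntegrable (deriv c) MeasureTheory.volume u v := by
  rw [intervalIntegrable_iff_integrableOn_Ioo_of_le huv]
  refine MeasureTheory.Measure.integrableOn_of_bounded (M := M) (by simp)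
    (measurable_deriv c).aestronglyMeasurable ?_
  exact (MeasureTheory.ae_restrict_iff' measurableSet_Ioo).2
    (.of_forall fun x hx => h.norm_deriv_le x ⟨hu.trans_lt hx.1, hx.2.trans_le hv⟩)

lemma norm_sub_le (h : IsArc c η M m τ) {u v : ℝ} (hu : 0 ≤ u) (huv : u ≤ v) (hv : v ≤ η) :
    ‖c v - c u‖ ≤ M * (v - u) := by
  have key : ∫ x in u..v, deriv c x = c v - c u :=
    intervalIntegral.integral_eq_sub_of_hasDerivAt_of_le huv
      (h.continuousOn.mono (Icc_subset_Icc hu hv))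
      (fun x hx => (h.differentiableAt x ⟨hu.trans_lt hx.1, hx.2.trans_le hv⟩).hasDerivAt)
      (h.intervalIntegrable_deriv hu huv hv)
  rw [← key, ← abs_of_nonneg (sub_nonneg.2 huv)]
  refine intervalIntegral.norm_integral_le_of_norm_le_const_ae ?_
  have : ∀ᵐ x : ℝ, x ≠ v := by simp [MeasureTheory.ae_iff]
  filter_upwards [this] with x hxv hx
  rw [uIoc_of_le huv] at hx
  exact h.norm_deriv_le x ⟨hu.trans_lt hx.1, (lt_of_le_of_ne hx.2 hxv).trans_le hv⟩

/-- The half plane condition on the derivative makes one coordinate of the arc grow at rate at least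
`m`. All lower bounds for distances to the arc come from this coordinate. -/
lemma le_re_sub (h : IsArc c η M m τ) (z : ℂ) {u v : ℝ} (hu : 0 ≤ u) (huv : u ≤ v) (hv : v ≤ η) :
    m * (v - u) ≤ (τ * (c v - z)).re - (τ * (c u - z)).re := by
  have hd : ∀ x ∈ Ioo 0 η, HasDerivAt (fun x => (τ * (c x - z)).re) (τ * deriv c x).re x := by
    intro x hx
    have h1 := ((h.differentiableAt x hx).hasDerivAt.sub_const z).const_mul τ
    exact (Complex.reCLM.hasFDerivAt.comp_hasDerivAt x h1)
  refine Convex.mul_sub_le_image_sub_of_le_deriv (convex_Icc 0 η)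
    (f := fun x => (τ * (c x - z)).re) ?_ ?_ ?_ u ⟨hu, huv.trans hv⟩ v ⟨hu.trans huv, hv⟩ huv
  · exact Complex.continuous_re.comp_continuousOn
      (continuousOn_const.mul (h.continuousOn.sub continuousOn_const))
  · rw [interior_Icc]
    exact fun x hx => (hd x hx).differentiableAt.differentiableWithinAt
  · rw [interior_Icc]
    intro x hx
    rw [(hd x hx).deriv]
    exact h.le_re_deriv x hx

lemma continuousOn_re (h : IsArc c η M m τ) (z : ℂ) :
    ContinuousOn (fun u => (τ * (c u - z)).re) (Icc 0 η) :=
  Complex.continuous_re.comp_continuousOn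
    (continuousOn_const.mul (h.continuousOn.sub continuousOn_const))

lemma abs_re_le (h : IsArc c η M m τ) (z : ℂ) (u : ℝ) : |(τ * (c u - z)).re| ≤ ‖c u - z‖ := by
  refine (Complex.abs_re_le_norm _).trans ?_
  rw [norm_mul]
  exact mul_le_of_le_one_left (norm_nonneg _) h.norm_direction_le

/-- Seen from any point `z`, the arc moves away linearly from some parameter on. -/
lemma exists_le_norm_sub (h : IsArc c η M m τ) (z : ℂ) :
    ∃ u₀ ∈ Icc 0 η, ∀ u ∈ Icc 0 η, m * |u - u₀| ≤ ‖c u - z‖ := by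
  have hη := h.length_pos.le
  set g := fun u => (τ * (c u - z)).re with hg
  have hmono : ∀ u v, 0 ≤ u → u ≤ v → v ≤ η → m * (v - u) ≤ g v - g u :=
    fun u v hu huv hv => h.le_re_sub z hu huv hv
  have habs : ∀ u, |g u| ≤ ‖c u - z‖ := h.abs_re_le z
  -- The increasing function `g` is nonnegative at the start, nonpositive at the end, or has a zero;
  -- accordingly `u₀` is `0`, `η` or that zero.
  rcases le_total 0 (g 0) with h0 | h0
  · refine ⟨0, ⟨le_rfl, hη⟩, fun u hu => ?_⟩
    rw [sub_zero, abs_of_nonneg hu.1]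
    have := hmono 0 u le_rfl hu.1 hu.2
    linarith [habs u, le_abs_self (g u)]
  rcases le_total (g η) 0 with h1 | h1
  · refine ⟨η, ⟨hη, le_rfl⟩, fun u hu => ?_⟩
    rw [abs_sub_comm, abs_of_nonneg (sub_nonneg.2 hu.2)]
    have := hmono u η hu.1 hu.2 le_rfl
    linarith [habs u, neg_abs_le (g u)]
  obtain ⟨u₀, hu₀, hz⟩ := intermediate_value_Icc hη (h.continuousOn_re z) ⟨h0, h1⟩
  replace hz : g u₀ = 0 := hz
  refine ⟨u₀, hu₀, fun u hu => ?_⟩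
  rcases le_total u u₀ with h2 | h2
  · rw [abs_sub_comm, abs_of_nonneg (sub_nonneg.2 h2)]
    have := hmono u u₀ hu.1 h2 hu₀.2
    linarith [habs u, neg_abs_le (g u)]
  · rw [abs_of_nonneg (sub_nonneg.2 h2)]
    have := hmono u₀ u hu₀.1 h2 hu.2
    linarith [habs u, le_abs_self (g u)]

lemma direction_ne_zero (h : IsArc c η M m τ) : τ ≠ 0 := by
  rintro rfl
  have := h.le_re_deriv (η / 2) ⟨half_pos h.length_pos, half_lt_self h.length_pos⟩
  simp at this
  linarith [h.slope_pos]

/-- The curve `τ * (c u - z)` crosses the imaginary axis at most once, and not at the origin.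
Multiplication by `I` or `-I` turns that axis into the real axis and puts the crossing on its
positive half, so one branch of the logarithm serves the whole arc. -/
lemma exists_slitPlane (h : IsArc c η M m τ) {z : ℂ} (hz : z ∉ c '' Icc 0 η) :
    ∃ ω : ℂ, ω ≠ 0 ∧ ∀ u ∈ Icc 0 η, ω * (c u - z) ∈ Complex.slitPlane := by
  set g := fun u => (τ * (c u - z)).re with hg
  have hτ := h.direction_ne_zero
  have hinj : ∀ u ∈ Icc 0 η, ∀ v ∈ Icc 0 η, g u = g v → u = v := by
    intro u hu v hv huv
    rcases le_total u v with h1 | h1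
    · have := h.le_re_sub z hu.1 h1 hv.2
      simp only [hg] at huv
      rw [huv, sub_self] at this
      nlinarith [h.slope_pos]
    · have := h.le_re_sub z hv.1 h1 hu.2
      simp only [hg] at huv
      rw [huv, sub_self] at this
      nlinarith [h.slope_pos]
  by_cases hex : ∃ u₀ ∈ Icc 0 η, g u₀ = 0
  · obtain ⟨u₀, hu₀, h0⟩ := hex
    have hne : τ * (c u₀ - z) ≠ 0 :=
      mul_ne_zero hτ (sub_ne_zero.2 fun h' => hz ⟨u₀, hu₀, h'⟩)
    have him : (τ * (c u₀ - z)).im ≠ 0 := fun h' => hne (Complex.ext h0 h')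
    rcases him.lt_or_gt with hlt | hgt
    · refine ⟨Complex.I * τ, mul_ne_zero Complex.I_ne_zero hτ, fun u hu => ?_⟩
      rw [mul_assoc, Complex.mem_slitPlane_iff, Complex.I_mul_re, Complex.I_mul_im]
      by_cases h' : g u = 0
      · left; rw [hinj u hu u₀ hu₀ (h'.trans h0.symm)]; linarith
      · exact Or.inr h'
    · refine ⟨-Complex.I * τ, mul_ne_zero (neg_ne_zero.2 Complex.I_ne_zero) hτ, fun u hu => ?_⟩
      rw [neg_mul, neg_mul, mul_assoc, Complex.mem_slitPlane_iff, Complex.neg_re, Complex.neg_im,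
        Complex.I_mul_re, Complex.I_mul_im]
      by_cases h' : g u = 0
      · left; rw [hinj u hu u₀ hu₀ (h'.trans h0.symm)]; linarith
      · exact Or.inr (neg_ne_zero.2 h')
  · push Not at hex
    refine ⟨Complex.I * τ, mul_ne_zero Complex.I_ne_zero hτ, fun u hu => ?_⟩
    rw [mul_assoc, Complex.mem_slitPlane_iff, Complex.I_mul_re, Complex.I_mul_im]
    exact Or.inr (hex u hu)

lemma intervalIntegrable_deriv_div (h : IsArc c η M m τ) {z : ℂ} (hz : z ∉ c '' Icc 0 η) :
    IntervalIntegrable (fun u => (c u - z)⁻¹ * deriv c u) MeasureTheory.volume 0 η := by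
  refine (h.intervalIntegrable_deriv le_rfl h.length_pos.le le_rfl).continuousOn_mul ?_
  rw [uIcc_of_le h.length_pos.le]
  exact (h.continuousOn.sub continuousOn_const).inv₀ fun u hu =>
    sub_ne_zero.2 fun h' => hz ⟨u, hu, h'⟩

/-- The logarithmic integral over an arc, seen from a point off the arc. -/
lemma norm_integral_deriv_div_le (h : IsArc c η M m τ) {z : ℂ} (hz : z ∉ c '' Icc 0 η) :
    ‖∫ u in (0 : ℝ)..η, (c u - z)⁻¹ * deriv c u‖ ≤
      |Real.log ‖c η - z‖| + |Real.log ‖c 0 - z‖| + 2 * Real.pi := by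
  -- The principal logarithm of `ω * (c u - z)` is a primitive. Its imaginary part is at most `π` in
  -- modulus at both ends, which makes the term `2π` uniform in `z`; the contributions of `log ‖ω‖`
  -- cancel.
  obtain ⟨ω, hω, hslit⟩ := h.exists_slitPlane hz
  have hη := h.length_pos.le
  have key : ∫ u in (0 : ℝ)..η, (c u - z)⁻¹ * deriv c u =
      Complex.log (ω * (c η - z)) - Complex.log (ω * (c 0 - z)) := by
    refine intervalIntegral.integral_eq_sub_of_hasDerivAt_of_le
      (f := fun u => Complex.log (ω * (c u - z))) hη ?_ ?_ (h.intervalIntegrable_deriv_div hz)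
    · exact ContinuousOn.clog
        (continuousOn_const.mul (h.continuousOn.sub continuousOn_const)) hslit
    · intro u hu
      have h1 := (((h.differentiableAt u hu).hasDerivAt.sub_const z).const_mul ω).clog_real
        (hslit u (Ioo_subset_Icc_self hu))
      rw [mul_div_mul_left _ _ hω, div_eq_inv_mul] at h1
      exact h1
  rw [key]
  have hn : ∀ u ∈ Icc 0 η, Real.log ‖ω * (c u - z)‖ = Real.log ‖ω‖ + Real.log ‖c u - z‖ := by
    intro u hu
    rw [norm_mul, Real.log_mul (norm_ne_zero_iff.2 hω)
      (norm_ne_zero_iff.2 (sub_ne_zero.2 fun h' => hz ⟨u, hu, h'⟩))]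
  refine (Complex.norm_le_abs_re_add_abs_im _).trans ?_
  refine add_le_add ?_ ?_
  · rw [Complex.sub_re, Complex.log_re, Complex.log_re, hn η ⟨hη, le_rfl⟩, hn 0 ⟨le_rfl, hη⟩,
      add_sub_add_left_eq_sub]
    exact abs_sub _ _
  · rw [Complex.sub_im, Complex.log_im, Complex.log_im]
    refine (abs_sub _ _).trans ?_
    linarith [Complex.abs_arg_le_pi (ω * (c η - z)), Complex.abs_arg_le_pi (ω * (c 0 - z))]

end IsArc

/-! ### Loops -/

namespace Loop

variable (γ : Loop)

lemma exists_Ico_piece {k : ℕ} {s : ℕ → ℝ} {x : ℝ} (h0 : s 0 ≤ x) (hk : x < s k) :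
    ∃ i < k, s i ≤ x ∧ x < s (i + 1) := by
  induction k with
  | zero => linarith
  | succ k ih =>
    rcases lt_or_ge x (s k) with h | h
    · obtain ⟨i, hi, h'⟩ := ih h
      exact ⟨i, by omega, h'⟩
    · exact ⟨k, by omega, h, hk⟩

lemma exists_Ioc_piece {k : ℕ} {s : ℕ → ℝ} {x : ℝ} (h0 : s 0 < x) (hk : x ≤ s k) :
    ∃ i < k, s i < x ∧ x ≤ s (i + 1) := by
  induction k with
  | zero => linarith
  | succ k ih =>
    rcases le_or_gt x (s k) with h | h
    · obtain ⟨i, hi, h'⟩ := ih h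
      exact ⟨i, by omega, h'⟩
    · exact ⟨k, by omega, h, hk⟩

/-- The one-sided derivative is continuous and nonzero at `s₀`, so on a short enough interval it
stays close to its value there. The sign `σ` treats the arcs leaving `s₀` forwards and backwards
together. -/
lemma isArc_of_piece {f : ℝ → ℂ} {a b s₀ σ η₀ : ℝ} (hab : a < b)
    (hf : ContDiffOn ℝ 1 f (Icc a b))
    (hne : derivWithin f (Icc a b) s₀ ≠ 0) (hσ : σ = 1 ∨ σ = -1) (hη₀ : 0 < η₀)
    (hmem : ∀ u ∈ Icc 0 η₀, s₀ + σ * u ∈ Icc a b) :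
    ∃ η M m τ, η ≤ η₀ ∧ IsArc (fun u => f (s₀ + σ * u)) η M m τ := by
  set d := derivWithin f (Icc a b) with hd
  have hdc : ContinuousOn d (Icc a b) :=
    hf.continuousOn_derivWithin (uniqueDiffOn_Icc hab) le_rfl
  have hn : 0 < ‖d s₀‖ := norm_pos_iff.2 hne
  have hσ2 : σ * σ = 1 := by rcases hσ with rfl | rfl <;> norm_num
  have hσabs : |σ| = 1 := by rcases hσ with rfl | rfl <;> norm_num
  -- The conjugate unit tangent at `s₀`, in the direction of travel: it rotates the initial velocity
  -- onto the positive real axis.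
  set τ : ℂ := (σ : ℂ) * (starRingEnd ℂ (d s₀)) / ‖d s₀‖ with hτ
  have hcomp : ContinuousOn (fun u : ℝ => d (s₀ + σ * u)) (Icc 0 η₀) :=
    hdc.comp (by fun_prop) hmem
  have hc0 := hcomp 0 ⟨le_rfl, hη₀.le⟩
  have h1 : ∀ᶠ u in 𝓝[Icc 0 η₀] (0 : ℝ), ‖d (s₀ + σ * u)‖ < 2 * ‖d s₀‖ := by
    refine hc0.norm.eventually_lt_const ?_
    simp only [mul_zero, add_zero]; linarith
  have hre0 : (τ * ((σ : ℂ) * d s₀)).re = ‖d s₀‖ := by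
    have : τ * ((σ : ℂ) * d s₀) = ((‖d s₀‖ : ℝ) : ℂ) := by
      rw [hτ]
      have e1 : (σ : ℂ) * (starRingEnd ℂ (d s₀)) / ‖d s₀‖ * (σ * d s₀) =
        ((σ * σ : ℝ) : ℂ) * (starRingEnd ℂ (d s₀) * d s₀) / ‖d s₀‖ := by push_cast; ring
      rw [e1, hσ2, mul_comm (starRingEnd ℂ (d s₀)), Complex.mul_conj, Complex.normSq_eq_norm_sq]
      have : ((‖d s₀‖ : ℝ) : ℂ) ≠ 0 := by exact_mod_cast hn.ne'
      push_cast; field_simp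
    rw [this, Complex.ofReal_re]
  have h2 : ∀ᶠ u in 𝓝[Icc 0 η₀] (0 : ℝ),
      ‖d s₀‖ / 2 < (τ * ((σ : ℂ) * d (s₀ + σ * u))).re := by
    have hc : ContinuousWithinAt (fun u : ℝ => (τ * ((σ : ℂ) * d (s₀ + σ * u))).re)
        (Icc 0 η₀) 0 :=
      Complex.continuous_re.continuousAt.comp_continuousWithinAt
        (continuousWithinAt_const.mul (continuousWithinAt_const.mul hc0))
    refine hc.eventually_const_lt ?_
    simp only [mul_zero, add_zero]; rw [hre0]; linarith
  obtain ⟨δ, hδ, hball⟩ := Metric.mem_nhdsWithin_iff.1 (h1.and h2)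
  set η := min η₀ (δ / 2) with hη
  have hη0 : 0 < η := lt_min hη₀ (half_pos hδ)
  have hηη : η ≤ η₀ := min_le_left _ _
  have hgood : ∀ u ∈ Ioo 0 η, ‖d (s₀ + σ * u)‖ < 2 * ‖d s₀‖ ∧
      ‖d s₀‖ / 2 < (τ * ((σ : ℂ) * d (s₀ + σ * u))).re := by
    intro u hu
    refine hball ⟨?_, hu.1.le, hu.2.le.trans hηη⟩
    rw [Metric.mem_ball, Real.dist_eq, sub_zero, abs_of_pos hu.1]
    linarith [hu.2, min_le_right η₀ (δ / 2)]
  -- These parameters are interior to the piece, so the one-sided derivative is the genuine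
  -- derivative there.
  have hint : ∀ u ∈ Ioo 0 η, Icc a b ∈ 𝓝 (s₀ + σ * u) := by
    intro u hu
    have hcont : Continuous fun x : ℝ => σ * (x - s₀) := by fun_prop
    have : (fun x : ℝ => σ * (x - s₀)) ⁻¹' Ioo 0 η ∈ 𝓝 (s₀ + σ * u) := by
      refine hcont.continuousAt.preimage_mem_nhds (Ioo_mem_nhds ?_ ?_)
      · rw [add_sub_cancel_left, ← mul_assoc, hσ2, one_mul]; exact hu.1
      · rw [add_sub_cancel_left, ← mul_assoc, hσ2, one_mul]; exact hu.2
    refine mem_of_superset this fun x hx => ?_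
    have := hmem (σ * (x - s₀)) ⟨hx.1.le, hx.2.le.trans hηη⟩
    rwa [← mul_assoc, hσ2, one_mul, add_sub_cancel] at this
  have hder : ∀ u ∈ Ioo 0 η, HasDerivAt (fun u : ℝ => f (s₀ + σ * u))
      ((σ : ℂ) * d (s₀ + σ * u)) u := by
    intro u hu
    have hx := mem_of_mem_nhds (hint u hu)
    have e1 : HasDerivAt f (d (s₀ + σ * u)) (s₀ + σ * u) :=
      ((hf.differentiableOn one_ne_zero _ hx).hasDerivWithinAt).hasDerivAt (hint u hu)
    have e2 : HasDerivAt (fun u : ℝ => s₀ + σ * u) σ u := by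
      simpa using ((hasDerivAt_id u).const_mul σ).const_add s₀
    simpa [Function.comp_def] using e1.scomp u e2
  refine ⟨η, 2 * ‖d s₀‖, ‖d s₀‖ / 2, τ, hηη, ?_⟩
  exact
    { length_pos := hη0
      continuousOn := hf.continuousOn.comp (by fun_prop) fun u hu =>
        hmem u (Icc_subset_Icc_right hηη hu)
      differentiableAt := fun u hu => (hder u hu).differentiableAt
      continuousOn_deriv := by
        refine ContinuousOn.congr (f := fun u : ℝ => (σ : ℂ) * d (s₀ + σ * u)) ?_
          fun u hu => (hder u hu).deriv
        exact continuousOn_const.mul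
          (hcomp.mono (Ioo_subset_Icc_self.trans (Icc_subset_Icc_right hηη)))
      norm_deriv_le := fun u hu => by
        rw [(hder u hu).deriv, norm_mul, Complex.norm_real, Real.norm_eq_abs, hσabs, one_mul]
        exact (hgood u hu).1.le
      slope_pos := by positivity
      norm_direction_le := by
        rw [hτ, norm_div, norm_mul, Complex.norm_real, Real.norm_eq_abs, hσabs, one_mul,
          RCLike.norm_conj, Complex.norm_real, norm_norm, div_self hn.ne']
      le_re_deriv := fun u hu => by
        rw [(hder u hu).deriv]; exact (hgood u hu).2.le }

/-- The loop starts with a short arc at each parameter `s₀ < 1`. -/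
lemma exists_isArc_right {s₀ : ℝ} (hs₀ : s₀ ∈ Ico (0 : ℝ) 1) :
    ∃ η M m τ, s₀ + η ≤ 1 ∧ IsArc (fun u => γ.toFun (s₀ + u)) η M m τ := by
  obtain ⟨k, s, hs0, hsk, hp⟩ := γ.piecewise_regular
  obtain ⟨i, hik, h1, h2⟩ := exists_Ico_piece (s := s) (k := k) (hs0.le.trans hs₀.1)
    (hsk ▸ hs₀.2)
  obtain ⟨hlt, hcd, hne⟩ := hp i hik
  have hle1 : ∀ j ≤ k, s j ≤ 1 := by
    intro j hj
    obtain ⟨l, rfl⟩ := Nat.exists_eq_add_of_le hj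
    clear hj h1 h2 hcd hne hlt hik
    rw [← hsk]
    have : ∀ r ≤ l, s j ≤ s (j + r) := by
      intro r hr
      induction r with
      | zero => simp
      | succ r ih => exact (ih (by omega)).trans (hp (j + r) (by omega)).1.le
    exact this l le_rfl
  obtain ⟨η, M, m, τ, hη, harc⟩ := isArc_of_piece (σ := 1) (η₀ := s (i + 1) - s₀) hlt hcd
    (hne s₀ ⟨h1, h2.le⟩) (Or.inl rfl) (sub_pos.2 h2) fun u hu =>
      ⟨by linarith [hu.1], by linarith [hu.2]⟩
  refine ⟨η, M, m, τ, by linarith [hle1 (i + 1) hik], by simpa using harc⟩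

/-- The loop ends with a short arc at each parameter `s₀ > 0`. -/
lemma exists_isArc_left {s₀ : ℝ} (hs₀ : s₀ ∈ Ioc (0 : ℝ) 1) :
    ∃ η M m τ, 0 ≤ s₀ - η ∧ IsArc (fun u => γ.toFun (s₀ - u)) η M m τ := by
  obtain ⟨k, s, hs0, hsk, hp⟩ := γ.piecewise_regular
  obtain ⟨i, hik, h1, h2⟩ := exists_Ioc_piece (s := s) (k := k) (hs0.trans_lt hs₀.1)
    (hs₀.2.trans hsk.ge)
  obtain ⟨hlt, hcd, hne⟩ := hp i hik
  have hge0 : ∀ j ≤ k, 0 ≤ s j := by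
    intro j hj
    induction j with
    | zero => exact hs0.ge
    | succ j ih => exact (ih (by omega)).trans (hp j (by omega)).1.le
  obtain ⟨η, M, m, τ, hη, harc⟩ := isArc_of_piece (σ := -1) (η₀ := s₀ - s i) hlt hcd
    (hne s₀ ⟨h1.le, h2⟩) (Or.inr rfl) (sub_pos.2 h1) fun u hu =>
      ⟨by linarith [hu.2], by linarith [hu.1]⟩
  refine ⟨η, M, m, τ, by linarith [hge0 i hik.le], by simpa [sub_eq_add_neg] using harc⟩

/-! ### Lipschitz parametrisation and the complement of a loop. -/

lemma exists_norm_deriv_le : ∃ M : ℝ, 0 ≤ M ∧ ∃ F : Set ℝ, F.Finite ∧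
    ∀ x ∈ Ioo (0 : ℝ) 1 \ F, DifferentiableAt ℝ γ.toFun x ∧ ‖deriv γ.toFun x‖ ≤ M := by
  obtain ⟨k, s, hs0, hsk, hp⟩ := γ.piecewise_regular
  have hb : ∀ i < k, ∃ M : ℝ, 0 ≤ M ∧ ∀ t ∈ Icc (s i) (s (i + 1)),
      ‖derivWithin γ.toFun (Icc (s i) (s (i + 1))) t‖ ≤ M := by
    intro i hi
    obtain ⟨hlt, hcd, -⟩ := hp i hi
    obtain ⟨M, hM⟩ := isCompact_Icc.exists_bound_of_continuousOn
      (hcd.continuousOn_derivWithin (uniqueDiffOn_Icc hlt) le_rfl)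
    exact ⟨M, (norm_nonneg _).trans (hM (s i) ⟨le_rfl, hlt.le⟩), hM⟩
  choose! M hM0 hM using hb
  refine ⟨∑ i ∈ Finset.range k, M i, Finset.sum_nonneg fun i hi => hM0 i (Finset.mem_range.1 hi),
    s '' (Finset.range (k + 1)), (Finset.finite_toSet _).image _, ?_⟩
  rintro x ⟨hx, hxF⟩
  obtain ⟨i, hik, h1, h2⟩ := exists_Ico_piece (s := s) (k := k) (hs0.le.trans hx.1.le)
    (hsk ▸ hx.2)
  have h1' : s i < x := lt_of_le_of_ne h1 fun h => hxF ⟨i, by simp; omega, h⟩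
  obtain ⟨hlt, hcd, -⟩ := hp i hik
  have hn : Icc (s i) (s (i + 1)) ∈ 𝓝 x := Icc_mem_nhds h1' h2
  refine ⟨(hcd.differentiableOn one_ne_zero x ⟨h1, h2.le⟩).differentiableAt hn, ?_⟩
  rw [← derivWithin_of_mem_nhds hn]
  exact (hM i hik x ⟨h1, h2.le⟩).trans (Finset.single_le_sum
    (fun j hj => hM0 j (Finset.mem_range.1 hj)) (Finset.mem_range.2 hik))

lemma exists_ae_norm_deriv_le : ∃ M : ℝ, 0 ≤ M ∧
    ∀ᵐ x : ℝ, x ∈ Icc (0 : ℝ) 1 → ‖deriv γ.toFun x‖ ≤ M := by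
  obtain ⟨M, hM, F, hF, h⟩ := γ.exists_norm_deriv_le
  refine ⟨M, hM, ?_⟩
  have h1 : ∀ᵐ x : ℝ, x ∉ F := MeasureTheory.measure_eq_zero_iff_ae_notMem.1
    (hF.measure_zero _)
  have h2 : ∀ᵐ x : ℝ, x ≠ 0 := by simp [MeasureTheory.ae_iff]
  have h3 : ∀ᵐ x : ℝ, x ≠ 1 := by simp [MeasureTheory.ae_iff]
  filter_upwards [h1, h2, h3] with x hx1 hx2 hx3 hx
  exact (h x ⟨⟨lt_of_le_of_ne hx.1 (Ne.symm hx2), lt_of_le_of_ne hx.2 hx3⟩, hx1⟩).2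

lemma intervalIntegrable_deriv : IntervalIntegrable (deriv γ.toFun) MeasureTheory.volume 0 1 := by
  obtain ⟨M, hM, h⟩ := γ.exists_ae_norm_deriv_le
  rw [intervalIntegrable_iff_integrableOn_Icc_of_le zero_le_one]
  exact MeasureTheory.Measure.integrableOn_of_bounded (M := M) (by simp)
    (measurable_deriv _).aestronglyMeasurable
    ((MeasureTheory.ae_restrict_iff' measurableSet_Icc).2 h)

lemma exists_lipschitz : ∃ M : ℝ, 0 ≤ M ∧ ∀ s ∈ Icc (0 : ℝ) 1, ∀ t ∈ Icc (0 : ℝ) 1,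
    ‖γ.toFun s - γ.toFun t‖ ≤ M * |s - t| := by
  obtain ⟨M, hM, F, hF, h⟩ := γ.exists_norm_deriv_le
  obtain ⟨M', hM', h'⟩ := γ.exists_ae_norm_deriv_le
  refine ⟨M', hM', ?_⟩
  have key : ∀ s ∈ Icc (0 : ℝ) 1, ∀ t ∈ Icc (0 : ℝ) 1, s ≤ t →
      ‖γ.toFun t - γ.toFun s‖ ≤ M' * |t - s| := by
    intro s hs t ht hst
    -- The fundamental theorem of calculus tolerates the finitely many break points between the
    -- regular pieces.
    rw [← MeasureTheory.integral_eq_of_hasDerivAt_off_countable_of_le γ.toFun (deriv γ.toFun) hst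
      hF.countable (γ.continuousOn.mono (Icc_subset_Icc hs.1 ht.2))
      (fun x hx => (h x ⟨⟨hs.1.trans_lt hx.1.1, hx.1.2.trans_le ht.2⟩, hx.2⟩).1.hasDerivAt)
      (γ.intervalIntegrable_deriv.mono_set (by
        rw [uIcc_of_le hst, uIcc_of_le zero_le_one]; exact Icc_subset_Icc hs.1 ht.2))]
    refine intervalIntegral.norm_integral_le_of_norm_le_const_ae ?_
    filter_upwards [h'] with x hx hx'
    rw [uIoc_of_le hst] at hx'
    exact hx ⟨hs.1.trans hx'.1.le, hx'.2.trans ht.2⟩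
  intro s hs t ht
  rcases le_total s t with hst | hst
  · rw [norm_sub_rev, abs_sub_comm]; exact key s hs t ht hst
  · exact key t ht s hs hst

lemma isCompact_trace : IsCompact γ.trace := isCompact_Icc.image_of_continuousOn γ.continuousOn

lemma isOpen_compl_trace : IsOpen γ.traceᶜ := γ.isCompact_trace.isClosed.isOpen_compl

lemma zero_mem_trace : (0 : ℂ) ∈ γ.trace := ⟨0, by simp, γ.map_zero⟩

/-- A Lipschitz image of an interval has Hausdorff dimension at most one. Density makes limits from
the complement meaningful at every point of the loop. -/
lemma dense_compl_trace : Dense γ.traceᶜ := by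
  obtain ⟨M, hM, h⟩ := γ.exists_lipschitz
  have hL : LipschitzOnWith ⟨M, hM⟩ γ.toFun (Icc 0 1) :=
    LipschitzOnWith.of_dist_le_mul fun s hs t ht => by
      rw [dist_eq_norm, Real.dist_eq]; exact h s hs t ht
  refine dense_compl_of_dimH_lt_finrank ?_
  calc dimH γ.trace ≤ dimH (Icc (0 : ℝ) 1) := hL.dimH_image_le
    _ ≤ dimH (univ : Set ℝ) := dimH_mono (subset_univ _)
    _ = 1 := by simp [Real.dimH_univ]
    _ < _ := by rw [Complex.finrank_real_complex]; norm_num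

/-- This takes the place of the Jordan curve theorem: the possible winding numbers are part of the
definition of a loop. -/
lemma compl_trace_eq : γ.traceᶜ = γ.plusSide ∪ γ.minusSide := by
  ext z
  constructor
  · intro hz
    exact (γ.winding z hz).imp (fun h => ⟨hz, h⟩) fun h => ⟨hz, h⟩
  · rintro (h | h) <;> exact h.1

end Loop

/-! ### Singular integrals over short arcs -/

lemma integral_rpow_sub_one {r : ℝ} (hr : 0 < r) (b : ℝ) :
    ∫ u in (0 : ℝ)..b, u ^ (r - 1) = b ^ r / r := by
  rw [integral_rpow (Or.inl (by linarith)), sub_add_cancel, Real.zero_rpow hr.ne', sub_zero]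

lemma intervalIntegrable_rpow_sub_one {r : ℝ} (hr : 0 < r) (a b : ℝ) :
    IntervalIntegrable (fun u : ℝ => u ^ (r - 1)) MeasureTheory.volume a b :=
  intervalIntegral.intervalIntegrable_rpow' (by linarith)

lemma intervalIntegrable_abs_sub_rpow {r u₀ σ : ℝ} (hr : 0 < r) (hu₀ : u₀ ∈ Icc 0 σ) :
    IntervalIntegrable (fun u : ℝ => |u - u₀| ^ (r - 1)) MeasureTheory.volume 0 u₀ ∧
    IntervalIntegrable (fun u : ℝ => |u - u₀| ^ (r - 1)) MeasureTheory.volume u₀ σ := by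
  constructor
  · have h := (intervalIntegrable_rpow_sub_one hr u₀ 0).comp_sub_left u₀
    simp only [sub_self, sub_zero] at h
    refine h.congr_uIoo fun u hu => ?_
    rw [uIoo_of_le hu₀.1] at hu
    rw [abs_sub_comm, abs_of_pos (sub_pos.2 hu.2)]
  · have h := (intervalIntegrable_rpow_sub_one hr 0 (σ - u₀)).comp_sub_right u₀
    simp only [zero_add, sub_add_cancel] at h
    refine h.congr_uIoo fun u hu => ?_
    rw [uIoo_of_le hu₀.2] at hu
    rw [abs_of_pos (sub_pos.2 hu.1)]

/-- The bound does not depend on `u₀`. This is the source of uniformity in `z` for the singular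
integrals below, where `u₀` depends on `z`. -/
lemma integral_abs_sub_rpow_le {r u₀ σ : ℝ} (hr : 0 < r) (hu₀ : u₀ ∈ Icc 0 σ) :
    ∫ u in (0 : ℝ)..σ, |u - u₀| ^ (r - 1) ≤ 2 / r * σ ^ r := by
  obtain ⟨h1, h2⟩ := intervalIntegrable_abs_sub_rpow hr hu₀
  rw [← intervalIntegral.integral_add_adjacent_intervals h1 h2]
  have e1 : ∫ u in (0 : ℝ)..u₀, |u - u₀| ^ (r - 1) = u₀ ^ r / r := by
    rw [← integral_rpow_sub_one hr]
    have := intervalIntegral.integral_comp_sub_left (a := 0) (b := u₀)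
      (fun u : ℝ => u ^ (r - 1)) u₀
    rw [sub_self, sub_zero] at this
    rw [← this]
    refine intervalIntegral.integral_congr fun u hu => ?_
    rw [uIcc_of_le hu₀.1] at hu
    rw [abs_sub_comm, abs_of_nonneg (sub_nonneg.2 hu.2)]
  have e2 : ∫ u in u₀..σ, |u - u₀| ^ (r - 1) = (σ - u₀) ^ r / r := by
    rw [← integral_rpow_sub_one hr]
    have := intervalIntegral.integral_comp_sub_right (a := u₀) (b := σ)
      (fun u : ℝ => u ^ (r - 1)) u₀
    rw [sub_self] at this
    rw [← this]
    refine intervalIntegral.integral_congr fun u hu => ?_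
    rw [uIcc_of_le hu₀.2] at hu
    rw [abs_of_nonneg (sub_nonneg.2 hu.1)]
  have b1 : u₀ ^ r ≤ σ ^ r := Real.rpow_le_rpow hu₀.1 hu₀.2 hr.le
  have b2 : (σ - u₀) ^ r ≤ σ ^ r :=
    Real.rpow_le_rpow (sub_nonneg.2 hu₀.2) (by linarith [hu₀.1]) hr.le
  rw [e1, e2, ← add_div, div_mul_eq_mul_div]
  gcongr
  linarith

/-- A density vanishing like `‖c - z‖ ^ r` makes the Cauchy kernel uniformly integrable. -/
lemma IsArc.norm_integral_cauchy_le {c : ℝ → ℂ} {σ M m : ℝ} {τ : ℂ} (h : IsArc c σ M m τ)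
    {r : ℝ} (hr : 0 < r) (hr1 : r ≤ 1) {z : ℂ} (hz : z ∉ c '' Icc 0 σ) {k : ℝ → ℂ} {K : ℝ}
    (hK : 0 ≤ K) (hk : ∀ u ∈ Icc 0 σ, ‖k u‖ ≤ K * ‖c u - z‖ ^ r) :
    ‖∫ u in (0 : ℝ)..σ, (c u - z)⁻¹ * (k u * deriv c u)‖ ≤
      K * M * m ^ (r - 1) * (2 / r) * σ ^ r := by
  obtain ⟨u₀, hu₀, hle⟩ := h.exists_le_norm_sub z
  obtain ⟨i1, i2⟩ := intervalIntegrable_abs_sub_rpow hr hu₀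
  have hm := h.slope_pos
  have hM := h.bound_nonneg
  have hbound : ‖∫ u in (0 : ℝ)..σ, (c u - z)⁻¹ * (k u * deriv c u)‖ ≤
      ∫ u in (0 : ℝ)..σ, K * M * m ^ (r - 1) * |u - u₀| ^ (r - 1) := by
    refine intervalIntegral.norm_integral_le_of_norm_le h.length_pos.le ?_
      ((i1.trans i2).const_mul _)
    have h1 : ∀ᵐ x : ℝ, x ≠ u₀ := by simp [MeasureTheory.ae_iff]
    have h2 : ∀ᵐ x : ℝ, x ≠ σ := by simp [MeasureTheory.ae_iff]
    filter_upwards [h1, h2] with u hu1 hu2 hu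
    have huI : u ∈ Icc 0 σ := Ioc_subset_Icc_self hu
    have hpos : 0 < ‖c u - z‖ := norm_pos_iff.2 (sub_ne_zero.2 fun h' => hz ⟨u, huI, h'⟩)
    have habs : 0 < |u - u₀| := abs_pos.2 (sub_ne_zero.2 hu1)
    have hd := h.norm_deriv_le u ⟨hu.1, lt_of_le_of_ne hu.2 hu2⟩
    rw [norm_mul, norm_mul, norm_inv]
    -- The density turns the kernel into `‖c u - z‖ ^ (r - 1)`. As `r - 1 ≤ 0`, the lower bound `m *
    -- |u - u₀|` for the distance bounds it from above by an integrable power.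
    calc ‖c u - z‖⁻¹ * (‖k u‖ * ‖deriv c u‖) ≤ ‖c u - z‖⁻¹ * ((K * ‖c u - z‖ ^ r) * M) := by
          gcongr; exact hk u huI
      _ = K * M * ‖c u - z‖ ^ (r - 1) := by
          rw [Real.rpow_sub_one hpos.ne']; field_simp
      _ ≤ K * M * (m * |u - u₀|) ^ (r - 1) := by
          refine mul_le_mul_of_nonneg_left ?_ (mul_nonneg hK hM)
          exact Real.rpow_le_rpow_of_nonpos (mul_pos hm habs) (hle u huI) (by linarith)
      _ = K * M * m ^ (r - 1) * |u - u₀| ^ (r - 1) := by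
          rw [Real.mul_rpow hm.le habs.le]; ring
  refine hbound.trans ?_
  rw [intervalIntegral.integral_const_mul, mul_assoc (K * M * m ^ (r - 1))]
  refine mul_le_mul_of_nonneg_left (integral_abs_sub_rpow_le hr hu₀) ?_
  positivity

/-! ### Cauchy integrals away from the curve -/

lemma differentiableAt_cauchyIntegral {c h : ℝ → ℂ} {a b : ℝ} (hab : a ≤ b)
    (hc : ContinuousOn c (Icc a b)) (hh : IntervalIntegrable h MeasureTheory.volume a b) {z₀ : ℂ}
    (hz₀ : z₀ ∉ c '' Icc a b) :
    DifferentiableAt ℂ (fun z => ∫ s in a..b, (c s - z)⁻¹ * h s) z₀ := by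
  have hcl : IsClosed (c '' Icc a b) := (isCompact_Icc.image_of_continuousOn hc).isClosed
  obtain ⟨ε, hε, hball⟩ := Metric.isOpen_iff.1 hcl.isOpen_compl z₀ hz₀
  have hfar : ∀ z ∈ Metric.ball z₀ (ε / 2), ∀ s ∈ Icc a b, ε / 2 ≤ ‖c s - z‖ := by
    intro z hz s hs
    by_contra! hlt
    suffices hmem : c s ∈ Metric.ball z₀ ε from hball hmem ⟨s, hs, rfl⟩
    rw [Metric.mem_ball, dist_eq_norm] at *
    calc ‖c s - z₀‖ = ‖(c s - z) + (z - z₀)‖ := by ring_nf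
      _ ≤ ‖c s - z‖ + ‖z - z₀‖ := norm_add_le _ _
      _ < ε := by linarith
  have hne : ∀ z ∈ Metric.ball z₀ (ε / 2), ∀ s ∈ Icc a b, c s - z ≠ 0 := fun z hz s hs h0 => by
    have := hfar z hz s hs
    rw [h0, norm_zero] at this; linarith
  have hcu : ContinuousOn c (uIcc a b) := by rwa [uIcc_of_le hab]
  have hint : ∀ z ∈ Metric.ball z₀ (ε / 2), IntervalIntegrable (fun s => (c s - z)⁻¹ * h s)
      MeasureTheory.volume a b := fun z hz =>
    hh.continuousOn_mul ((hcu.sub continuousOn_const).inv₀ fun s hs =>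
      hne z hz s (uIcc_of_le hab ▸ hs))
  have hz0 : z₀ ∈ Metric.ball z₀ (ε / 2) := Metric.mem_ball_self (half_pos hε)
  have hint' : IntervalIntegrable (fun s => ((c s - z₀) ^ 2)⁻¹ * h s)
      MeasureTheory.volume a b :=
    hh.continuousOn_mul (((hcu.sub continuousOn_const).pow 2).inv₀ fun s hs =>
      pow_ne_zero 2 (hne z₀ hz0 s (uIcc_of_le hab ▸ hs)))
  refine (intervalIntegral.hasDerivAt_integral_of_dominated_loc_of_deriv_le
    (F := fun z s => (c s - z)⁻¹ * h s) (F' := fun z s => ((c s - z) ^ 2)⁻¹ * h s)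
    (bound := fun s => ((ε / 2) ^ 2)⁻¹ * ‖h s‖) (Metric.ball_mem_nhds z₀ (half_pos hε))
    ?_ (hint z₀ hz0) hint'.aestronglyMeasurable_restrict_uIoc ?_ (hh.norm.const_mul _)
    ?_).2.differentiableAt
  · filter_upwards [Metric.ball_mem_nhds z₀ (half_pos hε)] with z hz
    exact (hint z hz).aestronglyMeasurable_restrict_uIoc
  · refine .of_forall fun s hs z hz => ?_
    have hs' : s ∈ Icc a b := Ioc_subset_Icc_self (uIoc_of_le hab ▸ hs)
    rw [norm_mul, norm_inv, norm_pow]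
    have := hfar z hz s hs'
    gcongr
  · refine .of_forall fun s hs z hz => ?_
    have hs' : s ∈ Icc a b := Ioc_subset_Icc_self (uIoc_of_le hab ▸ hs)
    have h1 := (((hasDerivAt_id z).const_sub (c s)).inv (hne z hz s hs')).mul_const (h s)
    refine h1.congr_deriv ?_
    rw [neg_neg, one_div]
    rfl

lemma isBigO_cauchyIntegral {c h : ℝ → ℂ} {a b : ℝ} (hab : a ≤ b)
    (hc : ContinuousOn c (Icc a b)) (hh : IntervalIntegrable h MeasureTheory.volume a b) :
    (fun z => ∫ s in a..b, (c s - z)⁻¹ * h s) =O[Bornology.cobounded ℂ] fun z => z⁻¹ := by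
  obtain ⟨R, hR⟩ := isCompact_Icc.exists_bound_of_continuousOn hc
  refine IsBigO.of_bound (2 * ∫ s in a..b, ‖h s‖) ?_
  filter_upwards [tendsto_norm_cobounded_atTop.eventually_ge_atTop (2 * R),
    tendsto_norm_cobounded_atTop.eventually_gt_atTop 0] with z hz hz0
  rw [norm_inv, mul_right_comm, ← intervalIntegral.integral_const_mul]
  refine intervalIntegral.norm_integral_le_of_norm_le hab (.of_forall fun s hs => ?_)
    (hh.norm.const_mul _)
  have h1 := hR s (Ioc_subset_Icc_self hs)
  have h2 : ‖z‖ / 2 ≤ ‖c s - z‖ := by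
    have := norm_sub_norm_le z (c s)
    rw [norm_sub_rev] at this
    linarith
  rw [norm_mul, norm_inv]
  gcongr
  calc ‖c s - z‖⁻¹ ≤ (‖z‖ / 2)⁻¹ := by gcongr
    _ = 2 * ‖z‖⁻¹ := by rw [inv_div]; ring

/-! ### Hölder functions -/

/-- Hölder continuity of some exponent in `(0, 1]`. -/
def IsHolderOn {α : Type*} [PseudoMetricSpace α] (f : α → ℂ) (S : Set α) : Prop :=
  ∃ K r : ℝ, 0 ≤ K ∧ 0 < r ∧ r ≤ 1 ∧ ∀ x ∈ S, ∀ y ∈ S, ‖f x - f y‖ ≤ K * dist x y ^ r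

namespace IsHolderOn

variable {α : Type*} [PseudoMetricSpace α] {f g : α → ℂ} {S T : Set α}

lemma mono (hf : IsHolderOn f T) (h : S ⊆ T) : IsHolderOn f S := by
  obtain ⟨K, r, hK, hr, hr1, hb⟩ := hf
  exact ⟨K, r, hK, hr, hr1, fun x hx y hy => hb x (h hx) y (h hy)⟩

lemma congr (hf : IsHolderOn f S) (h : ∀ x ∈ S, g x = f x) : IsHolderOn g S := by
  obtain ⟨K, r, hK, hr, hr1, hb⟩ := hf
  exact ⟨K, r, hK, hr, hr1, fun x hx y hy => by rw [h x hx, h y hy]; exact hb x hx y hy⟩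

lemma const (w : ℂ) : IsHolderOn (fun _ : α => w) S :=
  ⟨0, 1, le_rfl, one_pos, le_rfl, fun x _ y _ => by simp⟩

lemma of_lipschitz {K : ℝ} (hK : 0 ≤ K) (h : ∀ x ∈ S, ∀ y ∈ S, ‖f x - f y‖ ≤ K * dist x y) :
    IsHolderOn f S :=
  ⟨K, 1, hK, one_pos, le_rfl, fun x hx y hy => by rw [Real.rpow_one]; exact h x hx y hy⟩

lemma continuousOn (hf : IsHolderOn f S) : ContinuousOn f S := by
  obtain ⟨K, r, hK, hr, -, hb⟩ := hf
  intro x hx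
  rw [ContinuousWithinAt, tendsto_iff_norm_sub_tendsto_zero]
  have h1 : Tendsto (fun y => K * dist y x ^ r) (𝓝[S] x) (𝓝 0) := by
    have h2 : Tendsto (fun y => dist y x) (𝓝[S] x) (𝓝 0) := by
      have : Tendsto (fun y => dist y x) (𝓝 x) (𝓝 (dist x x)) :=
        (continuous_id.dist continuous_const).tendsto x
      rw [dist_self] at this
      exact this.mono_left nhdsWithin_le_nhds
    have h3 := (h2.rpow_const (p := r) (Or.inr hr.le)).const_mul K
    rwa [Real.zero_rpow hr.ne', mul_zero] at h3
  refine squeeze_zero' (.of_forall fun _ => norm_nonneg _) ?_ h1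
  filter_upwards [self_mem_nhdsWithin] with y hy using hb y hy x hx

lemma exists_bound (hf : IsHolderOn f S) (hS : Bornology.IsBounded S) :
    ∃ B, 0 ≤ B ∧ ∀ x ∈ S, ‖f x‖ ≤ B := by
  obtain ⟨K, r, hK, hr, -, hb⟩ := hf
  rcases S.eq_empty_or_nonempty with rfl | ⟨x₀, hx₀⟩
  · exact ⟨0, le_rfl, by simp⟩
  refine ⟨‖f x₀‖ + K * Metric.diam S ^ r, by positivity, fun x hx => ?_⟩
  have h1 := hb x hx x₀ hx₀
  have h2 : K * dist x x₀ ^ r ≤ K * Metric.diam S ^ r := by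
    gcongr; exact Metric.dist_le_diam_of_mem hS hx hx₀
  have := norm_sub_norm_le (f x) (f x₀)
  linarith

lemma exists_of_le {K r : ℝ} (hK : 0 ≤ K)
    (hb : ∀ x ∈ S, ∀ y ∈ S, ‖f x - f y‖ ≤ K * dist x y ^ r) (hS : Bornology.IsBounded S)
    {r' : ℝ} (hr' : 0 < r') (hle : r' ≤ r) :
    ∃ K', 0 ≤ K' ∧ ∀ x ∈ S, ∀ y ∈ S, ‖f x - f y‖ ≤ K' * dist x y ^ r' := by
  refine ⟨K * Metric.diam S ^ (r - r'), mul_nonneg hK (Real.rpow_nonneg Metric.diam_nonneg _),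
    fun x hx y hy => (hb x hx y hy).trans ?_⟩
  rcases eq_or_lt_of_le (dist_nonneg (x := x) (y := y)) with h0 | h0
  · rw [← h0, Real.zero_rpow hr'.ne', Real.zero_rpow (hr'.trans_le hle).ne']; simp
  · rw [mul_assoc]
    refine mul_le_mul_of_nonneg_left ?_ hK
    calc dist x y ^ r = dist x y ^ (r - r') * dist x y ^ r' := by
          rw [← Real.rpow_add h0, sub_add_cancel]
      _ ≤ Metric.diam S ^ (r - r') * dist x y ^ r' := by
          gcongr
          exact Metric.dist_le_diam_of_mem hS hx hy

/-- Two Hölder functions on a bounded set have a common exponent and constant. -/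
lemma common (hf : IsHolderOn f S) (hg : IsHolderOn g S) (hS : Bornology.IsBounded S) :
    ∃ K r : ℝ, 0 ≤ K ∧ 0 < r ∧ r ≤ 1 ∧ ∀ x ∈ S, ∀ y ∈ S,
      ‖f x - f y‖ ≤ K * dist x y ^ r ∧ ‖g x - g y‖ ≤ K * dist x y ^ r := by
  obtain ⟨K, r, hK, hr, hr1, hb⟩ := hf
  obtain ⟨K', r', hK', hr', hr1', hb'⟩ := hg
  have hm := lt_min hr hr'
  obtain ⟨K₁, hK₁, h1⟩ := exists_of_le hK hb hS hm (min_le_left _ _)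
  obtain ⟨K₂, hK₂, h2⟩ := exists_of_le hK' hb' hS hm (min_le_right _ _)
  refine ⟨max K₁ K₂, min r r', le_max_of_le_left hK₁, hm, (min_le_left _ _).trans hr1,
    fun x hx y hy => ⟨(h1 x hx y hy).trans ?_, (h2 x hx y hy).trans ?_⟩⟩
  · gcongr; exact le_max_left _ _
  · gcongr; exact le_max_right _ _

lemma add (hf : IsHolderOn f S) (hg : IsHolderOn g S) (hS : Bornology.IsBounded S) :
    IsHolderOn (fun x => f x + g x) S := by
  obtain ⟨K, r, hK, hr, hr1, hb⟩ := hf.common hg hS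
  refine ⟨2 * K, r, by positivity, hr, hr1, fun x hx y hy => ?_⟩
  obtain ⟨h1, h2⟩ := hb x hx y hy
  calc ‖f x + g x - (f y + g y)‖ = ‖(f x - f y) + (g x - g y)‖ := by ring_nf
    _ ≤ ‖f x - f y‖ + ‖g x - g y‖ := norm_add_le _ _
    _ ≤ _ := by linarith

lemma mul (hf : IsHolderOn f S) (hg : IsHolderOn g S) (hS : Bornology.IsBounded S) :
    IsHolderOn (fun x => f x * g x) S := by
  obtain ⟨B, hB, hBf⟩ := hf.exists_bound hS
  obtain ⟨B', hB', hBg⟩ := hg.exists_bound hS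
  obtain ⟨K, r, hK, hr, hr1, hb⟩ := hf.common hg hS
  refine ⟨B * K + K * B', r, by positivity, hr, hr1, fun x hx y hy => ?_⟩
  obtain ⟨h1, h2⟩ := hb x hx y hy
  calc ‖f x * g x - f y * g y‖ = ‖f x * (g x - g y) + (f x - f y) * g y‖ := by ring_nf
    _ ≤ ‖f x‖ * ‖g x - g y‖ + ‖f x - f y‖ * ‖g y‖ := by
        refine (norm_add_le _ _).trans ?_; rw [norm_mul, norm_mul]
    _ ≤ B * (K * dist x y ^ r) + (K * dist x y ^ r) * B' := by
        gcongr
        exacts [hBf x hx, hBg y hy]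
    _ = _ := by ring

lemma comp {β : Type*} [PseudoMetricSpace β] {T : Set β} {c : α → β} {f : β → ℂ}
    (hf : IsHolderOn f T) {M : ℝ} (hM : 0 ≤ M) (hc : ∀ x ∈ S, ∀ y ∈ S, dist (c x) (c y) ≤ M * dist x y)
    (hmap : MapsTo c S T) : IsHolderOn (fun x => f (c x)) S := by
  obtain ⟨K, r, hK, hr, hr1, hb⟩ := hf
  refine ⟨K * M ^ r, r, by positivity, hr, hr1, fun x hx y hy => ?_⟩
  refine (hb _ (hmap hx) _ (hmap hy)).trans ?_
  rw [mul_assoc, ← Real.mul_rpow hM dist_nonneg]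
  gcongr
  exact hc x hx y hy

end IsHolderOn

lemma isHolderOn_of_holderOnWith {f : ℂ → ℂ} {S : Set ℂ} {K r : ℝ≥0} (hr : 0 < r) (hr1 : r ≤ 1)
    (h : HolderOnWith K r f S) : IsHolderOn f S :=
  ⟨K, r, K.2, hr, hr1, fun x hx y hy => by
    rw [← dist_eq_norm]; exact h.dist_le hx hy⟩

lemma intervalIntegrable_cauchy {c h : ℝ → ℂ} {a b : ℝ} (hab : a ≤ b)
    (hc : ContinuousOn c (Icc a b)) (hh : IntervalIntegrable h MeasureTheory.volume a b) {z : ℂ}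
    (hz : z ∉ c '' Icc a b) :
    IntervalIntegrable (fun s => (c s - z)⁻¹ * h s) MeasureTheory.volume a b := by
  refine hh.continuousOn_mul ?_
  rw [uIcc_of_le hab]
  exact (hc.sub continuousOn_const).inv₀ fun s hs => sub_ne_zero.2 fun h' => hz ⟨s, hs, h'⟩

/-! ### Cauchy integrals at the initial point of an arc -/

namespace IsArc

variable {c : ℝ → ℂ} {η M m : ℝ} {τ : ℂ} {g : ℂ → ℂ}

lemma mul_le_norm (h : IsArc c η M m τ) (h0 : c 0 = 0) {u : ℝ} (hu : u ∈ Icc 0 η) :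
    m * u ≤ ‖c u‖ := by
  have h1 := h.le_re_sub 0 le_rfl hu.1 hu.2
  have h2 := h.abs_re_le 0 u
  simp only [sub_zero, h0, mul_zero, Complex.zero_re] at h1 h2
  exact h1.trans ((le_abs_self _).trans h2)

lemma ne_zero (h : IsArc c η M m τ) (h0 : c 0 = 0) {u : ℝ} (hu : u ∈ Ioc 0 η) : c u ≠ 0 := by
  intro h'
  have := h.mul_le_norm h0 (Ioc_subset_Icc_self hu)
  rw [h', norm_zero] at this
  nlinarith [h.slope_pos, hu.1]

/-- The product `c g(c)` vanishes at the initial point, so Hölder continuity bounds it by `K * u ^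
r`; dividing by `‖c u‖ ≥ m * u` gives an integrable power. -/
lemma norm_density_le (h : IsArc c η M m τ) (h0 : c 0 = 0) {K r : ℝ}
    (hk : ∀ x ∈ Icc 0 η, ∀ y ∈ Icc 0 η, ‖c x * g (c x) - c y * g (c y)‖ ≤ K * dist x y ^ r)
    {u : ℝ} (hu : u ∈ Ioc 0 η) : ‖g (c u)‖ ≤ K / m * u ^ (r - 1) := by
  have hk0 := hk u (Ioc_subset_Icc_self hu) 0 ⟨le_rfl, h.length_pos.le⟩
  rw [h0, zero_mul, sub_zero, Real.dist_eq, sub_zero, abs_of_pos hu.1, norm_mul] at hk0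
  have hm := h.slope_pos
  have h1 : m * u * ‖g (c u)‖ ≤ K * u ^ r :=
    (mul_le_mul_of_nonneg_right (h.mul_le_norm h0 (Ioc_subset_Icc_self hu)) (norm_nonneg _)).trans
      hk0
  rw [Real.rpow_sub_one hu.1.ne', div_mul_div_comm, le_div_iff₀ (mul_pos hm hu.1)]
  linarith

lemma intervalIntegrable_density (h : IsArc c η M m τ) (h0 : c 0 = 0)
    (hk : IsHolderOn (fun u => c u * g (c u)) (Icc 0 η)) :
    IntervalIntegrable (fun u => g (c u) * deriv c u) MeasureTheory.volume 0 η := by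
  have hcont := hk.continuousOn
  obtain ⟨K, r, hK, hr, hr1, hb⟩ := hk
  have hη := h.length_pos.le
  refine ((intervalIntegrable_rpow_sub_one hr 0 η).const_mul (K / m * M)).mono_fun' ?_ ?_
  · rw [uIoc_of_le hη, ← MeasureTheory.restrict_Ioo_eq_restrict_Ioc]
    refine MeasureTheory.AEStronglyMeasurable.mul ?_ (measurable_deriv c).aestronglyMeasurable
    -- Only `c g(c)` is known to be continuous, so `g(c)` is recovered as a quotient off the initial
    -- point.
    have : ContinuousOn (fun u => (c u * g (c u)) / c u) (Ioo 0 η) :=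
      (hcont.mono Ioo_subset_Icc_self).div (h.continuousOn.mono Ioo_subset_Icc_self)
        fun u hu => h.ne_zero h0 ⟨hu.1, hu.2.le⟩
    refine ContinuousOn.aestronglyMeasurable (this.congr fun u hu => ?_) measurableSet_Ioo
    exact (mul_div_cancel_left₀ _ (h.ne_zero h0 ⟨hu.1, hu.2.le⟩)).symm
  · rw [uIoc_of_le hη, ← MeasureTheory.restrict_Ioo_eq_restrict_Ioc]
    refine (MeasureTheory.ae_restrict_iff' measurableSet_Ioo).2 (.of_forall fun u hu => ?_)
    change ‖g (c u) * deriv c u‖ ≤ K / m * M * u ^ (r - 1)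
    rw [norm_mul]
    calc ‖g (c u)‖ * ‖deriv c u‖ ≤ K / m * u ^ (r - 1) * M := by
          gcongr
          · have := h.slope_pos
            have := Real.rpow_nonneg hu.1.le (r - 1)
            positivity
          · exact h.norm_density_le h0 hb ⟨hu.1, hu.2.le⟩
          · exact h.norm_deriv_le u hu
      _ = _ := by ring

/-- A power beats a logarithm. The expression bounds the value of `t g(t)` at a parameter comparable
to `‖z‖`, multiplied by the logarithmic integral over the arc. -/
lemma tendsto_rpow_mul_log (h : IsArc c η M m τ) (h0 : c 0 = 0) {K r : ℝ} (hr : 0 < r) :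
    Tendsto (fun z : ℂ => K * (‖z‖ / m) ^ r *
      (|Real.log ‖c η - z‖| + |Real.log ‖z‖| + 2 * Real.pi)) (𝓝[≠] 0) (𝓝 0) := by
  have hne : c η ≠ 0 := h.ne_zero h0 ⟨h.length_pos, le_rfl⟩
  have hn : Tendsto (fun z : ℂ => ‖z‖) (𝓝[≠] 0) (𝓝[>] 0) := tendsto_norm_nhdsNE_zero
  have hn' : Tendsto (fun z : ℂ => ‖z‖) (𝓝[≠] 0) (𝓝 0) :=
    hn.mono_right nhdsWithin_le_nhds
  have hr0 : Tendsto (fun z : ℂ => ‖z‖ ^ r) (𝓝[≠] 0) (𝓝 0) := by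
    have := hn'.rpow_const (p := r) (Or.inr hr.le)
    rwa [Real.zero_rpow hr.ne'] at this
  have h1 : Tendsto (fun z : ℂ => |Real.log ‖c η - z‖|) (𝓝[≠] 0) (𝓝 |Real.log ‖c η - 0‖|) := by
    refine (ContinuousAt.tendsto ?_).mono_left nhdsWithin_le_nhds
    refine ContinuousAt.abs (ContinuousAt.log (by fun_prop) ?_)
    simpa using hne
  have h2 : Tendsto (fun z : ℂ => |Real.log ‖z‖ * ‖z‖ ^ r|) (𝓝[≠] 0) (𝓝 0) := by
    have := ((tendsto_log_mul_rpow_nhdsGT_zero hr).comp hn).abs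
    rwa [abs_zero] at this
  have h3 : Tendsto (fun z : ℂ => K / m ^ r * (‖z‖ ^ r * |Real.log ‖c η - z‖| +
      |Real.log ‖z‖ * ‖z‖ ^ r| + ‖z‖ ^ r * (2 * Real.pi))) (𝓝[≠] 0) (𝓝 0) := by
    have := (((hr0.mul h1).add h2).add (hr0.mul_const (2 * Real.pi))).const_mul (K / m ^ r)
    simpa using this
  refine h3.congr fun z => ?_
  rw [abs_mul, Real.div_rpow (norm_nonneg _) h.slope_pos.le,
    abs_of_nonneg (Real.rpow_nonneg (norm_nonneg z) r)]
  ring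

/-- Near the initial point of an arc, a Cauchy integral with an integrable power bound is `o(1/z)`,
from all directions. -/
lemma tendsto_mul_cauchyIntegral (h : IsArc c η M m τ) (h0 : c 0 = 0)
    (hk : IsHolderOn (fun u => c u * g (c u)) (Icc 0 η)) :
    Tendsto (fun z => z * ∫ u in (0 : ℝ)..η, (c u - z)⁻¹ * (g (c u) * deriv c u))
      (𝓝[(c '' Icc 0 η)ᶜ] 0) (𝓝 0) := by
  have hint := h.intervalIntegrable_density h0 hk
  have hkc := hk.continuousOn
  obtain ⟨K, r, hK, hr, hr1, hb⟩ := hk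
  have hη := h.length_pos.le
  have hm := h.slope_pos
  have hM := h.bound_nonneg
  -- The sum of the constants in `b1` and `b3`, the two terms that are small because the arc `[0,
  -- σ]` is short rather than because `z` is near the origin. Hence `σ` is fixed before `z`.
  set C : ℝ := K / m ^ r * M * m ^ (r - 1) * (2 / r) + K / m * M / r with hC
  have hC0 : 0 ≤ C := by positivity
  rw [Metric.tendsto_nhds]
  intro ε hε
  obtain ⟨σ, hσ0, hση, hσC⟩ : ∃ σ, 0 < σ ∧ σ ≤ η ∧ C * σ ^ r < ε / 3 := by
    have h1 : Tendsto (fun σ : ℝ => C * σ ^ r) (𝓝[>] 0) (𝓝 0) := by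
      have : Tendsto (fun σ : ℝ => σ ^ r) (𝓝 0) (𝓝 (0 ^ r)) :=
        (Real.continuousAt_rpow_const 0 r (Or.inr hr.le)).tendsto
      rw [Real.zero_rpow hr.ne'] at this
      simpa using (this.mono_left nhdsWithin_le_nhds).const_mul C
    have h2 := (h1.eventually_lt_const (show 0 < ε / 3 by positivity)).and
      (Ioo_mem_nhdsGT h.length_pos)
    obtain ⟨σ, h3, h4⟩ := h2.exists
    exact ⟨σ, h4.1, h4.2.le, h3⟩
  have hσ := h.mono hσ0 hση
  have hsub : ∀ {z}, z ∉ c '' Icc 0 η → z ∉ c '' Icc 0 σ := fun hz h' =>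
    hz (image_mono (Icc_subset_Icc_right hση) h')
  have hsub' : ∀ {z}, z ∉ c '' Icc 0 η → z ∉ c '' Icc σ η := fun hz h' =>
    hz (image_mono (Icc_subset_Icc_left hσ0.le) h')
  have hi1 : IntervalIntegrable (fun u => g (c u) * deriv c u) MeasureTheory.volume 0 σ :=
    hint.mono_set (by rw [uIcc_of_le hσ0.le, uIcc_of_le hη]; exact Icc_subset_Icc_right hση)
  have hi2 : IntervalIntegrable (fun u => g (c u) * deriv c u) MeasureTheory.volume σ η :=
    hint.mono_set (by rw [uIcc_of_le hση, uIcc_of_le hη]; exact Icc_subset_Icc_left hσ0.le)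
  have hc1 := hσ.continuousOn
  have hc2 : ContinuousOn c (Icc σ η) := h.continuousOn.mono (Icc_subset_Icc_left hσ0.le)
  have hfar : Tendsto (fun z => z * ∫ u in σ..η, (c u - z)⁻¹ * (g (c u) * deriv c u))
      (𝓝[(c '' Icc 0 η)ᶜ] 0) (𝓝 0) := by
    have hz0 : (0 : ℂ) ∉ c '' Icc σ η := by
      rintro ⟨u, hu, h'⟩
      exact h.ne_zero h0 ⟨hσ0.trans_le hu.1, hu.2⟩ h'
    have h1 := (differentiableAt_cauchyIntegral hση hc2 hi2 hz0).continuousAt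
    have h2 := (continuousAt_id.mul h1).tendsto
    simp only [Pi.mul_def, id, zero_mul] at h2
    exact h2.mono_left nhdsWithin_le_nhds
  have hmem0 : (0 : ℂ) ∈ c '' Icc 0 η := ⟨0, ⟨le_rfl, hη⟩, h0⟩
  have hle : 𝓝[(c '' Icc 0 η)ᶜ] (0 : ℂ) ≤ 𝓝[≠] 0 :=
    nhdsWithin_mono _ fun z hz h' => hz (by rw [mem_singleton_iff.1 h']; exact hmem0)
  have hlog := (hσ.tendsto_rpow_mul_log h0 (K := K) hr).mono_left hle
  filter_upwards [self_mem_nhdsWithin, (Metric.tendsto_nhds.1 hfar) (ε / 3) (by positivity),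
    hlog.eventually_lt_const (show 0 < ε / 3 by positivity)] with z hz hzfar hzlog
  rw [dist_zero_right] at hzfar ⊢
  obtain ⟨u₀, hu₀, hu₀le⟩ := hσ.exists_le_norm_sub z
  have hu₀η : u₀ ∈ Icc 0 η := Icc_subset_Icc_right hση hu₀
  -- The parameter `u₀` at which the arc is seen as closest to `z` is itself controlled by `‖z‖`,
  -- since the arc starts at the origin.
  have hu₀z : m * u₀ ≤ ‖z‖ := by
    have := hu₀le 0 ⟨le_rfl, hσ0.le⟩
    rwa [zero_sub, abs_neg, abs_of_nonneg hu₀.1, h0, zero_sub, norm_neg] at this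
  set k : ℝ → ℂ := fun u => c u * g (c u) with hkdef
  have hdc : IntervalIntegrable (deriv c) MeasureTheory.volume 0 σ :=
    hσ.intervalIntegrable_deriv le_rfl hσ0.le le_rfl
  have hkint : IntervalIntegrable (fun u => (k u - k u₀) * deriv c u)
      MeasureTheory.volume 0 σ := by
    refine hdc.continuousOn_mul ?_
    rw [uIcc_of_le hσ0.le]
    exact (hkc.mono (Icc_subset_Icc_right hση)).sub continuousOn_const
  -- From `z / (c - z) = c / (c - z) - 1`, with `k u₀` subtracted from `k = c g(c)`. The three terms
  -- are a Cauchy integral with vanishing density, a logarithmic integral with small coefficient,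
  -- and the mass of a short arc.
  have e1 : z * ∫ u in (0 : ℝ)..σ, (c u - z)⁻¹ * (g (c u) * deriv c u) =
      (∫ u in (0 : ℝ)..σ, (c u - z)⁻¹ * ((k u - k u₀) * deriv c u)) +
      k u₀ * (∫ u in (0 : ℝ)..σ, (c u - z)⁻¹ * deriv c u) -
      ∫ u in (0 : ℝ)..σ, g (c u) * deriv c u := by
    rw [← intervalIntegral.integral_const_mul, ← intervalIntegral.integral_const_mul,
      ← intervalIntegral.integral_add (intervalIntegrable_cauchy hσ0.le hc1 hkint (hsub hz))
        ((intervalIntegrable_cauchy hσ0.le hc1 hdc (hsub hz)).const_mul _),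
      ← intervalIntegral.integral_sub ((intervalIntegrable_cauchy hσ0.le hc1 hkint (hsub hz)).add
        ((intervalIntegrable_cauchy hσ0.le hc1 hdc (hsub hz)).const_mul _)) hi1]
    refine intervalIntegral.integral_congr fun u hu => ?_
    rw [uIcc_of_le hσ0.le] at hu
    have hne : c u - z ≠ 0 := sub_ne_zero.2 fun h' => hsub hz ⟨u, hu, h'⟩
    simp only [hkdef]
    field_simp
    ring
  have b1 : ‖∫ u in (0 : ℝ)..σ, (c u - z)⁻¹ * ((k u - k u₀) * deriv c u)‖ ≤
      K / m ^ r * M * m ^ (r - 1) * (2 / r) * σ ^ r := by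
    refine hσ.norm_integral_cauchy_le hr hr1 (hsub hz) (by positivity) fun u hu => ?_
    refine (hb u (Icc_subset_Icc_right hση hu) u₀ hu₀η).trans ?_
    rw [Real.dist_eq, div_mul_eq_mul_div, mul_div_assoc,
      ← Real.div_rpow (norm_nonneg _) hm.le]
    gcongr
    rw [le_div_iff₀ hm, mul_comm]
    exact hu₀le u hu
  have b2 : ‖k u₀ * (∫ u in (0 : ℝ)..σ, (c u - z)⁻¹ * deriv c u)‖ ≤ K * (‖z‖ / m) ^ r *
      (|Real.log ‖c σ - z‖| + |Real.log ‖z‖| + 2 * Real.pi) := by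
    rw [norm_mul]
    have h1 := hσ.norm_integral_deriv_div_le (hsub hz)
    rw [h0, zero_sub, norm_neg] at h1
    refine mul_le_mul ?_ h1 (norm_nonneg _) (by positivity)
    have h2 := hb u₀ hu₀η 0 ⟨le_rfl, hη⟩
    have hk0 : k 0 = 0 := by simp [hkdef, h0]
    rw [hk0, sub_zero, Real.dist_eq, sub_zero, abs_of_nonneg hu₀.1] at h2
    refine h2.trans ?_
    have := hu₀.1
    gcongr
    rw [le_div_iff₀ hm, mul_comm]
    exact hu₀z
  have b3 : ‖∫ u in (0 : ℝ)..σ, g (c u) * deriv c u‖ ≤ K / m * M / r * σ ^ r := by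
    have : ‖∫ u in (0 : ℝ)..σ, g (c u) * deriv c u‖ ≤
        ∫ u in (0 : ℝ)..σ, K / m * M * u ^ (r - 1) := by
      refine intervalIntegral.norm_integral_le_of_norm_le hσ0.le ?_
        ((intervalIntegrable_rpow_sub_one hr 0 σ).const_mul _)
      have h2 : ∀ᵐ x : ℝ, x ≠ σ := by simp [MeasureTheory.ae_iff]
      filter_upwards [h2] with u hu2 hu
      rw [norm_mul]
      calc ‖g (c u)‖ * ‖deriv c u‖ ≤ K / m * u ^ (r - 1) * M := by
            gcongr
            · have := Real.rpow_nonneg hu.1.le (r - 1)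
              positivity
            · exact h.norm_density_le h0 hb ⟨hu.1, hu.2.trans hση⟩
            · exact hσ.norm_deriv_le u ⟨hu.1, lt_of_le_of_ne hu.2 hu2⟩
        _ = _ := by ring
    refine this.trans (le_of_eq ?_)
    rw [intervalIntegral.integral_const_mul, integral_rpow_sub_one hr]
    ring
  rw [← intervalIntegral.integral_add_adjacent_intervals
    (intervalIntegrable_cauchy hσ0.le hc1 hi1 (hsub hz))
    (intervalIntegrable_cauchy hση hc2 hi2 (hsub' hz)), mul_add]
  have b4 := norm_add_le (z * ∫ u in (0 : ℝ)..σ, (c u - z)⁻¹ * (g (c u) * deriv c u))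
    (z * ∫ u in σ..η, (c u - z)⁻¹ * (g (c u) * deriv c u))
  rw [e1] at b4 ⊢
  have b5 := _root_.norm_sub_le ((∫ u in (0 : ℝ)..σ, (c u - z)⁻¹ * ((k u - k u₀) * deriv c u)) +
      k u₀ * (∫ u in (0 : ℝ)..σ, (c u - z)⁻¹ * deriv c u))
      (∫ u in (0 : ℝ)..σ, g (c u) * deriv c u)
  have b6 := norm_add_le (∫ u in (0 : ℝ)..σ, (c u - z)⁻¹ * ((k u - k u₀) * deriv c u))
    (k u₀ * (∫ u in (0 : ℝ)..σ, (c u - z)⁻¹ * deriv c u))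
  have b7 : C * σ ^ r = K / m ^ r * M * m ^ (r - 1) * (2 / r) * σ ^ r +
    K / m * M / r * σ ^ r := by rw [hC]; ring
  linarith

end IsArc

/-! ### Densities on a loop -/

/-- Densities on the loop that are locally Hölder continuous off the origin and such that `t g(t)`
is Hölder continuous in the parameter, on both arcs at the origin. -/
structure IsDensity (γ : Loop) (g : ℂ → ℂ) : Prop where
  locally_holder : ∀ z ∈ γ.trace \ {0}, ∃ ε > 0,
    IsHolderOn g (γ.trace ∩ Metric.closedBall z ε)
  start_holder : ∃ η > 0, η ≤ 1 ∧ IsHolderOn (fun u => γ.toFun u * g (γ.toFun u)) (Icc 0 η)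
  finish_holder : ∃ η > 0, η ≤ 1 ∧
    IsHolderOn (fun u => γ.toFun (1 - u) * g (γ.toFun (1 - u))) (Icc 0 η)

namespace Loop

variable (γ : Loop)

lemma ne_of_ne {s₀ s : ℝ} (hs₀ : s₀ ∈ Ioo (0 : ℝ) 1) (hs : s ∈ Icc (0 : ℝ) 1) (h : s ≠ s₀) :
    γ.toFun s ≠ γ.toFun s₀ := by
  intro h'
  rcases hs.2.lt_or_eq with h1 | rfl
  · exact h (γ.injOn ⟨hs.1, h1⟩ ⟨hs₀.1.le, hs₀.2⟩ h')
  · rw [γ.map_one, ← γ.map_zero] at h'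
    exact hs₀.1.ne (γ.injOn ⟨le_rfl, zero_lt_one⟩ ⟨hs₀.1.le, hs₀.2⟩ h')

lemma ne_zero {s : ℝ} (hs : s ∈ Ioo (0 : ℝ) 1) : γ.toFun s ≠ 0 := by
  rw [← γ.map_zero]
  exact (γ.ne_of_ne hs ⟨le_rfl, zero_le_one⟩ hs.1.ne).symm

lemma mem_trace {s : ℝ} (hs : s ∈ Icc (0 : ℝ) 1) : γ.toFun s ∈ γ.trace := ⟨s, hs, rfl⟩

lemma exists_param {z : ℂ} (hz : z ∈ γ.trace \ {0}) : ∃ s ∈ Ioo (0 : ℝ) 1, γ.toFun s = z := by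
  obtain ⟨⟨s, hs, rfl⟩, h0⟩ := hz
  refine ⟨s, ⟨lt_of_le_of_ne hs.1 ?_, lt_of_le_of_ne hs.2 ?_⟩, rfl⟩
  · rintro rfl; exact h0 γ.map_zero
  · rintro rfl; exact h0 γ.map_one

lemma exists_isArc_start : ∃ η M m τ, η ≤ 1 ∧ IsArc γ.toFun η M m τ := by
  simpa using γ.exists_isArc_right (s₀ := 0) ⟨le_rfl, zero_lt_one⟩

lemma exists_isArc_finish : ∃ η M m τ, η ≤ 1 ∧ IsArc (fun u => γ.toFun (1 - u)) η M m τ := by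
  simpa using γ.exists_isArc_left (s₀ := 1) ⟨zero_lt_one, le_rfl⟩

lemma isBounded_trace : Bornology.IsBounded γ.trace := γ.isCompact_trace.isBounded

end Loop

namespace IsDensity

variable {γ : Loop} {g f : ℂ → ℂ}

lemma continuousWithinAt (hg : IsDensity γ g) {z : ℂ} (hz : z ∈ γ.trace \ {0}) :
    ContinuousWithinAt g γ.trace z := by
  obtain ⟨ε, hε, h⟩ := hg.locally_holder z hz
  have := h.continuousOn z ⟨hz.1, Metric.mem_closedBall_self hε.le⟩
  exact this.mono_of_mem_nhdsWithin
    (inter_mem_nhdsWithin _ (Metric.closedBall_mem_nhds z hε))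

lemma continuousOn_comp (hg : IsDensity γ g) :
    ContinuousOn (fun s => g (γ.toFun s)) (Ioo 0 1) := by
  intro s hs
  exact (hg.continuousWithinAt ⟨γ.mem_trace (Ioo_subset_Icc_self hs), γ.ne_zero hs⟩).comp
    ((γ.continuousOn s (Ioo_subset_Icc_self hs)).mono Ioo_subset_Icc_self)
    fun u hu => γ.mem_trace (Ioo_subset_Icc_self hu)

lemma exists_start (hg : IsDensity γ g) : ∃ η M m τ, η ≤ 1 / 2 ∧ IsArc γ.toFun η M m τ ∧
    IsHolderOn (fun u => γ.toFun u * g (γ.toFun u)) (Icc 0 η) := by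
  obtain ⟨η, M, m, τ, -, h⟩ := γ.exists_isArc_start
  obtain ⟨η', hη', -, h'⟩ := hg.start_holder
  have h0 : 0 < min (min η η') (1 / 2) := lt_min (lt_min h.length_pos hη') (by norm_num)
  exact ⟨min (min η η') (1 / 2), M, m, τ, min_le_right _ _,
    h.mono h0 ((min_le_left _ _).trans (min_le_left _ _)),
    h'.mono (Icc_subset_Icc_right ((min_le_left _ _).trans (min_le_right _ _)))⟩

lemma exists_finish (hg : IsDensity γ g) : ∃ η M m τ, η ≤ 1 / 2 ∧
    IsArc (fun u => γ.toFun (1 - u)) η M m τ ∧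
    IsHolderOn (fun u => γ.toFun (1 - u) * g (γ.toFun (1 - u))) (Icc 0 η) := by
  obtain ⟨η, M, m, τ, -, h⟩ := γ.exists_isArc_finish
  obtain ⟨η', hη', -, h'⟩ := hg.finish_holder
  have h0 : 0 < min (min η η') (1 / 2) := lt_min (lt_min h.length_pos hη') (by norm_num)
  exact ⟨min (min η η') (1 / 2), M, m, τ, min_le_right _ _,
    h.mono h0 ((min_le_left _ _).trans (min_le_left _ _)),
    h'.mono (Icc_subset_Icc_right ((min_le_left _ _).trans (min_le_right _ _)))⟩

lemma intervalIntegrable_middle (hg : IsDensity γ g) {a b : ℝ} (ha : 0 < a) (hab : a ≤ b)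
    (hb : b < 1) :
    IntervalIntegrable (fun s => g (γ.toFun s) * deriv γ.toFun s) MeasureTheory.volume a b := by
  refine IntervalIntegrable.continuousOn_mul (γ.intervalIntegrable_deriv.mono_set ?_) ?_
  · rw [uIcc_of_le hab, uIcc_of_le zero_le_one]; exact Icc_subset_Icc ha.le hb.le
  · rw [uIcc_of_le hab]
    exact hg.continuousOn_comp.mono fun x hx => ⟨ha.trans_le hx.1, hx.2.trans_lt hb⟩

lemma intervalIntegrable (hg : IsDensity γ g) :
    IntervalIntegrable (fun s => g (γ.toFun s) * deriv γ.toFun s) MeasureTheory.volume 0 1 := by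
  obtain ⟨a, M, m, τ, ha, harc, hk⟩ := hg.exists_start
  obtain ⟨b, M', m', τ', hb, harc', hk'⟩ := hg.exists_finish
  have h1 := harc.intervalIntegrable_density γ.map_zero hk
  have h2 := hg.intervalIntegrable_middle (b := 1 - b) harc.length_pos (by linarith)
    (by linarith [harc'.length_pos])
  have h3 := harc'.intervalIntegrable_density (g := g) (by simp [γ.map_one]) hk'
  have h4 := (h3.comp_sub_left 1).neg.symm
  refine (h1.trans h2).trans (IntervalIntegrable.congr (fun s _ => ?_) (by simpa using h4))
  simp [deriv_comp_const_sub]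

end IsDensity

/-! ### The Cauchy transform -/

/-- The Cauchy transform of a density along the loop. -/
def cauchyTransform (γ : Loop) (g : ℂ → ℂ) (z : ℂ) : ℂ :=
  loopIntegral γ.toFun fun t => (t - z)⁻¹ * g t

section

variable {γ : Loop} {g : ℂ → ℂ}

lemma cauchyTransform_eq (z : ℂ) : cauchyTransform γ g z = (2 * (Real.pi : ℂ) * Complex.I)⁻¹ *
    ∫ s in (0 : ℝ)..1, (γ.toFun s - z)⁻¹ * (g (γ.toFun s) * deriv γ.toFun s) := by
  simp only [cauchyTransform, loopIntegral, mul_assoc]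

lemma windingNumber_eq (z : ℂ) : windingNumber γ.toFun z = (2 * (Real.pi : ℂ) * Complex.I)⁻¹ *
    ∫ s in (0 : ℝ)..1, (γ.toFun s - z)⁻¹ * deriv γ.toFun s := rfl

lemma differentiableOn_cauchyTransform (hg : IsDensity γ g) :
    DifferentiableOn ℂ (cauchyTransform γ g) γ.traceᶜ := by
  intro z hz
  have h1 := differentiableAt_cauchyIntegral zero_le_one γ.continuousOn hg.intervalIntegrable hz
  refine (DifferentiableAt.congr_of_eventuallyEq
    (h1.const_mul (2 * (Real.pi : ℂ) * Complex.I)⁻¹) ?_).differentiableWithinAt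
  exact .of_forall fun z => cauchyTransform_eq z

lemma isBigO_cauchyTransform (hg : IsDensity γ g) :
    cauchyTransform γ g =O[Bornology.cobounded ℂ] fun z => z⁻¹ := by
  have h1 := (isBigO_cauchyIntegral zero_le_one γ.continuousOn hg.intervalIntegrable).const_mul_left
    (2 * (Real.pi : ℂ) * Complex.I)⁻¹
  exact h1.congr_left fun z => (cauchyTransform_eq z).symm

/-- Since `z / (t - z) = t / (t - z) - 1`, a factor `z` moves under the integral at the cost of one
moment. -/
lemma mul_cauchyTransform (hg : IsDensity γ g) (hg' : IsDensity γ fun t => t * g t) {z : ℂ}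
    (hz : z ∉ γ.trace) : z * cauchyTransform γ g z =
      cauchyTransform γ (fun t => t * g t) z - loopIntegral γ.toFun g := by
  rw [cauchyTransform_eq, cauchyTransform_eq, loopIntegral, ← mul_sub, mul_left_comm,
    ← intervalIntegral.integral_const_mul, ← intervalIntegral.integral_sub
      (intervalIntegrable_cauchy zero_le_one γ.continuousOn hg'.intervalIntegrable hz)
      hg.intervalIntegrable]
  congr 1
  refine intervalIntegral.integral_congr fun s hs => ?_
  rw [uIcc_of_le zero_le_one] at hs
  have hne : γ.toFun s - z ≠ 0 := sub_ne_zero.2 fun h' => hz ⟨s, hs, h'⟩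
  field_simp
  ring

/-- `z Q(z) → 0` at the origin, from all directions off the loop. -/
lemma tendsto_mul_cauchyTransform (hg : IsDensity γ g) :
    Tendsto (fun z => z * cauchyTransform γ g z) (𝓝[γ.traceᶜ] 0) (𝓝 0) := by
  obtain ⟨a, M, m, τ, ha, harc, hk⟩ := hg.exists_start
  obtain ⟨b, M', m', τ', hb, harc', hk'⟩ := hg.exists_finish
  have ha0 := harc.length_pos
  have hb0 := harc'.length_pos
  have hsub1 : γ.toFun '' Icc 0 a ⊆ γ.trace := image_mono (Icc_subset_Icc_right (by linarith))
  have hsub2 : (fun u => γ.toFun (1 - u)) '' Icc 0 b ⊆ γ.trace := by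
    rintro _ ⟨u, hu, rfl⟩
    exact γ.mem_trace ⟨by linarith [hu.2], by linarith [hu.1]⟩
  have t1 := (harc.tendsto_mul_cauchyIntegral γ.map_zero hk).mono_left
    (nhdsWithin_mono 0 (compl_subset_compl.2 hsub1))
  have t3 := (harc'.tendsto_mul_cauchyIntegral (g := g) (by simp [γ.map_one]) hk').mono_left
    (nhdsWithin_mono 0 (compl_subset_compl.2 hsub2))
  have hi := hg.intervalIntegrable
  have hmid := hg.intervalIntegrable_middle (b := 1 - b) ha0 (by linarith) (by linarith)
  have hcmid : ContinuousOn γ.toFun (Icc a (1 - b)) :=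
    γ.continuousOn.mono (Icc_subset_Icc ha0.le (by linarith))
  have t2 : Tendsto (fun z => z * ∫ s in a..(1 - b),
      (γ.toFun s - z)⁻¹ * (g (γ.toFun s) * deriv γ.toFun s)) (𝓝[γ.traceᶜ] 0) (𝓝 0) := by
    have hz0 : (0 : ℂ) ∉ γ.toFun '' Icc a (1 - b) := by
      rintro ⟨u, hu, h'⟩
      exact γ.ne_zero ⟨ha0.trans_le hu.1, by linarith [hu.2]⟩ h'
    have h1 := (differentiableAt_cauchyIntegral (by linarith) hcmid hmid hz0).continuousAt
    have h2 := (continuousAt_id.mul h1).tendsto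
    simp only [Pi.mul_def, id, zero_mul] at h2
    exact h2.mono_left nhdsWithin_le_nhds
  have h4 := ((t1.add t2).add t3.neg).const_mul (2 * (Real.pi : ℂ) * Complex.I)⁻¹
  simp only [add_zero, neg_zero, mul_zero] at h4
  refine h4.congr' ?_
  filter_upwards [self_mem_nhdsWithin] with z hz
  have hiz := intervalIntegrable_cauchy zero_le_one γ.continuousOn hi hz
  have hz' : ∀ x y, 0 ≤ x → x ≤ y → y ≤ 1 → IntervalIntegrable (fun s => (γ.toFun s - z)⁻¹ *
      (g (γ.toFun s) * deriv γ.toFun s)) MeasureTheory.volume x y := fun x y hx hxy hy =>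
    hiz.mono_set (by rw [uIcc_of_le hxy, uIcc_of_le zero_le_one]; exact Icc_subset_Icc hx hy)
  -- The final arc was parametrised from the origin backwards, which reverses the sign of its
  -- integral.
  have e3 : (∫ u in (0 : ℝ)..b, (γ.toFun (1 - u) - z)⁻¹ * (g (γ.toFun (1 - u)) *
      deriv (fun u => γ.toFun (1 - u)) u)) = -∫ s in (1 - b)..1, (γ.toFun s - z)⁻¹ *
      (g (γ.toFun s) * deriv γ.toFun s) := by
    have := intervalIntegral.integral_comp_sub_left (a := 0) (b := b)
      (fun s => (γ.toFun s - z)⁻¹ * (g (γ.toFun s) * deriv γ.toFun s)) 1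
    rw [sub_zero] at this
    rw [← this, ← intervalIntegral.integral_neg]
    refine intervalIntegral.integral_congr fun u _ => ?_
    simp only [deriv_comp_const_sub]
    ring
  rw [cauchyTransform_eq, ← intervalIntegral.integral_add_adjacent_intervals
      (hz' 0 (1 - b) le_rfl (by linarith) (by linarith))
      (hz' (1 - b) 1 (by linarith) (by linarith) le_rfl),
    ← intervalIntegral.integral_add_adjacent_intervals
      (hz' 0 a le_rfl ha0.le (by linarith)) (hz' a (1 - b) ha0.le (by linarith) (by linarith)), e3]
  ring

/-- Up to every `ε`, the function agrees eventually with a convergent one, so its image filter is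
Cauchy. Completeness gives a limit without identifying it. -/
lemma exists_tendsto_of_approx {l : Filter ℂ} [NeBot l] {F : ℂ → ℂ}
    (h : ∀ ε > 0, ∃ B : ℂ → ℂ, ∃ b, Tendsto B l (𝓝 b) ∧ ∀ᶠ z in l, ‖F z - B z‖ ≤ ε) :
    ∃ w, Tendsto F l (𝓝 w) := by
  refine cauchy_map_iff_exists_tendsto.1 (Metric.cauchy_iff.2 ⟨inferInstance, fun ε hε => ?_⟩)
  obtain ⟨B, b, hB, hF⟩ := h (ε / 4) (by positivity)
  refine ⟨Metric.ball b (ε / 2), ?_, fun x hx y hy => ?_⟩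
  · rw [mem_map]
    filter_upwards [hF, Metric.tendsto_nhds.1 hB (ε / 4) (by positivity)] with z h1 h2
    rw [mem_preimage, Metric.mem_ball]
    rw [← dist_eq_norm] at h1
    linarith [dist_triangle (F z) (B z) b]
  · rw [Metric.mem_ball] at hx hy
    linarith [dist_triangle_right x y b]

end

/-! ### Boundary values of the Cauchy transform off the origin. -/

section

variable {γ : Loop} {g : ℂ → ℂ}

/-- Subtracting the density at a nearest point `p z`, not at the limit point, makes the numerator
small where the kernel is large, however `z` approaches the loop. Tangential approach is therefore
covered and the boundary limits are unrestricted. -/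
lemma Loop.exists_nearest (γ : Loop) : ∃ p : ℂ → ℂ, (∀ z, p z ∈ γ.trace) ∧
    ∀ z, ∀ t ∈ γ.trace, ‖z - p z‖ ≤ ‖z - t‖ := by
  have : ∀ z : ℂ, ∃ p ∈ γ.trace, ∀ t ∈ γ.trace, ‖z - p‖ ≤ ‖z - t‖ := by
    intro z
    obtain ⟨p, hp, hd⟩ := γ.isCompact_trace.exists_infDist_eq_dist ⟨0, γ.zero_mem_trace⟩ z
    refine ⟨p, hp, fun t ht => ?_⟩
    rw [← dist_eq_norm, ← dist_eq_norm, ← hd]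
    exact Metric.infDist_le_dist_of_mem ht
  choose p hp h using this
  exact ⟨p, hp, h⟩

/-- The Cauchy integral, minus its jump, is continuous at the points of the loop off the origin. -/
lemma exists_tendsto_sub_jump (hg : IsDensity γ g) {z₀ : ℂ} (hz₀ : z₀ ∈ γ.trace \ {0})
    {p : ℂ → ℂ} (hp : ∀ z, p z ∈ γ.trace) (hpn : ∀ z, ∀ t ∈ γ.trace, ‖z - p z‖ ≤ ‖z - t‖)
    (hgp : Tendsto (fun z => g (p z)) (𝓝 z₀) (𝓝 (g z₀))) :
    ∃ w, Tendsto (fun z => ∫ s in (0 : ℝ)..1, (γ.toFun s - z)⁻¹ *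
      ((g (γ.toFun s) - g (p z)) * deriv γ.toFun s)) (𝓝[γ.traceᶜ] z₀) (𝓝 w) := by
  have : NeBot (𝓝[γ.traceᶜ] z₀) := mem_closure_iff_nhdsWithin_neBot.1 (γ.dense_compl_trace z₀)
  obtain ⟨s₀, hs₀, rfl⟩ := γ.exists_param hz₀
  obtain ⟨η₁, M₁, m₁, τ₁, hη₁, harc₁⟩ := γ.exists_isArc_right ⟨hs₀.1.le, hs₀.2⟩
  obtain ⟨η₂, M₂, m₂, τ₂, hη₂, harc₂⟩ := γ.exists_isArc_left ⟨hs₀.1, hs₀.2.le⟩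
  obtain ⟨ρ, hρ, K, r, hK, hr, hr1, hb⟩ := hg.locally_holder _ hz₀
  obtain ⟨L, hL0, hL⟩ := γ.exists_lipschitz
  -- The constants of `IsArc.norm_integral_cauchy_le` on the arcs after and before `s₀`, with Hölder
  -- constant `K * 2 ^ r` from `hden`. They do not involve `z`, so `σ` can be chosen first.
  set C₁ := K * 2 ^ r * M₁ * m₁ ^ (r - 1) * (2 / r) with hC₁
  set C₂ := K * 2 ^ r * M₂ * m₂ ^ (r - 1) * (2 / r) with hC₂
  refine exists_tendsto_of_approx fun ε hε => ?_
  obtain ⟨σ, hσ0, hσ₁, hσ₂, hσρ, hσε⟩ : ∃ σ, 0 < σ ∧ σ ≤ η₁ ∧ σ ≤ η₂ ∧ L * σ ≤ ρ ∧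
      C₁ * σ ^ r + C₂ * σ ^ r ≤ ε := by
    have h1 : Tendsto (fun σ : ℝ => σ ^ r) (𝓝[>] 0) (𝓝 0) := by
      have := (Real.continuousAt_rpow_const 0 r (Or.inr hr.le)).tendsto
      rw [Real.zero_rpow hr.ne'] at this
      exact this.mono_left nhdsWithin_le_nhds
    have h2 : Tendsto (fun σ : ℝ => C₁ * σ ^ r + C₂ * σ ^ r) (𝓝[>] 0) (𝓝 0) := by
      simpa using (h1.const_mul C₁).add (h1.const_mul C₂)
    have h3 : Tendsto (fun σ : ℝ => L * σ) (𝓝[>] 0) (𝓝 0) := by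
      have : Tendsto (fun σ : ℝ => L * σ) (𝓝 0) (𝓝 (L * 0)) :=
        (continuous_const.mul continuous_id).tendsto 0
      rw [mul_zero] at this
      exact this.mono_left nhdsWithin_le_nhds
    obtain ⟨σ, ⟨⟨h4, h5⟩, h6⟩, h7⟩ := (((h2.eventually_lt_const hε).and
      (h3.eventually_lt_const hρ)).and (Ioo_mem_nhdsGT harc₁.length_pos)).and
      (Ioo_mem_nhdsGT harc₂.length_pos) |>.exists
    exact ⟨σ, h6.1, h6.2.le, h7.2.le, h5.le, h4.le⟩
  have ha0 : 0 ≤ s₀ - σ := by linarith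
  have hb1 : s₀ + σ ≤ 1 := by linarith
  set F : ℂ → ℝ → ℂ := fun z s => (γ.toFun s - z)⁻¹ *
      ((g (γ.toFun s) - g (p z)) * deriv γ.toFun s) with hF
  have hgi := hg.intervalIntegrable
  have hdi := γ.intervalIntegrable_deriv
  have hsub : ∀ {x y : ℝ}, 0 ≤ x → x ≤ y → y ≤ 1 → uIcc x y ⊆ uIcc 0 1 := by
    intro x y hx hxy hy
    rw [uIcc_of_le hxy, uIcc_of_le zero_le_one]; exact Icc_subset_Icc hx hy
  have hFi : ∀ z ∉ γ.trace, ∀ x y, 0 ≤ x → x ≤ y → y ≤ 1 →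
      IntervalIntegrable (F z) MeasureTheory.volume x y := by
    intro z hz x y hx hxy hy
    refine IntervalIntegrable.mono_set ?_ (hsub hx hxy hy)
    refine intervalIntegrable_cauchy zero_le_one γ.continuousOn ?_ hz
    simp only [sub_mul]
    exact hgi.sub (hdi.const_mul _)
  -- Away from `s₀` both Cauchy integrals are continuous at the limit point, and `g (p z)` converges
  -- by assumption.
  have hfar : ∀ x y, 0 ≤ x → x ≤ y → y ≤ 1 → s₀ ∉ Icc x y →
      ∃ w, Tendsto (fun z => ∫ s in x..y, F z s) (𝓝[γ.traceᶜ] (γ.toFun s₀)) (𝓝 w) := by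
    intro x y hx hxy hy hs
    have hcx : ContinuousOn γ.toFun (Icc x y) := γ.continuousOn.mono (Icc_subset_Icc hx hy)
    have hz0 : γ.toFun s₀ ∉ γ.toFun '' Icc x y := by
      rintro ⟨u, hu, h'⟩
      refine γ.ne_of_ne hs₀ (Icc_subset_Icc hx hy hu) ?_ h'
      rintro rfl; exact hs hu
    have i1 := hgi.mono_set (hsub hx hxy hy)
    have i2 := hdi.mono_set (hsub hx hxy hy)
    have h1 := (differentiableAt_cauchyIntegral hxy hcx i1 hz0).continuousAt.tendsto
    have h2 := (differentiableAt_cauchyIntegral hxy hcx i2 hz0).continuousAt.tendsto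
    refine ⟨_, ((h1.sub (hgp.mul h2)).mono_left nhdsWithin_le_nhds).congr' ?_⟩
    filter_upwards [self_mem_nhdsWithin] with z hz
    have hz' : z ∉ γ.toFun '' Icc x y := fun h' => hz (image_mono (Icc_subset_Icc hx hy) h')
    rw [← intervalIntegral.integral_const_mul, ← intervalIntegral.integral_sub
      (intervalIntegrable_cauchy hxy hcx i1 hz')
      ((intervalIntegrable_cauchy hxy hcx i2 hz').const_mul _)]
    refine intervalIntegral.integral_congr fun s _ => ?_
    simp only [hF]; ring
  obtain ⟨w₁, hw₁⟩ := hfar 0 (s₀ - σ) le_rfl ha0 (by linarith) fun h => by linarith [h.2]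
  obtain ⟨w₂, hw₂⟩ := hfar (s₀ + σ) 1 (by linarith) hb1 le_rfl fun h => by linarith [h.1]
  refine ⟨_, _, hw₁.add hw₂, ?_⟩
  have hnear : ∀ᶠ z in 𝓝[γ.traceᶜ] (γ.toFun s₀), z ∈ Metric.ball (γ.toFun s₀) (ρ / 2) :=
    nhdsWithin_le_nhds (Metric.ball_mem_nhds _ (half_pos hρ))
  filter_upwards [self_mem_nhdsWithin, hnear] with z hz hzρ
  have hpz : p z ∈ γ.trace ∩ Metric.closedBall (γ.toFun s₀) ρ := by
    refine ⟨hp z, ?_⟩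
    rw [Metric.mem_ball, dist_eq_norm] at hzρ
    rw [Metric.mem_closedBall, dist_eq_norm]
    have h1 := hpn z _ hz₀.1
    have h2 : p z - γ.toFun s₀ = (z - γ.toFun s₀) - (z - p z) := by ring
    rw [h2]
    exact (norm_sub_le _ _).trans (by linarith)
  -- Minimality of `p z` gives `‖γ s - p z‖ ≤ 2 * ‖γ s - z‖`; this is the origin of `2 ^ r`.
  have hden : ∀ s ∈ Icc (0 : ℝ) 1, |s - s₀| ≤ σ →
      ‖g (γ.toFun s) - g (p z)‖ ≤ K * 2 ^ r * ‖γ.toFun s - z‖ ^ r := by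
    intro s hs hss
    have hst := γ.mem_trace hs
    have h1 : γ.toFun s ∈ γ.trace ∩ Metric.closedBall (γ.toFun s₀) ρ := by
      refine ⟨hst, ?_⟩
      rw [Metric.mem_closedBall, dist_eq_norm]
      refine (hL s hs s₀ (Ioo_subset_Icc_self hs₀)).trans (le_trans ?_ hσρ)
      gcongr
    refine (hb _ h1 _ hpz).trans ?_
    rw [mul_assoc, ← Real.mul_rpow two_pos.le (norm_nonneg _)]
    gcongr
    rw [dist_eq_norm]
    have h2 : γ.toFun s - p z = (γ.toFun s - z) + (z - p z) := by ring
    have h3 := hpn z _ hst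
    rw [norm_sub_rev z (γ.toFun s)] at h3
    rw [h2]
    exact (norm_add_le _ _).trans (by linarith)
  have n1 : ‖∫ s in s₀..(s₀ + σ), F z s‖ ≤ C₁ * σ ^ r := by
    have harc := harc₁.mono hσ0 hσ₁
    have hmem : ∀ u ∈ Icc 0 σ, s₀ + u ∈ Icc (0 : ℝ) 1 := fun u hu =>
      ⟨by linarith [hu.1, hs₀.1], by linarith [hu.2]⟩
    have hz' : z ∉ (fun u => γ.toFun (s₀ + u)) '' Icc 0 σ := by
      rintro ⟨u, hu, rfl⟩; exact hz (γ.mem_trace (hmem u hu))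
    have h1 := harc.norm_integral_cauchy_le hr hr1 hz'
      (k := fun u => g (γ.toFun (s₀ + u)) - g (p z)) (K := K * 2 ^ r) (by positivity)
      fun u hu => hden _ (hmem u hu) (by
        rw [add_sub_cancel_left, abs_of_nonneg hu.1]; exact hu.2)
    have h2 := intervalIntegral.integral_comp_add_left (a := 0) (b := σ) (F z) s₀
    rw [add_zero] at h2
    rw [← h2]
    simpa only [hF, deriv_comp_const_add] using h1
  have n2 : ‖∫ s in (s₀ - σ)..s₀, F z s‖ ≤ C₂ * σ ^ r := by
    have harc := harc₂.mono hσ0 hσ₂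
    have hmem : ∀ u ∈ Icc 0 σ, s₀ - u ∈ Icc (0 : ℝ) 1 := fun u hu =>
      ⟨by linarith [hu.2], by linarith [hu.1, hs₀.2]⟩
    have hz' : z ∉ (fun u => γ.toFun (s₀ - u)) '' Icc 0 σ := by
      rintro ⟨u, hu, rfl⟩; exact hz (γ.mem_trace (hmem u hu))
    have h1 := harc.norm_integral_cauchy_le hr hr1 hz'
      (k := fun u => g (γ.toFun (s₀ - u)) - g (p z)) (K := K * 2 ^ r) (by positivity)
      fun u hu => hden _ (hmem u hu) (by
        rw [sub_sub_cancel_left, abs_neg, abs_of_nonneg hu.1]; exact hu.2)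
    have h2 := intervalIntegral.integral_comp_sub_left (a := 0) (b := σ) (F z) s₀
    rw [sub_zero] at h2
    rw [← h2, ← norm_neg, ← intervalIntegral.integral_neg]
    simpa only [hF, deriv_comp_const_sub, mul_neg] using h1
  have e1 : (∫ s in (0 : ℝ)..1, F z s) =
      (∫ s in (0 : ℝ)..(s₀ - σ), F z s) + (∫ s in (s₀ - σ)..s₀, F z s) +
      (∫ s in s₀..(s₀ + σ), F z s) + ∫ s in (s₀ + σ)..1, F z s := by
    rw [intervalIntegral.integral_add_adjacent_intervals
        (hFi z hz _ _ le_rfl ha0 (by linarith)) (hFi z hz _ _ ha0 (by linarith) (by linarith)),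
      intervalIntegral.integral_add_adjacent_intervals
        (hFi z hz _ _ le_rfl (by linarith) (by linarith))
        (hFi z hz _ _ (by linarith) (by linarith) (by linarith)),
      intervalIntegral.integral_add_adjacent_intervals
        (hFi z hz _ _ le_rfl (by linarith) (by linarith))
        (hFi z hz _ _ (by linarith) (by linarith) (by linarith))]
  have e2 : (∫ s in (0 : ℝ)..1, F z s) - ((∫ s in (0 : ℝ)..(s₀ - σ), F z s) +
      ∫ s in (s₀ + σ)..1, F z s) = (∫ s in (s₀ - σ)..s₀, F z s) +
      (∫ s in s₀..(s₀ + σ), F z s) := by rw [e1]; ring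
  change ‖(∫ s in (0 : ℝ)..1, F z s) - ((∫ s in (0 : ℝ)..(s₀ - σ), F z s) +
      ∫ s in (s₀ + σ)..1, F z s)‖ ≤ ε
  rw [e2]
  exact (norm_add_le _ _).trans (by linarith)

/-- The jump relation of Plemelj. -/
theorem exists_tendsto_cauchyTransform (hg : IsDensity γ g) {z₀ : ℂ} (hz₀ : z₀ ∈ γ.trace \ {0}) :
    ∃ w, Tendsto (cauchyTransform γ g) (𝓝[γ.plusSide] z₀) (𝓝 (w + g z₀)) ∧
      Tendsto (cauchyTransform γ g) (𝓝[γ.minusSide] z₀) (𝓝 w) := by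
  obtain ⟨p, hp, hpn⟩ := γ.exists_nearest
  have hpt : Tendsto p (𝓝 z₀) (𝓝[γ.trace] z₀) := by
    refine tendsto_nhdsWithin_iff.2 ⟨?_, .of_forall hp⟩
    rw [tendsto_iff_norm_sub_tendsto_zero]
    have h1 : Tendsto (fun z => 2 * ‖z - z₀‖) (𝓝 z₀) (𝓝 0) := by
      have : Continuous fun z : ℂ => 2 * ‖z - z₀‖ := by fun_prop
      simpa using this.tendsto z₀
    refine squeeze_zero (fun _ => norm_nonneg _) (fun z => ?_) h1
    have h2 : p z - z₀ = (z - z₀) - (z - p z) := by ring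
    rw [h2]
    refine (norm_sub_le _ _).trans ?_
    linarith [hpn z z₀ hz₀.1]
  have hgp : Tendsto (fun z => g (p z)) (𝓝 z₀) (𝓝 (g z₀)) :=
    (hg.continuousWithinAt hz₀).tendsto.comp hpt
  obtain ⟨w, hw⟩ := exists_tendsto_sub_jump hg hz₀ hp hpn hgp
  have hw' := hw.const_mul (2 * (Real.pi : ℂ) * Complex.I)⁻¹
  -- Splitting the convergent integral produces the winding number as coefficient of `g (p z)`. It
  -- is `0` on the `+` side and `-1` on the `-` side, so the jump of the transform is `g z₀`.
  have key : ∀ z ∉ γ.trace, (2 * (Real.pi : ℂ) * Complex.I)⁻¹ *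
      (∫ s in (0 : ℝ)..1, (γ.toFun s - z)⁻¹ * ((g (γ.toFun s) - g (p z)) * deriv γ.toFun s)) =
      cauchyTransform γ g z - g (p z) * windingNumber γ.toFun z := by
    intro z hz
    rw [cauchyTransform_eq, windingNumber_eq, mul_left_comm, ← mul_sub,
      ← intervalIntegral.integral_const_mul (g (p z)), ← intervalIntegral.integral_sub
        (intervalIntegrable_cauchy zero_le_one γ.continuousOn hg.intervalIntegrable hz)
        ((intervalIntegrable_cauchy zero_le_one γ.continuousOn γ.intervalIntegrable_deriv
          hz).const_mul _)]
    congr 1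
    refine intervalIntegral.integral_congr fun s _ => ?_
    ring
  set w' := (2 * (Real.pi : ℂ) * Complex.I)⁻¹ * w
  refine ⟨w' - g z₀, ?_, ?_⟩
  · rw [sub_add_cancel]
    refine (hw'.mono_left (nhdsWithin_mono _ fun z hz => hz.1)).congr' ?_
    filter_upwards [self_mem_nhdsWithin] with z hz
    rw [key z hz.1, hz.2, mul_zero, sub_zero]
  · refine ((hw'.mono_left (nhdsWithin_mono _ fun z hz => hz.1)).sub
      (hgp.mono_left nhdsWithin_le_nhds)).congr' ?_
    filter_upwards [self_mem_nhdsWithin] with z hz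
    rw [key z hz.1, hz.2]; ring

end

/-! ### Algebra of densities -/

namespace IsDensity

variable {γ : Loop} {g f : ℂ → ℂ}

/-- The value at the origin is immaterial: the factor `z` removes it in the end conditions, and a
closed ball of radius at most `‖z‖ / 2` about `z` avoids it in the local one. -/
lemma congr (hg : IsDensity γ g) (h : ∀ z ∈ γ.trace \ {0}, f z = g z) : IsDensity γ f := by
  have hmul : ∀ z ∈ γ.trace, z * f z = z * g z := by
    intro z hz
    rcases eq_or_ne z 0 with rfl | h0
    · simp
    · rw [h z ⟨hz, h0⟩]
  refine ⟨fun z hz => ?_, ?_, ?_⟩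
  · obtain ⟨ε, hε, h'⟩ := hg.locally_holder z hz
    have hz0 : 0 < ‖z‖ := norm_pos_iff.2 hz.2
    refine ⟨min ε (‖z‖ / 2), lt_min hε (half_pos hz0), (h'.mono ?_).congr fun t ht => ?_⟩
    · exact inter_subset_inter_right _ (Metric.closedBall_subset_closedBall (min_le_left _ _))
    · refine h t ⟨ht.1, ?_⟩
      rintro rfl
      have h1 := ht.2
      rw [Metric.mem_closedBall, dist_zero_left] at h1
      linarith [min_le_right ε (‖z‖ / 2)]
  · obtain ⟨η, h0, h1, h'⟩ := hg.start_holder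
    exact ⟨η, h0, h1, h'.congr fun u hu => hmul _ (γ.mem_trace ⟨hu.1, hu.2.trans h1⟩)⟩
  · obtain ⟨η, h0, h1, h'⟩ := hg.finish_holder
    exact ⟨η, h0, h1, h'.congr fun u hu =>
      hmul _ (γ.mem_trace ⟨by linarith [hu.2], by linarith [hu.1]⟩)⟩

lemma zero : IsDensity γ fun _ => 0 :=
  ⟨fun _ _ => ⟨1, one_pos, .const 0⟩, ⟨1, one_pos, le_rfl, by simpa using .const 0⟩,
    ⟨1, one_pos, le_rfl, by simpa using .const 0⟩⟩

lemma add (hf : IsDensity γ f) (hg : IsDensity γ g) : IsDensity γ fun z => f z + g z := by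
  refine ⟨fun z hz => ?_, ?_, ?_⟩
  · obtain ⟨ε, hε, h⟩ := hf.locally_holder z hz
    obtain ⟨ε', hε', h'⟩ := hg.locally_holder z hz
    exact ⟨min ε ε', lt_min hε hε', (h.mono (inter_subset_inter_right _
      (Metric.closedBall_subset_closedBall (min_le_left _ _)))).add (h'.mono
      (inter_subset_inter_right _ (Metric.closedBall_subset_closedBall (min_le_right _ _))))
      (γ.isBounded_trace.subset inter_subset_left)⟩
  · obtain ⟨η, h0, h1, h⟩ := hf.start_holder
    obtain ⟨η', h0', h1', h'⟩ := hg.start_holder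
    refine ⟨min η η', lt_min h0 h0', (min_le_left _ _).trans h1, ?_⟩
    exact ((h.mono (Icc_subset_Icc_right (min_le_left _ _))).add
      (h'.mono (Icc_subset_Icc_right (min_le_right _ _))) (Metric.isBounded_Icc _ _)).congr
      fun u _ => mul_add _ _ _
  · obtain ⟨η, h0, h1, h⟩ := hf.finish_holder
    obtain ⟨η', h0', h1', h'⟩ := hg.finish_holder
    refine ⟨min η η', lt_min h0 h0', (min_le_left _ _).trans h1, ?_⟩
    exact ((h.mono (Icc_subset_Icc_right (min_le_left _ _))).add
      (h'.mono (Icc_subset_Icc_right (min_le_right _ _))) (Metric.isBounded_Icc _ _)).congr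
      fun u _ => mul_add _ _ _

lemma sum {ι : Type*} {s : Finset ι} {F : ι → ℂ → ℂ} (h : ∀ i ∈ s, IsDensity γ (F i)) :
    IsDensity γ fun z => ∑ i ∈ s, F i z := by
  classical
  induction s using Finset.induction_on with
  | empty => simpa using zero
  | insert i s hi ih =>
    simp only [Finset.sum_insert hi]
    exact (h i (Finset.mem_insert_self _ _)).add
      (ih fun j hj => h j (Finset.mem_insert_of_mem hj))

lemma holder_mul (hg : IsDensity γ g) {φ : ℂ → ℂ} (hφ : IsHolderOn φ γ.trace) :
    IsDensity γ fun z => φ z * g z := by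
  obtain ⟨L, hL0, hL⟩ := γ.exists_lipschitz
  refine ⟨fun z hz => ?_, ?_, ?_⟩
  · obtain ⟨ε, hε, h⟩ := hg.locally_holder z hz
    exact ⟨ε, hε, (hφ.mono inter_subset_left).mul h
      (γ.isBounded_trace.subset inter_subset_left)⟩
  · obtain ⟨η, h0, h1, h⟩ := hg.start_holder
    refine ⟨η, h0, h1, IsHolderOn.congr (IsHolderOn.mul (f := fun u => φ (γ.toFun u)) ?_ h
      (Metric.isBounded_Icc _ _)) fun u _ => mul_left_comm _ _ _⟩
    refine hφ.comp hL0 (fun x hx y hy => ?_) fun u hu => γ.mem_trace ⟨hu.1, hu.2.trans h1⟩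
    rw [dist_eq_norm, Real.dist_eq]
    exact hL _ ⟨hx.1, hx.2.trans h1⟩ _ ⟨hy.1, hy.2.trans h1⟩
  · obtain ⟨η, h0, h1, h⟩ := hg.finish_holder
    have hmem : ∀ u ∈ Icc 0 η, 1 - u ∈ Icc (0 : ℝ) 1 := fun u hu =>
      ⟨by linarith [hu.2], by linarith [hu.1]⟩
    refine ⟨η, h0, h1, IsHolderOn.congr (IsHolderOn.mul (f := fun u => φ (γ.toFun (1 - u))) ?_ h
      (Metric.isBounded_Icc _ _)) fun u _ => mul_left_comm _ _ _⟩
    refine hφ.comp (c := fun u => γ.toFun (1 - u)) hL0 (fun x hx y hy => ?_)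
      fun u hu => γ.mem_trace (hmem u hu)
    rw [dist_eq_norm, dist_comm, Real.dist_eq]
    have := hL _ (hmem x hx) _ (hmem y hy)
    rwa [sub_sub_sub_cancel_left] at this

lemma const_mul (hg : IsDensity γ g) (w : ℂ) : IsDensity γ fun z => w * g z :=
  hg.holder_mul (.const w)

lemma id_mul (hg : IsDensity γ g) : IsDensity γ fun z => z * g z :=
  hg.holder_mul (φ := fun z => z) (.of_lipschitz zero_le_one fun x _ y _ => by
    rw [one_mul, dist_eq_norm])

lemma pow_mul (hg : IsDensity γ g) (n : ℕ) : IsDensity γ fun z => z ^ n * g z := by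
  induction n with
  | zero => simpa using hg
  | succ n ih => simpa only [pow_succ', mul_assoc] using ih.id_mul

/-- Each factor `z` passed under the integral leaves a moment behind, and these moments vanish.
Orthogonality thus becomes decay at infinity. -/
lemma pow_mul_cauchyTransform (hg : IsDensity γ g) {n : ℕ}
    (h : ∀ k < n, loopIntegral γ.toFun (fun t => t ^ k * g t) = 0) {z : ℂ} (hz : z ∉ γ.trace) :
    z ^ n * cauchyTransform γ g z = cauchyTransform γ (fun t => t ^ n * g t) z := by
  induction n with
  | zero => simp
  | succ n ih =>
    have h1 := mul_cauchyTransform (hg.pow_mul n) (hg.pow_mul n).id_mul hz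
    rw [h n n.lt_succ_self, sub_zero] at h1
    rw [pow_succ', mul_assoc, ih fun k hk => h k (hk.trans n.lt_succ_self), h1]
    simp only [pow_succ', mul_assoc]

/-- One power further, the first moment not assumed to vanish appears; its negative is the leading
coefficient at infinity. -/
lemma pow_succ_mul_cauchyTransform (hg : IsDensity γ g) {n : ℕ}
    (h : ∀ k < n, loopIntegral γ.toFun (fun t => t ^ k * g t) = 0) {z : ℂ} (hz : z ∉ γ.trace) :
    z ^ (n + 1) * cauchyTransform γ g z = cauchyTransform γ (fun t => t ^ (n + 1) * g t) z -
      loopIntegral γ.toFun fun t => t ^ n * g t := by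
  rw [pow_succ', mul_assoc, hg.pow_mul_cauchyTransform h hz,
    mul_cauchyTransform (hg.pow_mul n) (hg.pow_mul n).id_mul hz]
  simp only [pow_succ', mul_assoc]

end IsDensity

/-! ### Terms of Bessel type are densities -/

/-- A function with a power bound whose derivative may be more singular by the factor `u ^ (-2)` is
Hölder continuous, with half the exponent. -/
lemma isHolderOn_of_deriv_bound {k k' : ℝ → ℂ} {η α C : ℝ} (hη : η ≤ 1)
    (hα : 0 < α) (hα1 : α ≤ 1) (hC : 0 ≤ C) (h0 : k 0 = 0)
    (hk : ∀ u ∈ Ioc 0 η, ‖k u‖ ≤ C * u ^ α)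
    (hd : ∀ u ∈ Ioc 0 η, HasDerivAt k (k' u) u)
    (hk' : ∀ u ∈ Ioc 0 η, ‖k' u‖ ≤ C * u ^ (α - 2)) : IsHolderOn k (Icc 0 η) := by
  have key : ∀ x y, 0 ≤ x → x < y → y ≤ η → ‖k x - k y‖ ≤ 4 * C * (y - x) ^ (α / 2) := by
    intro x y hx hxy hy
    have hy0 : 0 < y := hx.trans_lt hxy
    have hyx : 0 < y - x := sub_pos.2 hxy
    -- The scale `y ^ 2` is where the two bounds balance. For points further apart the size of `k`
    -- suffices, because `y ^ α = (y ^ 2) ^ (α / 2)`.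
    rcases le_or_gt (y ^ 2 / 2) (y - x) with h1 | h1
    · have h2 : ‖k x‖ ≤ C * y ^ α := by
        rcases hx.eq_or_lt with rfl | hx0
        · rw [h0, norm_zero]; positivity
        · refine (hk x ⟨hx0, hxy.le.trans hy⟩).trans ?_
          gcongr
      have h3 := hk y ⟨hy0, hy⟩
      have h4 : y ^ α ≤ 2 * (y - x) ^ (α / 2) := by
        calc y ^ α = (y ^ 2) ^ (α / 2) := by
              rw [← Real.rpow_natCast, ← Real.rpow_mul hy0.le]; congr 1; push_cast; ring
          _ ≤ (2 * (y - x)) ^ (α / 2) := by gcongr; linarith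
          _ = 2 ^ (α / 2) * (y - x) ^ (α / 2) := Real.mul_rpow two_pos.le hyx.le
          _ ≤ 2 ^ (1 : ℝ) * (y - x) ^ (α / 2) := by
              gcongr
              · norm_num
              · linarith
          _ = _ := by rw [Real.rpow_one]
      calc ‖k x - k y‖ ≤ ‖k x‖ + ‖k y‖ := norm_sub_le _ _
        _ ≤ 2 * (C * y ^ α) := by linarith
        _ ≤ 2 * (C * (2 * (y - x) ^ (α / 2))) := by gcongr
        _ = _ := by ring
    -- For close points `x > y / 2`, so the derivative is comparable to `y ^ (α - 2) = (y ^ 2) ^ (α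
    -- / 2 - 1)` throughout, and the mean value inequality applies.
    · have hyy : y ^ 2 ≤ y := by nlinarith
      have hxy2 : y / 2 < x := by linarith
      have hx0 : 0 < x := lt_of_le_of_lt (by positivity) hxy2
      have h2 : ∀ u ∈ Icc x y, ‖k' u‖ ≤ C * (2 * (y - x) ^ (α / 2 - 1)) := by
        intro u hu
        have hu0 : 0 < u := hx0.trans_le hu.1
        refine (hk' u ⟨hu0, hu.2.trans hy⟩).trans ?_
        gcongr
        calc u ^ (α - 2) ≤ (y / 2) ^ (α - 2) :=
              Real.rpow_le_rpow_of_nonpos (by positivity) (by linarith [hu.1]) (by linarith)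
          _ = ((y / 2) ^ 2) ^ (α / 2 - 1) := by
              rw [← Real.rpow_natCast, ← Real.rpow_mul (by positivity)]
              congr 1; push_cast; ring
          _ ≤ ((y - x) / 2) ^ (α / 2 - 1) :=
              Real.rpow_le_rpow_of_nonpos (by positivity) (by nlinarith) (by linarith)
          _ = (2⁻¹) ^ (α / 2 - 1) * (y - x) ^ (α / 2 - 1) := by
              rw [div_eq_inv_mul, Real.mul_rpow (by norm_num) hyx.le]
          _ ≤ (2⁻¹) ^ (-1 : ℝ) * (y - x) ^ (α / 2 - 1) := by
              refine mul_le_mul_of_nonneg_right ?_ (Real.rpow_nonneg hyx.le _)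
              exact Real.rpow_le_rpow_of_exponent_ge (by norm_num) (by norm_num) (by linarith)
          _ = _ := by rw [Real.rpow_neg_one, inv_inv]
      have h3 := (convex_Icc x y).norm_image_sub_le_of_norm_hasDerivWithin_le
        (f := k) (f' := k') (C := C * (2 * (y - x) ^ (α / 2 - 1)))
        (fun u hu => (hd u ⟨hx0.trans_le hu.1, hu.2.trans hy⟩).hasDerivWithinAt) h2
        (right_mem_Icc.2 hxy.le) (left_mem_Icc.2 hxy.le)
      refine h3.trans ?_
      rw [Real.norm_eq_abs, abs_sub_comm, abs_of_pos hyx, Real.rpow_sub_one hyx.ne']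
      have h4 : C * (2 * ((y - x) ^ (α / 2) / (y - x))) * (y - x) =
          2 * C * (y - x) ^ (α / 2) := by field_simp
      rw [h4]
      gcongr
      norm_num
  refine ⟨4 * C, α / 2, by positivity, by positivity, by linarith, fun x hx y hy => ?_⟩
  rw [Real.dist_eq]
  rcases lt_trichotomy x y with h | rfl | h
  · rw [abs_sub_comm, abs_of_pos (sub_pos.2 h)]; exact key x y hx.1 h hy.2
  · rw [sub_self, norm_zero]; positivity
  · rw [norm_sub_rev, abs_of_pos (sub_pos.2 h)]; exact key y x hy.1 h hx.2

/-! ### Branches of the logarithm and Bessel terms along the loop. -/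

section

variable {γ : Loop} {ℓ : ℂ → ℂ}

/-- On the loop, a branch of the logarithm agrees locally with an analytic one. -/
lemma IsLogBranch.eventually_eq (hℓ : IsLogBranch γ ℓ) {z₀ : ℂ} (hz₀ : z₀ ∈ γ.trace \ {0}) :
    ∀ᶠ z in 𝓝[γ.trace \ {0}] z₀, ℓ z = ℓ z₀ + Complex.log (z / z₀) := by
  have h0 : z₀ ≠ 0 := hz₀.2
  have hc1 : ContinuousWithinAt (fun z => Complex.log (z / z₀)) (γ.trace \ {0}) z₀ := by
    refine ContinuousWithinAt.clog (by fun_prop) ?_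
    rw [div_self h0]; exact Complex.one_mem_slitPlane
  have hc : ContinuousWithinAt (fun z => ‖ℓ z - (ℓ z₀ + Complex.log (z / z₀))‖)
      (γ.trace \ {0}) z₀ :=
    ((hℓ.1 z₀ hz₀).sub (continuousWithinAt_const.add hc1)).norm
  -- The difference of the two branches is an integer multiple of `2πi`; continuity makes it smaller
  -- than `2π` in modulus, hence zero.
  have hlt := hc.tendsto.eventually_lt_const (u := 2 * Real.pi) (by
    rw [div_self h0, Complex.log_one, add_zero, sub_self, norm_zero]; exact Real.two_pi_pos)
  filter_upwards [hlt, self_mem_nhdsWithin] with z hz hzt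
  have hz0 : z ≠ 0 := hzt.2
  have he : Complex.exp (ℓ z - (ℓ z₀ + Complex.log (z / z₀))) = 1 := by
    rw [Complex.exp_sub, Complex.exp_add, Complex.exp_log (div_ne_zero hz0 h0), hℓ.2 z hzt,
      hℓ.2 z₀ hz₀, mul_div_cancel₀ _ h0, div_self hz0]
  obtain ⟨n, hn⟩ := Complex.exp_eq_one_iff.1 he
  rw [hn, norm_mul, norm_mul, norm_mul, Complex.norm_I, mul_one, Complex.norm_intCast] at hz
  have h2 : ‖(2 : ℂ)‖ * ‖(Real.pi : ℂ)‖ = 2 * Real.pi := by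
    rw [Complex.norm_real, Real.norm_eq_abs, abs_of_pos Real.pi_pos]; simp
  rw [h2] at hz
  have h3 : |(n : ℝ)| < 1 := by nlinarith [Real.two_pi_pos]
  have h4 : n = 0 := by
    have : |n| < 1 := by exact_mod_cast h3
    exact Int.abs_lt_one_iff.1 this
  rw [h4] at hn
  simp only [Int.cast_zero, zero_mul] at hn
  exact sub_eq_zero.1 hn

/-- Near `z₀ ≠ 0` the term agrees on the loop with an analytic function of `z`, which is locally
Lipschitz. -/
lemma IsLogBranch.locally_holder (hℓ : IsLogBranch γ ℓ) (p Λ : ℂ) (q : ℕ) {z₀ : ℂ}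
    (hz₀ : z₀ ∈ γ.trace \ {0}) : ∃ ε > 0,
      IsHolderOn (fun z => Complex.exp (p * ℓ z) * Complex.exp (-Λ / z) * ℓ z ^ q)
        (γ.trace ∩ Metric.closedBall z₀ ε) := by
  have h0 : z₀ ≠ 0 := hz₀.2
  set L : ℂ → ℂ := fun z => ℓ z₀ + Complex.log (z / z₀) with hL
  have hLc : ContDiffAt ℝ 1 L z₀ := by
    have h1 : ContDiffAt ℂ 1 L z₀ := by
      refine contDiffAt_const.add ((Complex.contDiffAt_log ?_).comp z₀ (by fun_prop))
      rw [div_self h0]; exact Complex.one_mem_slitPlane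
    exact h1.restrict_scalars ℝ
  have hic : ContDiffAt ℝ 1 (fun z : ℂ => -Λ / z) z₀ := by
    have h1 : ContDiffAt ℂ 1 (fun z : ℂ => -Λ / z) z₀ :=
      contDiffAt_const.div contDiffAt_id h0
    exact h1.restrict_scalars ℝ
  have hB : ContDiffAt ℝ 1 (fun z => Complex.exp (p * L z) * Complex.exp (-Λ / z) * L z ^ q) z₀ :=
    ((contDiffAt_const.mul hLc).cexp.mul hic.cexp).mul (hLc.pow q)
  obtain ⟨K, t, ht, hKt⟩ := hB.exists_lipschitzOnWith
  have hev := hℓ.eventually_eq hz₀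
  rw [eventually_nhdsWithin_iff] at hev
  have hne : ∀ᶠ z in 𝓝 z₀, z ≠ 0 := isOpen_ne.mem_nhds h0
  obtain ⟨ε, hε, hball⟩ := Metric.nhds_basis_closedBall.mem_iff.1 ((hev.and ht).and hne)
  refine ⟨ε, hε, IsHolderOn.congr (f := fun z =>
    Complex.exp (p * L z) * Complex.exp (-Λ / z) * L z ^ q)
    (.of_lipschitz K.2 fun x hx y hy => ?_) fun z hz => ?_⟩
  · rw [← dist_eq_norm]
    exact hKt.dist_le_mul _ (hball hx.2).1.2 _ (hball hy.2).1.2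
  · simp only [hL]
    rw [(hball hz.2).1.1 ⟨hz.1, (hball hz.2).2⟩]

variable {c : ℝ → ℂ} {η M m : ℝ} {τ : ℂ}

lemma IsLogBranch.hasDerivAt_comp (hℓ : IsLogBranch γ ℓ) (h : IsArc c η M m τ)
    (hc : ∀ u ∈ Ioo 0 η, c u ∈ γ.trace \ {0}) {u : ℝ} (hu : u ∈ Ioo 0 η) :
    HasDerivAt (fun u => ℓ (c u)) (deriv c u / c u) u := by
  have h0 : c u ≠ 0 := (hc u hu).2
  have hd := (h.differentiableAt u hu).hasDerivAt
  have h1 : HasDerivAt (fun x => ℓ (c u) + Complex.log (c x / c u)) (deriv c u / c u) u := by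
    have h2 := ((hd.div_const (c u)).clog_real (by
      rw [div_self h0]; exact Complex.one_mem_slitPlane)).const_add (ℓ (c u))
    rwa [div_self h0, div_one] at h2
  refine h1.congr_of_eventuallyEq ?_
  have ht : Tendsto c (𝓝 u) (𝓝[γ.trace \ {0}] (c u)) :=
    tendsto_nhdsWithin_iff.2 ⟨hd.continuousAt, by
      filter_upwards [Ioo_mem_nhds hu.1 hu.2] with x hx using hc x hx⟩
  exact ht.eventually (hℓ.eventually_eq (hc u hu))

/-- Integrating the derivative `c' / c`, of modulus at most `M / (m u)`, from `u` to `η / 2` shows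
that the branch grows at most logarithmically, hence slower than any negative power of `u`. -/
lemma IsLogBranch.exists_norm_le (hℓ : IsLogBranch γ ℓ) (h : IsArc c η M m τ) (hη : η ≤ 1)
    (h0 : c 0 = 0) (hc : ∀ u ∈ Ioo 0 η, c u ∈ γ.trace \ {0}) {κ : ℝ} (hκ : 0 < κ) :
    ∃ B, 1 ≤ B ∧ ∀ u ∈ Ioc 0 (η / 2), ‖ℓ (c u)‖ ≤ B * u ^ (-κ) := by
  have hm := h.slope_pos
  have hM := h.bound_nonneg
  have hη0 := h.length_pos
  set v := η / 2 with hv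
  have hv0 : 0 < v := half_pos hη0
  have hvη : v < η := half_lt_self hη0
  refine ⟨1 + ‖ℓ (c v)‖ + M / m / κ, by
    have : 0 ≤ M / m / κ := by positivity
    linarith [norm_nonneg (ℓ (c v))], fun u hu => ?_⟩
  have hmem : ∀ x ∈ Icc u v, x ∈ Ioo 0 η := fun x hx => ⟨hu.1.trans_le hx.1, hx.2.trans_lt hvη⟩
  have hne : ∀ x ∈ Icc u v, c x ≠ 0 := fun x hx => (hc x (hmem x hx)).2
  have hFTC : ∫ x in u..v, deriv c x / c x = ℓ (c v) - ℓ (c u) := by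
    refine intervalIntegral.integral_eq_sub_of_hasDerivAt (f := fun x => ℓ (c x)) ?_ ?_
    · intro x hx
      rw [uIcc_of_le hu.2] at hx
      exact hℓ.hasDerivAt_comp h hc (hmem x hx)
    · refine ContinuousOn.intervalIntegrable ?_
      rw [uIcc_of_le hu.2]
      exact (h.continuousOn_deriv.mono hmem).div
        (h.continuousOn.mono fun x hx => Ioo_subset_Icc_self (hmem x hx)) hne
  have hb : ‖∫ x in u..v, deriv c x / c x‖ ≤ ∫ x in u..v, M / m * x⁻¹ := by
    refine intervalIntegral.norm_integral_le_of_norm_le hu.2 (.of_forall fun x hx => ?_) ?_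
    · have hx' := Ioc_subset_Icc_self hx
      have hx0 : 0 < x := hu.1.trans hx.1
      have h1 := h.mul_le_norm h0 (Ioo_subset_Icc_self (hmem x hx'))
      rw [norm_div, ← div_eq_mul_inv, div_div]
      have := mul_pos hm hx0
      gcongr
      exact h.norm_deriv_le x (hmem x hx')
    · refine ContinuousOn.intervalIntegrable ?_
      rw [uIcc_of_le hu.2]
      exact continuousOn_const.mul (continuousOn_id.inv₀ fun x hx => (hmem x hx).1.ne')
  rw [intervalIntegral.integral_const_mul, integral_inv_of_pos hu.1 hv0, hFTC,
    Real.log_div hv0.ne' hu.1.ne'] at hb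
  have hlogv : Real.log v ≤ 0 := Real.log_nonpos hv0.le (by linarith)
  have hlogu : -Real.log u ≤ u ^ (-κ) / κ := by
    rw [← Real.log_inv, Real.rpow_neg hu.1.le, ← Real.inv_rpow hu.1.le]
    exact Real.log_le_rpow_div (inv_nonneg.2 hu.1.le) hκ
  have hone : 1 ≤ u ^ (-κ) :=
    Real.one_le_rpow_of_pos_of_le_one_of_nonpos hu.1 (by linarith [hu.2]) (by linarith)
  have h3 := norm_sub_norm_le (ℓ (c u)) (ℓ (c v))
  rw [norm_sub_rev] at h3
  have h4 : M / m * (Real.log v - Real.log u) ≤ M / m * (u ^ (-κ) / κ) := by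
    gcongr; linarith
  have h5 : M / m * (u ^ (-κ) / κ) = M / m / κ * u ^ (-κ) := by ring
  have h6 : ‖ℓ (c v)‖ ≤ ‖ℓ (c v)‖ * u ^ (-κ) := le_mul_of_one_le_right (norm_nonneg _) hone
  calc ‖ℓ (c u)‖ ≤ ‖ℓ (c v)‖ * u ^ (-κ) + M / m / κ * u ^ (-κ) := by linarith
    _ ≤ (1 + ‖ℓ (c v)‖ + M / m / κ) * u ^ (-κ) := by nlinarith

/-- A Bessel term is Hölder continuous in the parameter after multiplication by `z`. -/
lemma IsLogBranch.arc_holder (hℓ : IsLogBranch γ ℓ) (h : IsArc c η M m τ) (hη : η ≤ 1)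
    (h0 : c 0 = 0) (hc : ∀ u ∈ Ioo 0 η, c u ∈ γ.trace \ {0}) (p Λ : ℂ) (q : ℕ) {δ : ℝ}
    (hδ : 0 < δ) (hO : (fun z => Complex.exp (p * ℓ z) * Complex.exp (-Λ / z))
      =O[𝓝[γ.trace \ {0}] 0] fun z => ‖z‖ ^ (δ - 1)) :
    ∃ η' > 0, η' ≤ 1 ∧ IsHolderOn (fun u => c u *
      (Complex.exp (p * ℓ (c u)) * Complex.exp (-Λ / c u) * ℓ (c u) ^ q)) (Icc 0 η') := by
  have hm := h.slope_pos
  have hM := h.bound_nonneg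
  have hη0 := h.length_pos
  -- Capping the exponent at `1` keeps `δ' - 1` nonpositive, so that lower bounds for `‖c u‖` may be
  -- used.
  set δ' := min δ 1 with hδ'
  have hδ'0 : 0 < δ' := lt_min hδ one_pos
  have hδ'1 : δ' ≤ 1 := min_le_right _ _
  -- With this growth rate `q` logarithms cost at most `u ^ (-δ' / 2)`, half of the available
  -- exponent; the `+ 1` covers `q = 0`.
  set κ := δ' / (2 * (q + 1)) with hκ
  have hκ0 : 0 < κ := by positivity
  have hκq : κ * q ≤ δ' / 2 := by
    rw [hκ, div_mul_eq_mul_div, div_le_div_iff₀ (by positivity) two_pos]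
    nlinarith
  obtain ⟨B, hB1, hB⟩ := hℓ.exists_norm_le h hη h0 hc hκ0
  have hB0 : 0 < B := one_pos.trans_le hB1
  obtain ⟨A, hA0, hA⟩ := hO.exists_pos
  rw [isBigOWith_iff, eventually_nhdsWithin_iff] at hA
  obtain ⟨ρ, hρ, hball⟩ := Metric.eventually_nhds_iff.1 hA
  have hcnorm : ∀ u ∈ Icc 0 η, ‖c u‖ ≤ M * u := by
    intro u hu
    have := h.norm_sub_le le_rfl hu.1 hu.2
    rwa [h0, sub_zero, sub_zero] at this
  obtain ⟨v, hv0, hvη, hvρ⟩ : ∃ v, 0 < v ∧ v ≤ η / 2 ∧ M * v < min ρ 1 := by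
    have h1 : Tendsto (fun u : ℝ => M * u) (𝓝[>] 0) (𝓝 0) := by
      have : Tendsto (fun u : ℝ => M * u) (𝓝 0) (𝓝 (M * 0)) :=
        (continuous_const.mul continuous_id).tendsto 0
      rw [mul_zero] at this
      exact this.mono_left nhdsWithin_le_nhds
    obtain ⟨v, h2, h3⟩ := ((h1.eventually_lt_const (lt_min hρ one_pos)).and
      (Ioo_mem_nhdsGT (half_pos hη0))).exists
    exact ⟨v, h3.1, h3.2.le, h2⟩
  have hv1 : v ≤ 1 := by linarith
  have hmem : ∀ u ∈ Ioc 0 v, u ∈ Ioo 0 η := fun u hu => ⟨hu.1, by linarith [hu.2]⟩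
  set E : ℝ → ℂ := fun u => Complex.exp (p * ℓ (c u)) * Complex.exp (-Λ / c u) with hE
  set D : ℝ := A * m ^ (δ' - 1) * B ^ q with hD
  have hD0 : 0 ≤ D := by positivity
  have hEb : ∀ u ∈ Ioc 0 v, ‖E u‖ * (B * u ^ (-κ)) ^ q ≤ D * u ^ (δ' / 2 - 1) := by
    intro u hu
    have hu0 := hu.1
    have huη := Ioo_subset_Icc_self (hmem u hu)
    have hcu := hcnorm u huη
    have hcu' : ‖c u‖ < min ρ 1 :=
      (hcu.trans (mul_le_mul_of_nonneg_left hu.2 hM)).trans_lt hvρ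
    have hcu0 : 0 < ‖c u‖ := norm_pos_iff.2 (hc u (hmem u hu)).2
    have h1 : ‖E u‖ ≤ A * ‖c u‖ ^ (δ - 1) := by
      have := hball (y := c u) (by
        rw [dist_zero_right]; exact hcu'.trans_le (min_le_left _ _)) (hc u (hmem u hu))
      rwa [Real.norm_eq_abs, abs_of_nonneg (Real.rpow_nonneg (norm_nonneg _) _)] at this
    have h2 : ‖c u‖ ^ (δ - 1) ≤ m ^ (δ' - 1) * u ^ (δ' - 1) := by
      calc ‖c u‖ ^ (δ - 1) ≤ ‖c u‖ ^ (δ' - 1) :=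
            Real.rpow_le_rpow_of_exponent_ge hcu0 (hcu'.le.trans (min_le_right _ _))
              (by linarith [min_le_left δ 1])
        _ ≤ (m * u) ^ (δ' - 1) :=
            Real.rpow_le_rpow_of_nonpos (mul_pos hm hu0) (h.mul_le_norm h0 huη) (by linarith)
        _ = _ := Real.mul_rpow hm.le hu0.le
    have h3 : (B * u ^ (-κ)) ^ q = B ^ q * u ^ (-(κ * q)) := by
      rw [mul_pow, ← Real.rpow_natCast (u ^ (-κ)), ← Real.rpow_mul hu0.le, neg_mul]
    calc ‖E u‖ * (B * u ^ (-κ)) ^ q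
        ≤ (A * (m ^ (δ' - 1) * u ^ (δ' - 1))) * (B ^ q * u ^ (-(κ * q))) := by
          rw [h3]
          have := Real.rpow_nonneg hu0.le (-(κ * q))
          gcongr
          exact h1.trans (by gcongr)
      _ = D * (u ^ (δ' - 1) * u ^ (-(κ * q))) := by rw [hD]; ring
      _ ≤ D * u ^ (δ' / 2 - 1) := by
          refine mul_le_mul_of_nonneg_left ?_ hD0
          rw [← Real.rpow_add hu0]
          exact Real.rpow_le_rpow_of_exponent_ge hu0 (hu.2.trans hv1) (by linarith)
  have hℓb : ∀ u ∈ Ioc 0 v, ‖ℓ (c u)‖ ≤ B * u ^ (-κ) := fun u hu =>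
    hB u ⟨hu.1, hu.2.trans hvη⟩
  have hb1 : ∀ u ∈ Ioc 0 v, 1 ≤ B * u ^ (-κ) := fun u hu =>
    one_le_mul_of_one_le_of_one_le hB1
      (Real.one_le_rpow_of_pos_of_le_one_of_nonpos hu.1 (hu.2.trans hv1) (by linarith))
  -- The summands bound the four terms of the derivative, from differentiating `c`, the power, the
  -- exponential and the logarithms. Only the exponential costs a further `u⁻¹`.
  set C : ℝ := D * M * (1 + ‖p‖ + ‖Λ‖ / m + q) with hC
  have hq0 : (0 : ℝ) ≤ q := Nat.cast_nonneg q
  have hC0 : 0 ≤ C := by positivity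
  refine ⟨v, hv0, hv1, isHolderOn_of_deriv_bound (α := δ' / 2) (C := C)
    (k' := fun u => deriv c u * (E u * ℓ (c u) ^ q) + c u *
      ((p * (deriv c u / c u) + Λ * deriv c u / c u ^ 2) * E u * ℓ (c u) ^ q +
        E u * (q * ℓ (c u) ^ (q - 1) * (deriv c u / c u)))) hv1
    (by positivity) (by linarith) hC0 (by simp [h0]) ?_ ?_ ?_⟩
  · intro u hu
    have hu0 := hu.1
    have h1 := hEb u hu
    have h2 : ‖E u‖ * ‖ℓ (c u)‖ ^ q ≤ D * u ^ (δ' / 2 - 1) := by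
      refine le_trans ?_ h1
      gcongr
      exact hℓb u hu
    have h3 := hcnorm u (Ioo_subset_Icc_self (hmem u hu))
    change ‖c u * (E u * ℓ (c u) ^ q)‖ ≤ _
    rw [norm_mul, norm_mul, norm_pow]
    calc ‖c u‖ * (‖E u‖ * ‖ℓ (c u)‖ ^ q) ≤ (M * u) * (D * u ^ (δ' / 2 - 1)) := by gcongr
      _ = D * M * 1 * u ^ (δ' / 2) := by
          rw [Real.rpow_sub_one hu0.ne']; field_simp
      _ ≤ C * u ^ (δ' / 2) := by
          rw [hC]
          gcongr
          have : 0 ≤ ‖Λ‖ / m := by positivity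
          linarith [norm_nonneg p]
  · intro u hu
    have hcu : c u ≠ 0 := (hc u (hmem u hu)).2
    have hd := (h.differentiableAt u (hmem u hu)).hasDerivAt
    have hl := hℓ.hasDerivAt_comp h hc (hmem u hu)
    have h1 := (hl.const_mul p).cexp
    have h2 : HasDerivAt (fun u => -Λ / c u) (Λ * deriv c u / c u ^ 2) u := by
      have := (hasDerivAt_const u (-Λ)).div hd hcu
      refine this.congr_deriv ?_
      rw [zero_mul, zero_sub, neg_mul, neg_neg]
    have h3 := hd.mul ((h1.mul h2.cexp).mul (hl.pow q))
    refine h3.congr_deriv ?_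
    simp only [hE, Pi.mul_apply, Pi.pow_apply]
    ring
  · intro u hu
    have hu0 := hu.1
    have hcu : c u ≠ 0 := (hc u (hmem u hu)).2
    have hcu0 : 0 < ‖c u‖ := norm_pos_iff.2 hcu
    have hd := h.norm_deriv_le u (hmem u hu)
    have hmu := h.mul_le_norm h0 (Ioo_subset_Icc_self (hmem u hu))
    have h1 := hEb u hu
    set P := ‖E u‖ * (B * u ^ (-κ)) ^ q with hP
    have hb1u := hb1 u hu
    have hP0 : 0 ≤ P := by positivity
    have h2 : ‖E u‖ * ‖ℓ (c u)‖ ^ q ≤ P := by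
      rw [hP]
      gcongr
      exact hℓb u hu
    -- The exponent is truncated, harmlessly: the bound `B * u ^ (-κ)` is at least `1`, and for `q =
    -- 0` the term carries the coefficient `0`.
    have h3 : ‖E u‖ * ‖ℓ (c u)‖ ^ (q - 1) ≤ P := by
      rw [hP]
      gcongr
      calc ‖ℓ (c u)‖ ^ (q - 1) ≤ (B * u ^ (-κ)) ^ (q - 1) := by gcongr; exact hℓb u hu
        _ ≤ (B * u ^ (-κ)) ^ q := pow_le_pow_right₀ hb1u (Nat.sub_le _ _)
    have e1 : deriv c u * (E u * ℓ (c u) ^ q) + c u *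
      ((p * (deriv c u / c u) + Λ * deriv c u / c u ^ 2) * E u * ℓ (c u) ^ q +
        E u * (q * ℓ (c u) ^ (q - 1) * (deriv c u / c u))) =
        deriv c u * ((1 + p + Λ / c u) * (E u * ℓ (c u) ^ q) +
          q * (E u * ℓ (c u) ^ (q - 1))) := by field_simp; ring
    change ‖deriv c u * (E u * ℓ (c u) ^ q) + c u *
      ((p * (deriv c u / c u) + Λ * deriv c u / c u ^ 2) * E u * ℓ (c u) ^ q +
        E u * (q * ℓ (c u) ^ (q - 1) * (deriv c u / c u)))‖ ≤ _
    rw [e1, norm_mul]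
    have hcoef : ‖1 + p + Λ / c u‖ ≤ 1 + ‖p‖ + ‖Λ‖ / (m * u) := by
      have a1 := norm_add_le (1 + p) (Λ / c u)
      have a2 := norm_add_le 1 p
      rw [norm_one] at a2
      have a3 : ‖Λ / c u‖ ≤ ‖Λ‖ / (m * u) := by
        rw [norm_div]
        have := mul_pos hm hu0
        gcongr
      linarith
    have hsum : ‖(1 + p + Λ / c u) * (E u * ℓ (c u) ^ q) + q * (E u * ℓ (c u) ^ (q - 1))‖ ≤
        (1 + ‖p‖ + ‖Λ‖ / (m * u)) * P + q * P := by
      refine (norm_add_le _ _).trans ?_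
      rw [norm_mul, norm_mul (q : ℂ), norm_mul (E u), norm_mul (E u), norm_pow, norm_pow,
        Complex.norm_natCast]
      gcongr
    have hinv : 1 ≤ u⁻¹ := (one_le_inv₀ hu0).2 (hu.2.trans hv1)
    calc ‖deriv c u‖ * ‖(1 + p + Λ / c u) * (E u * ℓ (c u) ^ q) +
          q * (E u * ℓ (c u) ^ (q - 1))‖
        ≤ M * ((1 + ‖p‖ + ‖Λ‖ / (m * u)) * P + q * P) := by gcongr
      _ = M * P * ((1 + ‖p‖ + q) * 1 + ‖Λ‖ / m * u⁻¹) := by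
          rw [div_mul_eq_div_div, div_eq_mul_inv (‖Λ‖ / m) u]; ring
      _ ≤ M * (D * u ^ (δ' / 2 - 1)) * ((1 + ‖p‖ + q) * u⁻¹ + ‖Λ‖ / m * u⁻¹) := by
          have := Real.rpow_nonneg hu0.le (δ' / 2 - 1)
          gcongr
      _ = C * u ^ (δ' / 2 - 2) := by
          have : δ' / 2 - 2 = (δ' / 2 - 1) - 1 := by ring
          rw [this, Real.rpow_sub_one hu0.ne' (δ' / 2 - 1), hC]
          ring

theorem IsLogBranch.isDensity (hℓ : IsLogBranch γ ℓ) (p Λ : ℂ) (q : ℕ) {δ : ℝ}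
    (hδ : 0 < δ) (hO : (fun z => Complex.exp (p * ℓ z) * Complex.exp (-Λ / z))
      =O[𝓝[γ.trace \ {0}] 0] fun z => ‖z‖ ^ (δ - 1)) :
    IsDensity γ fun z => Complex.exp (p * ℓ z) * Complex.exp (-Λ / z) * ℓ z ^ q := by
  refine ⟨fun z hz => hℓ.locally_holder p Λ q hz, ?_, ?_⟩
  · obtain ⟨η, M, m, τ, hη, harc⟩ := γ.exists_isArc_start
    refine hℓ.arc_holder harc hη γ.map_zero (fun u hu => ?_) p Λ q hδ hO
    have hu' : u ∈ Ioo (0 : ℝ) 1 := ⟨hu.1, hu.2.trans_le hη⟩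
    exact ⟨γ.mem_trace (Ioo_subset_Icc_self hu'), γ.ne_zero hu'⟩
  · obtain ⟨η, M, m, τ, hη, harc⟩ := γ.exists_isArc_finish
    refine hℓ.arc_holder harc hη (by simp [γ.map_one]) (fun u hu => ?_) p Λ q hδ hO
    have hu' : 1 - u ∈ Ioo (0 : ℝ) 1 := ⟨by linarith [hu.2], by linarith [hu.1]⟩
    exact ⟨γ.mem_trace (Ioo_subset_Icc_self hu'), γ.ne_zero hu'⟩

/-- The factor `φ` is only Hölder continuous and cannot be differentiated, so it is multiplied in
after the explicit factors have been shown to form a density. -/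
theorem IsBesselType.isDensity {N : ℕ} {W : ℂ → Matrix (Fin N) (Fin N) ℂ}
    (hW : IsBesselType γ W) (i j : Fin N) : IsDensity γ fun z => W z i j := by
  obtain ⟨ℓ, hℓ, h⟩ := hW
  obtain ⟨n, φ, p, q, Λ, hterm, hsum⟩ := h i j
  refine IsDensity.congr (g := fun z => ∑ m, φ m z *
    (Complex.exp (p m * ℓ z) * Complex.exp (-Λ m / z) * ℓ z ^ q m))
    (IsDensity.sum fun m _ => ?_) fun z hz => ?_
  · obtain ⟨-, ⟨K, r, hr, hr1, hφ⟩, -, -, δ, hδ, hO⟩ := hterm m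
    exact (hℓ.isDensity (p m) (Λ m) (q m) hδ hO).holder_mul (isHolderOn_of_holderOnWith hr hr1 hφ)
  · rw [hsum z hz]
    exact Finset.sum_congr rfl fun m _ => by ring

end

/-! ### Functions without jump -/

/-- A function that is holomorphic off the loop, without jump, `o(1/z)` at the origin, and
convergent at infinity, is constant. -/
theorem Loop.eq_of_no_jump (γ : Loop) {f : ℂ → ℂ} {w : ℂ} (hf : DifferentiableOn ℂ f γ.traceᶜ)
    (hlim : ∀ z ∈ γ.trace \ {0}, ∃ y, Tendsto f (𝓝[γ.traceᶜ] z) (𝓝 y))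
    (h0 : Tendsto (fun z => z * f z) (𝓝[γ.traceᶜ] 0) (𝓝 0))
    (hinf : Tendsto f (Bornology.cobounded ℂ) (𝓝 w)) {z : ℂ} (hz : z ∉ γ.trace) : f z = w := by
  have hdense := γ.dense_compl_trace
  have hnebot : ∀ x, NeBot (𝓝[γ.traceᶜ] x) := fun x =>
    mem_closure_iff_nhdsWithin_neBot.1 (hdense x)
  have hcont : ∀ x ∉ γ.trace, Tendsto f (𝓝[γ.traceᶜ] x) (𝓝 (f x)) := fun x hx =>
    (hf.continuousOn x hx).tendsto
  -- Equal boundary limits from both sides give a continuous extension across the loop off the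
  -- origin, to which Painlevé's theorem applies.
  set F : ℂ → ℂ := extendFrom γ.traceᶜ f with hF
  have hFeq : ∀ x ∉ γ.trace, F x = f x := fun x hx => extendFrom_eq (hdense x) (hcont x hx)
  have hFc : ContinuousOn F {0}ᶜ := by
    refine continuousOn_extendFrom (fun x _ => hdense x) fun x hx => ?_
    by_cases hxt : x ∈ γ.trace
    · exact hlim x ⟨hxt, hx⟩
    · exact ⟨_, hcont x hxt⟩
  obtain ⟨M, hM0, hM⟩ := γ.exists_lipschitz
  have hFd : DifferentiableOn ℂ F {0}ᶜ := by
    refine differentiableOn_of_lipschitz_curve hM hM0 isOpen_compl_singleton hFc fun x _ hx => ?_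
    have h1 : DifferentiableAt ℂ f x := hf.differentiableAt (γ.isOpen_compl_trace.mem_nhds hx)
    refine h1.congr_of_eventuallyEq ?_
    filter_upwards [γ.isOpen_compl_trace.mem_nhds hx] with y hy using hFeq y hy
  -- The estimate at the origin passes to points of the loop by density of the complement; halving
  -- `ε` restores the strict inequality.
  have hF0 : Tendsto (fun x => x * F x) (𝓝[≠] 0) (𝓝 0) := by
    rw [Metric.tendsto_nhdsWithin_nhds]
    intro ε hε
    obtain ⟨ρ, hρ, hb⟩ := Metric.tendsto_nhdsWithin_nhds.1 h0 (ε / 2) (half_pos hε)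
    refine ⟨ρ, hρ, fun {x} hx hxρ => ?_⟩
    have hc : ContinuousAt F x := hFc.continuousAt (isOpen_compl_singleton.mem_nhds hx)
    have ht : Tendsto (fun y => ‖y * F y‖) (𝓝[γ.traceᶜ] x) (𝓝 ‖x * F x‖) :=
      ((continuousAt_id.mul hc).norm.tendsto).mono_left nhdsWithin_le_nhds
    have : NeBot (𝓝[γ.traceᶜ] x) := hnebot x
    have hle : ‖x * F x‖ ≤ ε / 2 := by
      refine le_of_tendsto ht ?_
      filter_upwards [self_mem_nhdsWithin,
        nhdsWithin_le_nhds (Metric.isOpen_ball.mem_nhds (Metric.mem_ball.2 hxρ))] with y hy hyρ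
      rw [hFeq y hy, ← dist_zero_right]
      exact (hb hy (Metric.mem_ball.1 hyρ)).le
    rw [dist_zero_right]
    linarith
  have hlo : (fun x => F x - F 0) =o[𝓝[≠] 0] fun x => (x - 0)⁻¹ := by
    simp only [sub_zero]
    rw [isLittleO_iff_tendsto' (by
      filter_upwards [self_mem_nhdsWithin] with x hx h'
      exact absurd (inv_eq_zero.1 h') hx)]
    have h1 : Tendsto (fun x : ℂ => x * F 0) (𝓝[≠] 0) (𝓝 0) := by
      have : Tendsto (fun x : ℂ => x * F 0) (𝓝 0) (𝓝 (0 * F 0)) :=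
        (continuous_id.mul continuous_const).tendsto 0
      rw [zero_mul] at this
      exact this.mono_left nhdsWithin_le_nhds
    have h2 := hF0.sub h1
    rw [sub_zero] at h2
    refine h2.congr fun x => ?_
    rw [div_inv_eq_mul]; ring
  -- Riemann's theorem in its `o(1/z)` form makes the function entire, and Liouville's theorem
  -- concludes.
  have hG := Complex.differentiableOn_update_limUnder_insert_of_isLittleO
    (s := {0}ᶜ) self_mem_nhdsWithin hFd hlo
  have huniv : insert (0 : ℂ) {0}ᶜ = univ := by
    ext x; by_cases hx : x = 0 <;> simp [hx]
  rw [huniv, differentiableOn_univ] at hG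
  set G := Function.update F 0 (limUnder (𝓝[≠] 0) F) with hGdef
  have hGeq : ∀ x ∉ γ.trace, G x = f x := by
    intro x hx
    have hx0 : x ≠ 0 := by rintro rfl; exact hx γ.zero_mem_trace
    rw [hGdef, Function.update_of_ne hx0, hFeq x hx]
  have hGinf : Tendsto G (cocompact ℂ) (𝓝 w) := by
    rw [← Metric.cobounded_eq_cocompact]
    refine hinf.congr' ?_
    filter_upwards [γ.isBounded_trace] with x hx using (hGeq x hx).symm
  rw [← hGeq z hz]
  exact hG.apply_eq_of_tendsto_cocompact z hGinf

/-! ### Uniqueness of the solutions of the Riemann–Hilbert problems -/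

section

variable {N : ℕ} {γ : Loop} {W : ℂ → Matrix (Fin N) (Fin N) ℂ} {n : ℕ}
  {Y Z : ℂ → Matrix (Fin N ⊕ Fin N) (Fin N ⊕ Fin N) ℂ}

/-- The symplectic unit `[[0, 1], [-1, 0]]`. -/
def symplecticUnit (N : ℕ) : Matrix (Fin N ⊕ Fin N) (Fin N ⊕ Fin N) ℂ :=
  Matrix.fromBlocks 0 1 (-1) 0

/-- The unit always pairs a first column with a second row or a second column with a first row. At
the origin every product is therefore a bounded factor times an `o(1/z)` factor. -/
lemma mul_symplecticUnit_mul_apply (A B : Matrix (Fin N ⊕ Fin N) (Fin N ⊕ Fin N) ℂ)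
    (a b : Fin N ⊕ Fin N) : (A * symplecticUnit N * B) a b =
      ∑ j, (A a (Sum.inl j) * B (Sum.inr j) b - A a (Sum.inr j) * B (Sum.inl j) b) := by
  have h1 : ∀ j, (A * symplecticUnit N) a (Sum.inl j) = -A a (Sum.inr j) := by
    intro j
    simp [symplecticUnit, Matrix.mul_apply, Fintype.sum_sum_type, Matrix.one_apply]
  have h2 : ∀ j, (A * symplecticUnit N) a (Sum.inr j) = A a (Sum.inl j) := by
    intro j
    simp [symplecticUnit, Matrix.mul_apply, Fintype.sum_sum_type, Matrix.one_apply]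
  rw [Matrix.mul_apply, Fintype.sum_sum_type, ← Finset.sum_add_distrib]
  refine Finset.sum_congr rfl fun j _ => ?_
  rw [h1, h2]; ring

/-- The left and right jump matrices cancel through the unit, so the paired product has no jump. -/
lemma jump_mul_symplecticUnit_mul_jump (V : Matrix (Fin N) (Fin N) ℂ) :
    Matrix.fromBlocks 1 V 0 1 * symplecticUnit N * Matrix.fromBlocks 1 0 V 1 =
      symplecticUnit N := by
  simp [symplecticUnit, Matrix.fromBlocks_multiply]

lemma diagPower_mul_symplecticUnit_mul_diagPower (n : ℕ) {z : ℂ} (hz : z ≠ 0) :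
    diagPower N n z * symplecticUnit N * diagPower N n z = symplecticUnit N := by
  have h : z ^ n ≠ 0 := pow_ne_zero n hz
  simp [symplecticUnit, diagPower, Matrix.fromBlocks_multiply, smul_smul, h]

lemma tendsto_matrix_of_isBigO_inv {ι κ : Type*} {E : ℂ → Matrix ι κ ℂ}
    (h : ∀ a b, (fun z => E z a b) =O[Bornology.cobounded ℂ] fun z => z⁻¹) :
    Tendsto E (Bornology.cobounded ℂ) (𝓝 0) := by
  refine tendsto_pi_nhds.2 fun a => tendsto_pi_nhds.2 fun b => ?_
  exact (h a b).trans_tendsto tendsto_inv₀_cobounded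

/-- Each entry of the product satisfies the hypotheses of `Loop.eq_of_no_jump`: equal limits from
both sides, `o(1/z)` at the origin, and a limit at infinity because the powers of `z` also cancel
through the unit. -/
theorem SolvesLeftRHP.mul_symplecticUnit_mul (hY : SolvesLeftRHP γ W n Y)
    (hZ : SolvesRightRHP γ W n Z) {z : ℂ} (hz : z ∉ γ.trace) :
    Y z * symplecticUnit N * Z z = symplecticUnit N := by
  ext a b
  refine γ.eq_of_no_jump (f := fun z => (Y z * symplecticUnit N * Z z) a b) ?_ ?_ ?_ ?_ hz
  · simp only [mul_symplecticUnit_mul_apply]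
    exact DifferentiableOn.fun_sum fun j _ =>
      ((hY.holomorphic _ _).mul (hZ.holomorphic _ _)).sub
        ((hY.holomorphic _ _).mul (hZ.holomorphic _ _))
  · intro x hx
    obtain ⟨Yp, Ym, hYp, hYm, hYj⟩ := hY.jump x hx
    obtain ⟨Zp, Zm, hZp, hZm, hZj⟩ := hZ.jump x hx
    have h1 := (hYp.mul_const (symplecticUnit N)).mul hZp
    have h2 := (hYm.mul_const (symplecticUnit N)).mul hZm
    have h3 : Yp * symplecticUnit N * Zp = Ym * symplecticUnit N * Zm := by
      rw [hYj, hZj]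
      calc Ym * Matrix.fromBlocks 1 (W x) 0 1 * symplecticUnit N *
            (Matrix.fromBlocks 1 0 (W x) 1 * Zm)
          = Ym * (Matrix.fromBlocks 1 (W x) 0 1 * symplecticUnit N *
            Matrix.fromBlocks 1 0 (W x) 1) * Zm := by simp only [Matrix.mul_assoc]
        _ = _ := by rw [jump_mul_symplecticUnit_mul_jump]
    rw [h3] at h1
    refine ⟨(Ym * symplecticUnit N * Zm) a b, ?_⟩
    rw [γ.compl_trace_eq, nhdsWithin_union]
    exact tendsto_pi_nhds.1 (tendsto_pi_nhds.1 (h1.sup h2) a) b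
  · have h1 : ∀ z, z * (Y z * symplecticUnit N * Z z) a b =
        ∑ j, (Y z a (Sum.inl j) * (z * Z z (Sum.inr j) b) -
          (z * Y z a (Sum.inr j)) * Z z (Sum.inl j) b) := by
      intro z
      rw [mul_symplecticUnit_mul_apply, Finset.mul_sum]
      exact Finset.sum_congr rfl fun j _ => by ring
    simp only [h1]
    rw [← Finset.sum_const_zero (s := (Finset.univ : Finset (Fin N))) (M := ℂ)]
    refine tendsto_finsetSum _ fun j _ => ?_
    have t1 := (hY.origin_first_column a j).mul_isLittleO
      ((isLittleO_one_iff ℂ).2 (hZ.origin_second_row j b))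
    have t2 := ((isLittleO_one_iff ℂ).2 (hY.origin_second_column a j)).mul_isBigO
      (hZ.origin_first_row j b)
    simp only [mul_one] at t1 t2
    simpa using ((isLittleO_one_iff ℂ).1 t1).sub ((isLittleO_one_iff ℂ).1 t2)
  · obtain ⟨E, hE, hYE⟩ := hY.infinity
    obtain ⟨E', hE', hZE⟩ := hZ.infinity
    have h1 := (((tendsto_matrix_of_isBigO_inv hE).const_add 1).mul_const
      (symplecticUnit N)).mul ((tendsto_matrix_of_isBigO_inv hE').const_add 1)
    simp only [add_zero, one_mul, mul_one] at h1
    have h2 : Tendsto (fun z => Y z * symplecticUnit N * Z z) (Bornology.cobounded ℂ)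
        (𝓝 (symplecticUnit N)) := by
      refine h1.congr' ?_
      filter_upwards [hYE, hZE, Bornology.eventually_ne_cobounded (0 : ℂ)] with z hz hz' hz0
      rw [hz, hz']
      calc (1 + E z) * symplecticUnit N * (1 + E' z)
          = (1 + E z) * (diagPower N n z * symplecticUnit N * diagPower N n z) * (1 + E' z) := by
            rw [diagPower_mul_symplecticUnit_mul_diagPower n hz0]
        _ = _ := by simp only [Matrix.mul_assoc]
    exact tendsto_pi_nhds.1 (tendsto_pi_nhds.1 h2 a) b

lemma symplecticUnit_mul_self : symplecticUnit N * symplecticUnit N = -1 := by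
  rw [symplecticUnit, Matrix.fromBlocks_multiply, ← Matrix.fromBlocks_one, Matrix.fromBlocks_neg]
  simp

/-- Since the unit squares to `-1`, the identity `Y' J Z = J` exhibits an inverse of `Z`, which can
then be cancelled from `Y J Z = Y' J Z`. -/
theorem SolvesLeftRHP.eqOn {Y' : ℂ → Matrix (Fin N ⊕ Fin N) (Fin N ⊕ Fin N) ℂ}
    (hY : SolvesLeftRHP γ W n Y) (hY' : SolvesLeftRHP γ W n Y')
    (hZ : SolvesRightRHP γ W n Z) : EqOn Y Y' γ.traceᶜ := by
  intro z hz
  have h1 := hY.mul_symplecticUnit_mul hZ hz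
  have h2 := hY'.mul_symplecticUnit_mul hZ hz
  have h3 : (-(symplecticUnit N * Y' z * symplecticUnit N)) * Z z = 1 := by
    rw [Matrix.neg_mul, Matrix.mul_assoc, Matrix.mul_assoc, ← Matrix.mul_assoc (Y' z), h2,
      symplecticUnit_mul_self, neg_neg]
  have h4 := mul_eq_one_comm.1 h3
  have h5 : Y z * symplecticUnit N = Y' z * symplecticUnit N := by
    rw [← Matrix.mul_one (Y z * symplecticUnit N), ← Matrix.mul_one (Y' z * symplecticUnit N),
      ← h4, ← Matrix.mul_assoc, ← Matrix.mul_assoc, h1, h2]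
  have h6 := congrArg (· * symplecticUnit N) h5
  simpa [Matrix.mul_assoc, symplecticUnit_mul_self] using h6

theorem SolvesRightRHP.eqOn {Z' : ℂ → Matrix (Fin N ⊕ Fin N) (Fin N ⊕ Fin N) ℂ}
    (hZ : SolvesRightRHP γ W n Z) (hZ' : SolvesRightRHP γ W n Z')
    (hY : SolvesLeftRHP γ W n Y) : EqOn Z Z' γ.traceᶜ := by
  intro z hz
  have h1 := hY.mul_symplecticUnit_mul hZ hz
  have h2 := hY.mul_symplecticUnit_mul hZ' hz
  have h3 : (-(symplecticUnit N * Y z * symplecticUnit N)) * Z z = 1 := by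
    rw [Matrix.neg_mul, Matrix.mul_assoc, Matrix.mul_assoc, ← Matrix.mul_assoc (Y z), h1,
      symplecticUnit_mul_self, neg_neg]
  have h4 : (-(symplecticUnit N * Y z * symplecticUnit N)) * Z' z = 1 := by
    rw [Matrix.neg_mul, Matrix.mul_assoc, Matrix.mul_assoc, ← Matrix.mul_assoc (Y z), h2,
      symplecticUnit_mul_self, neg_neg]
  exact (left_inv_eq_right_inv (mul_eq_one_comm.1 h3) h4)

/-- Transposition exchanges the left and right problems. -/
theorem SolvesLeftRHP.transpose (hY : SolvesLeftRHP γ (fun z => (W z).transpose) n Y) :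
    SolvesRightRHP γ W n fun z => (Y z).transpose where
  holomorphic a b := hY.holomorphic b a
  jump z hz := by
    obtain ⟨Yp, Ym, hp, hm, hj⟩ := hY.jump z hz
    have hc : Continuous fun A : Matrix (Fin N ⊕ Fin N) (Fin N ⊕ Fin N) ℂ => A.transpose :=
      continuous_id.matrix_transpose
    refine ⟨Yp.transpose, Ym.transpose, (hc.tendsto _).comp hp, (hc.tendsto _).comp hm, ?_⟩
    rw [hj, Matrix.transpose_mul, Matrix.fromBlocks_transpose]
    simp
  infinity := by
    obtain ⟨E, hE, hYE⟩ := hY.infinity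
    refine ⟨fun z => (E z).transpose, fun a b => hE b a, hYE.mono fun z hz => ?_⟩
    rw [hz, Matrix.transpose_mul, diagPower, Matrix.fromBlocks_transpose]
    simp
  origin_first_row i b := hY.origin_first_column b i
  origin_second_row i b := hY.origin_second_column b i

end

/-! ### Solutions built from polynomials and second kind functions -/

section

variable {γ : Loop}

lemma loopIntegral_const_mul (c : ℝ → ℂ) (w : ℂ) (f : ℂ → ℂ) :
    loopIntegral c (fun t => w * f t) = w * loopIntegral c f := by
  simp only [loopIntegral, mul_assoc, intervalIntegral.integral_const_mul]
  ring

lemma loopIntegral_sum {ι : Type*} (s : Finset ι) {F : ι → ℂ → ℂ}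
    (h : ∀ i ∈ s, IsDensity γ (F i)) :
    loopIntegral γ.toFun (fun t => ∑ i ∈ s, F i t) = ∑ i ∈ s, loopIntegral γ.toFun (F i) := by
  simp only [loopIntegral, Finset.sum_mul]
  rw [intervalIntegral.integral_finsetSum fun i hi => (h i hi).intervalIntegrable,
    Finset.mul_sum]

variable {N : ℕ} {W : ℂ → Matrix (Fin N) (Fin N) ℂ}

/-- The polynomial `∑_{i < m} a_i z ^ i` with matrix coefficients, as a function. -/
def matrixPoly (m : ℕ) (a : ℕ → Matrix (Fin N) (Fin N) ℂ) (z : ℂ) : Matrix (Fin N) (Fin N) ℂ :=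
  ∑ i ∈ Finset.range m, z ^ i • a i

lemma matrixPoly_apply (m : ℕ) (a : ℕ → Matrix (Fin N) (Fin N) ℂ) (z : ℂ) (i j : Fin N) :
    matrixPoly m a z i j = ∑ l ∈ Finset.range m, z ^ l * a l i j := by
  simp [matrixPoly, Matrix.sum_apply]

lemma polyVal_eq_matrixPoly {P : (Matrix (Fin N) (Fin N) ℂ)[X]} {n : ℕ} (hP : P.natDegree ≤ n)
    (z : ℂ) : polyVal P z = matrixPoly (n + 1) P.coeff z := by
  rw [polyVal, Polynomial.eval_eq_sum_range' (Nat.lt_succ_of_le hP), matrixPoly]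
  refine Finset.sum_congr rfl fun i _ => ?_
  rw [← map_pow, Matrix.scalar_apply, ← Matrix.smul_one_eq_diagonal, Matrix.mul_smul,
    Matrix.mul_one]

lemma matrixPoly_mul_apply (m : ℕ) (a : ℕ → Matrix (Fin N) (Fin N) ℂ) (k : ℕ) (z : ℂ)
    (i j : Fin N) : z ^ k * (matrixPoly m a z * W z) i j =
      ∑ s, ∑ l ∈ Finset.range m, a l i s * (z ^ (l + k) * W z s j) := by
  rw [Matrix.mul_apply, Finset.mul_sum]
  refine Finset.sum_congr rfl fun s _ => ?_
  rw [matrixPoly_apply, Finset.sum_mul, Finset.mul_sum]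
  refine Finset.sum_congr rfl fun l _ => ?_
  ring

lemma isDensity_matrixPoly_mul (hW : ∀ i j, IsDensity γ fun z => W z i j) (m : ℕ)
    (a : ℕ → Matrix (Fin N) (Fin N) ℂ) (i j : Fin N) :
    IsDensity γ fun z => (matrixPoly m a z * W z) i j := by
  have h : ∀ z, (matrixPoly m a z * W z) i j =
      ∑ s, ∑ l ∈ Finset.range m, a l i s * (z ^ l * W z s j) := fun z => by
    simpa using matrixPoly_mul_apply (W := W) m a 0 z i j
  simp only [h]
  exact IsDensity.sum fun s _ => IsDensity.sum fun l _ => ((hW s j).pow_mul l).const_mul _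

/-- The moments of `P W` in terms of the coefficients of `P` and the moments of `W`. -/
lemma loopIntegral_pow_mul_matrixPoly_mul (hW : ∀ i j, IsDensity γ fun z => W z i j) (m : ℕ)
    (a : ℕ → Matrix (Fin N) (Fin N) ℂ) (k : ℕ) (i j : Fin N) :
    loopIntegral γ.toFun (fun z => z ^ k * (matrixPoly m a z * W z) i j) =
      (∑ l ∈ Finset.range m, a l * moment γ W (l + k)) i j := by
  simp only [matrixPoly_mul_apply]
  rw [loopIntegral_sum _ fun s _ => IsDensity.sum fun l _ =>
    ((hW s j).pow_mul (l + k)).const_mul _, Matrix.sum_apply]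
  simp only [Matrix.mul_apply]
  rw [Finset.sum_comm]
  refine Finset.sum_congr rfl fun s _ => ?_
  rw [loopIntegral_sum _ fun l _ => ((hW s j).pow_mul (l + k)).const_mul _]
  refine Finset.sum_congr rfl fun l _ => ?_
  rw [loopIntegral_const_mul]
  rfl

/-- A pair of functions that can serve as a block row of a solution of the left problem, but for
the behaviour at infinity. -/
structure IsBlockRow (γ : Loop) (W P Q : ℂ → Matrix (Fin N) (Fin N) ℂ) : Prop where
  differentiable : ∀ i j, Differentiable ℂ fun z => P z i j
  differentiableOn : ∀ i j, DifferentiableOn ℂ (fun z => Q z i j) γ.traceᶜ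
  jump : ∀ z ∈ γ.trace \ {0}, ∃ V, Tendsto Q (𝓝[γ.plusSide] z) (𝓝 (V + P z * W z)) ∧
    Tendsto Q (𝓝[γ.minusSide] z) (𝓝 V)
  origin : ∀ i j, Tendsto (fun z => z * Q z i j) (𝓝[γ.traceᶜ] 0) (𝓝 0)

namespace IsBlockRow

variable {P Q A B : ℂ → Matrix (Fin N) (Fin N) ℂ}

lemma const_mul (h : IsBlockRow γ W P Q) (L : Matrix (Fin N) (Fin N) ℂ) :
    IsBlockRow γ W (fun z => L * P z) fun z => L * Q z where
  differentiable i j := by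
    simp only [Matrix.mul_apply]
    exact Differentiable.fun_sum fun s _ => (h.differentiable s j).const_mul _
  differentiableOn i j := by
    simp only [Matrix.mul_apply]
    exact DifferentiableOn.fun_sum fun s _ => (h.differentiableOn s j).const_mul _
  jump z hz := by
    obtain ⟨V, h1, h2⟩ := h.jump z hz
    refine ⟨L * V, ?_, h2.const_mul L⟩
    rw [Matrix.mul_assoc, ← Matrix.mul_add]
    exact h1.const_mul L
  origin i j := by
    have h1 := tendsto_finsetSum (Finset.univ : Finset (Fin N)) fun s _ =>
      (h.origin s j).const_mul (L i s)
    simp only [mul_zero, Finset.sum_const_zero] at h1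
    refine h1.congr fun z => ?_
    rw [Matrix.mul_apply, Finset.mul_sum]
    exact Finset.sum_congr rfl fun s _ => by ring

lemma zero_const (K : Matrix (Fin N) (Fin N) ℂ) :
    IsBlockRow γ W (fun _ => 0) fun _ => K where
  differentiable i j := differentiable_const _
  differentiableOn i j := differentiableOn_const _
  jump z _ := ⟨K, by simpa using tendsto_const_nhds, tendsto_const_nhds⟩
  origin i j := by
    have : Tendsto (fun z : ℂ => z * K i j) (𝓝 0) (𝓝 (0 * K i j)) :=
      (continuous_id.mul continuous_const).tendsto 0
    rw [zero_mul] at this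
    exact this.mono_left nhdsWithin_le_nhds

lemma of_isDensity (hP : ∀ i j, Differentiable ℂ fun z => P z i j)
    (hd : ∀ i j, IsDensity γ fun z => (P z * W z) i j) :
    IsBlockRow γ W P fun z => γ.matrixIntegral fun t => (t - z)⁻¹ • (P t * W t) := by
  have hQ : ∀ i j, (fun z => (γ.matrixIntegral fun t => (t - z)⁻¹ • (P t * W t)) i j) =
      cauchyTransform γ fun t => (P t * W t) i j := fun i j => rfl
  refine ⟨hP, fun i j => ?_, fun z hz => ?_, fun i j => ?_⟩
  · rw [hQ]
    exact differentiableOn_cauchyTransform (hd i j)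
  · have h := fun i j => exists_tendsto_cauchyTransform (hd i j) hz
    choose V h1 h2 using h
    refine ⟨Matrix.of V, tendsto_pi_nhds.2 fun i => tendsto_pi_nhds.2 fun j => ?_,
      tendsto_pi_nhds.2 fun i => tendsto_pi_nhds.2 fun j => ?_⟩
    · exact (h1 i j).congr fun z => (congrFun (hQ i j) z).symm
    · exact (h2 i j).congr fun z => (congrFun (hQ i j) z).symm
  · exact (tendsto_mul_cauchyTransform (hd i j)).congr fun z => by rw [← hQ]

lemma of_matrixPoly (hW : ∀ i j, IsDensity γ fun z => W z i j) (m : ℕ)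
    (a : ℕ → Matrix (Fin N) (Fin N) ℂ) : IsBlockRow γ W (matrixPoly m a)
      fun z => γ.matrixIntegral fun t => (t - z)⁻¹ • (matrixPoly m a t * W t) := by
  refine of_isDensity (fun i j => ?_) (isDensity_matrixPoly_mul hW m a)
  simp only [matrixPoly_apply]
  exact Differentiable.fun_sum fun l _ => (differentiable_id.pow l).mul_const _

lemma tendsto_fromBlocks {l : Filter ℂ} {P Q A B : ℂ → Matrix (Fin N) (Fin N) ℂ}
    {P₀ Q₀ A₀ B₀ : Matrix (Fin N) (Fin N) ℂ} (hP : Tendsto P l (𝓝 P₀)) (hQ : Tendsto Q l (𝓝 Q₀))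
    (hA : Tendsto A l (𝓝 A₀)) (hB : Tendsto B l (𝓝 B₀)) :
    Tendsto (fun z => Matrix.fromBlocks (P z) (Q z) (A z) (B z)) l
      (𝓝 (Matrix.fromBlocks P₀ Q₀ A₀ B₀)) := by
  refine tendsto_pi_nhds.2 fun a => tendsto_pi_nhds.2 fun b => ?_
  rcases a with a | a <;> rcases b with b | b
  · exact tendsto_pi_nhds.1 (tendsto_pi_nhds.1 hP a) b
  · exact tendsto_pi_nhds.1 (tendsto_pi_nhds.1 hQ a) b
  · exact tendsto_pi_nhds.1 (tendsto_pi_nhds.1 hA a) b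
  · exact tendsto_pi_nhds.1 (tendsto_pi_nhds.1 hB a) b

lemma tendsto_poly (h : IsBlockRow γ W P Q) (z : ℂ) (S : Set ℂ) :
    Tendsto P (𝓝[S] z) (𝓝 (P z)) :=
  tendsto_pi_nhds.2 fun i => tendsto_pi_nhds.2 fun j =>
    ((h.differentiable i j).continuous.tendsto z).mono_left nhdsWithin_le_nhds

/-- Two block rows with the right behaviour at infinity solve the left problem. -/
theorem solvesLeftRHP (h : IsBlockRow γ W P Q) (h' : IsBlockRow γ W A B) {n : ℕ}
    (hP : ∀ i j, (fun z => (z ^ n)⁻¹ * P z i j - (1 : Matrix (Fin N) (Fin N) ℂ) i j)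
      =O[Bornology.cobounded ℂ] fun z => z⁻¹)
    (hQ : ∀ i j, (fun z => z ^ n * Q z i j) =O[Bornology.cobounded ℂ] fun z => z⁻¹)
    (hA : ∀ i j, (fun z => (z ^ n)⁻¹ * A z i j) =O[Bornology.cobounded ℂ] fun z => z⁻¹)
    (hB : ∀ i j, (fun z => z ^ n * B z i j - (1 : Matrix (Fin N) (Fin N) ℂ) i j)
      =O[Bornology.cobounded ℂ] fun z => z⁻¹) :
    SolvesLeftRHP γ W n fun z => Matrix.fromBlocks (P z) (Q z) (A z) (B z) where
  holomorphic a b := by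
    rcases a with a | a <;> rcases b with b | b
    · exact (h.differentiable a b).differentiableOn
    · exact h.differentiableOn a b
    · exact (h'.differentiable a b).differentiableOn
    · exact h'.differentiableOn a b
  jump z hz := by
    obtain ⟨V, h1, h2⟩ := h.jump z hz
    obtain ⟨V', h1', h2'⟩ := h'.jump z hz
    refine ⟨_, _, tendsto_fromBlocks (h.tendsto_poly z _) h1 (h'.tendsto_poly z _) h1',
      tendsto_fromBlocks (h.tendsto_poly z _) h2 (h'.tendsto_poly z _) h2', ?_⟩
    rw [Matrix.fromBlocks_multiply]
    simp [add_comm]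
  infinity := by
    refine ⟨fun z => Matrix.fromBlocks ((z ^ n)⁻¹ • P z - 1) (z ^ n • Q z) ((z ^ n)⁻¹ • A z)
      (z ^ n • B z - 1), ?_, ?_⟩
    · rintro (a | a) (b | b)
      · exact hP a b
      · exact hQ a b
      · exact hA a b
      · exact hB a b
    · filter_upwards [Bornology.eventually_ne_cobounded (0 : ℂ)] with z hz
      have hz' : z ^ n ≠ 0 := pow_ne_zero n hz
      rw [diagPower, ← Matrix.fromBlocks_one, Matrix.fromBlocks_add, Matrix.fromBlocks_multiply]
      simp [smul_smul, hz']
  origin_first_column a j := by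
    rcases a with a | a
    · exact ((h.differentiable a j).continuous.tendsto 0).isBigO_one ℂ |>.mono nhdsWithin_le_nhds
    · exact ((h'.differentiable a j).continuous.tendsto 0).isBigO_one ℂ |>.mono nhdsWithin_le_nhds
  origin_second_column a j := by
    rcases a with a | a
    · exact h.origin a j
    · exact h'.origin a j

end IsBlockRow

lemma isBigO_pow_inv_mul_pow {l n : ℕ} (h : l < n) :
    (fun z : ℂ => (z ^ n)⁻¹ * z ^ l) =O[Bornology.cobounded ℂ] fun z => z⁻¹ := by
  obtain ⟨d, rfl⟩ := Nat.exists_eq_add_of_lt h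
  refine IsBigO.of_bound 1 ?_
  filter_upwards [tendsto_norm_cobounded_atTop.eventually_ge_atTop 1,
    Bornology.eventually_ne_cobounded (0 : ℂ)] with z hz hz0
  have h1 : (z ^ (l + d + 1))⁻¹ * z ^ l = z⁻¹ * (z ^ d)⁻¹ := by
    rw [pow_succ, pow_add]
    have := pow_ne_zero l hz0
    have := pow_ne_zero d hz0
    field_simp
  rw [h1, one_mul, norm_mul]
  refine mul_le_of_le_one_right (norm_nonneg _) ?_
  rw [norm_inv, norm_pow]
  exact inv_le_one_of_one_le₀ (one_le_pow₀ hz)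

lemma isBigO_matrixPoly (a : ℕ → Matrix (Fin N) (Fin N) ℂ) (n : ℕ) (i j : Fin N) :
    (fun z => (z ^ n)⁻¹ * matrixPoly n a z i j) =O[Bornology.cobounded ℂ] fun z => z⁻¹ := by
  simp only [matrixPoly_apply, Finset.mul_sum]
  refine IsBigO.fun_sum fun l hl => ?_
  refine ((isBigO_pow_inv_mul_pow (Finset.mem_range.1 hl)).const_mul_left (a l i j)).congr_left
    fun z => ?_
  ring

lemma isBigO_monic_matrixPoly {a : ℕ → Matrix (Fin N) (Fin N) ℂ} {n : ℕ} (ha : a n = 1)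
    (i j : Fin N) : (fun z => (z ^ n)⁻¹ * matrixPoly (n + 1) a z i j -
      (1 : Matrix (Fin N) (Fin N) ℂ) i j) =O[Bornology.cobounded ℂ] fun z => z⁻¹ := by
  refine (isBigO_matrixPoly a n i j).congr' ?_ .rfl
  filter_upwards [Bornology.eventually_ne_cobounded (0 : ℂ)] with z hz
  have hz' : z ^ n ≠ 0 := pow_ne_zero n hz
  rw [matrixPoly_apply, matrixPoly_apply, Finset.sum_range_succ, ha]
  field_simp
  ring

/-- The `n` vanishing moments let `z ^ n` pass under the integral, and every Cauchy transform is
`O(1/z)`. -/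
lemma isBigO_pow_mul_secondKind (hW : ∀ i j, IsDensity γ fun z => W z i j)
    {a : ℕ → Matrix (Fin N) (Fin N) ℂ} {m n : ℕ}
    (h : ∀ k < n, ∑ l ∈ Finset.range m, a l * moment γ W (l + k) = 0) (i j : Fin N) :
    (fun z => z ^ n * (γ.matrixIntegral fun t => (t - z)⁻¹ • (matrixPoly m a t * W t)) i j)
      =O[Bornology.cobounded ℂ] fun z => z⁻¹ := by
  have hd := isDensity_matrixPoly_mul hW m a i j
  refine (isBigO_cauchyTransform (hd.pow_mul n)).congr' ?_ .rfl
  filter_upwards [γ.isBounded_trace] with z hz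
  refine (hd.pow_mul_cauchyTransform (fun k hk => ?_) hz).symm
  rw [loopIntegral_pow_mul_matrixPoly_mul hW, h k hk, Matrix.zero_apply]

lemma isBigO_pow_succ_mul_secondKind (hW : ∀ i j, IsDensity γ fun z => W z i j)
    {a : ℕ → Matrix (Fin N) (Fin N) ℂ} {m n : ℕ} {V : Matrix (Fin N) (Fin N) ℂ}
    (h : ∀ k < n, ∑ l ∈ Finset.range m, a l * moment γ W (l + k) = 0)
    (hV : ∑ l ∈ Finset.range m, a l * moment γ W (l + n) = V) (i j : Fin N) :
    (fun z => z ^ (n + 1) * (γ.matrixIntegral fun t => (t - z)⁻¹ • (matrixPoly m a t * W t)) i j +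
      V i j) =O[Bornology.cobounded ℂ] fun z => z⁻¹ := by
  have hd := isDensity_matrixPoly_mul hW m a i j
  refine (isBigO_cauchyTransform (hd.pow_mul (n + 1))).congr' ?_ .rfl
  filter_upwards [γ.isBounded_trace] with z hz
  have h1 := hd.pow_succ_mul_cauchyTransform (n := n) (fun k hk => by
    rw [loopIntegral_pow_mul_matrixPoly_mul hW, h k hk, Matrix.zero_apply]) hz
  rw [loopIntegral_pow_mul_matrixPoly_mul hW, hV] at h1
  change _ = z ^ (n + 1) * cauchyTransform γ (fun t => (matrixPoly m a t * W t) i j) z + V i j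
  rw [h1]; ring

/-- Coefficients of a monic polynomial of degree `n` that is left orthogonal, with norm `V`. -/
def IsLeftOrthogonal (M : ℕ → Matrix (Fin N) (Fin N) ℂ) (n : ℕ)
    (a : ℕ → Matrix (Fin N) (Fin N) ℂ) (V : Matrix (Fin N) (Fin N) ℂ) : Prop :=
  a n = 1 ∧ (∀ k < n, ∑ l ∈ Finset.range (n + 1), a l * M (l + k) = 0) ∧
    ∑ l ∈ Finset.range (n + 1), a l * M (l + n) = V

theorem solvesLeftRHP_zero (hW : ∀ i j, IsDensity γ fun z => W z i j)
    {a : ℕ → Matrix (Fin N) (Fin N) ℂ} {V : Matrix (Fin N) (Fin N) ℂ}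
    (h : IsLeftOrthogonal (moment γ W) 0 a V) :
    SolvesLeftRHP γ W 0 fun z => Matrix.fromBlocks (matrixPoly (0 + 1) a z)
      (γ.matrixIntegral fun t => (t - z)⁻¹ • (matrixPoly (0 + 1) a t * W t)) 0 1 := by
  refine (IsBlockRow.of_matrixPoly hW (0 + 1) a).solvesLeftRHP (.zero_const 1)
    (isBigO_monic_matrixPoly h.1) (isBigO_pow_mul_secondKind hW h.2.1) (fun i j => ?_)
    fun i j => ?_
  · simpa using isBigO_zero _ _
  · simpa using isBigO_zero _ _

/-- The normalisation of the second row comes from the first nonvanishing moment: `z ^ (n + 1) Q_n`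
tends to `-V'`, and the factor `-C` turns this limit into the identity. -/
theorem solvesLeftRHP_succ (hW : ∀ i j, IsDensity γ fun z => W z i j) {n : ℕ}
    {a b : ℕ → Matrix (Fin N) (Fin N) ℂ} {V V' C : Matrix (Fin N) (Fin N) ℂ}
    (h : IsLeftOrthogonal (moment γ W) (n + 1) a V) (h' : IsLeftOrthogonal (moment γ W) n b V')
    (hC : C * V' = 1) :
    SolvesLeftRHP γ W (n + 1) fun z => Matrix.fromBlocks (matrixPoly (n + 1 + 1) a z)
      (γ.matrixIntegral fun t => (t - z)⁻¹ • (matrixPoly (n + 1 + 1) a t * W t))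
      (-(C * matrixPoly (n + 1) b z))
      (-(C * γ.matrixIntegral fun t => (t - z)⁻¹ • (matrixPoly (n + 1) b t * W t))) := by
  simp only [← Matrix.neg_mul]
  refine (IsBlockRow.of_matrixPoly hW _ a).solvesLeftRHP
    ((IsBlockRow.of_matrixPoly hW _ b).const_mul (-C))
    (isBigO_monic_matrixPoly h.1) (isBigO_pow_mul_secondKind hW h.2.1) (fun i j => ?_)
    fun i j => ?_
  · simp only [Matrix.mul_apply, Finset.mul_sum]
    refine IsBigO.fun_sum fun s _ => ?_
    refine ((isBigO_matrixPoly b (n + 1) s j).const_mul_left ((-C) i s)).congr_left fun z => ?_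
    ring
  · have hV : ∀ i j, (1 : Matrix (Fin N) (Fin N) ℂ) i j = -∑ s, (-C) i s * V' s j := by
      intro i j
      rw [← Matrix.mul_apply, Matrix.neg_mul, hC, Matrix.neg_apply, neg_neg]
    simp only [hV, sub_neg_eq_add, Matrix.mul_apply (M := -C), Finset.mul_sum,
      ← Finset.sum_add_distrib]
    refine IsBigO.fun_sum fun s _ => ?_
    refine ((isBigO_pow_succ_mul_secondKind hW h'.2.1 h'.2.2 s j).const_mul_left
      ((-C) i s)).congr_left fun z => ?_
    ring

end

/-! ### Biorthogonal polynomials -/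

section

variable {N : ℕ} {M : ℕ → Matrix (Fin N) (Fin N) ℂ}

/-- The block Hankel matrix of a sequence of matrices. -/
def hankelMatrix (M : ℕ → Matrix (Fin N) (Fin N) ℂ) (n : ℕ) :
    Matrix (Fin (n + 1) × Fin N) (Fin (n + 1) × Fin N) ℂ :=
  Matrix.of fun a b => M ((a.1 : ℕ) + (b.1 : ℕ)) a.2 b.2

lemma hankelMatrix_transpose (n : ℕ) :
    hankelMatrix (fun k => (M k).transpose) n = (hankelMatrix M n).transpose := by
  ext a b
  simp [hankelMatrix, add_comm]

/-- The rows `a_0, …, a_n` as one block row. -/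
def blockRow (n : ℕ) (a : ℕ → Matrix (Fin N) (Fin N) ℂ) :
    Matrix (Fin N) (Fin (n + 1) × Fin N) ℂ :=
  Matrix.of fun r p => a p.1 r p.2

/-- Moments of `P W` are a block row times the Hankel matrix, so orthogonality is a linear system
with an invertible matrix. -/
lemma blockRow_mul_hankelMatrix (n : ℕ) (a : ℕ → Matrix (Fin N) (Fin N) ℂ) :
    blockRow n a * hankelMatrix M n =
      blockRow n fun k => ∑ l ∈ Finset.range (n + 1), a l * M (l + k) := by
  ext r p
  simp only [blockRow, hankelMatrix, Matrix.mul_apply, Matrix.of_apply, Fintype.sum_prod_type,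
    Matrix.sum_apply]
  rw [Finset.sum_range fun l => ∑ s, a l r s * M (l + p.1) s p.2]

lemma blockRow_injective {n : ℕ} {a b : ℕ → Matrix (Fin N) (Fin N) ℂ}
    (h : blockRow n a = blockRow n b) {k : ℕ} (hk : k < n + 1) : a k = b k := by
  ext r s
  simpa [blockRow] using congrFun (congrFun h r) (⟨k, hk⟩, s)

lemma exists_blockRow_eq {n : ℕ} (A : Matrix (Fin N) (Fin (n + 1) × Fin N) ℂ) :
    ∃ a : ℕ → Matrix (Fin N) (Fin N) ℂ, blockRow n a = A := by
  refine ⟨fun k => Matrix.of fun r s => if h : k < n + 1 then A r (⟨k, h⟩, s) else 0, ?_⟩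
  ext r p
  have hp : (p.1 : ℕ) < n + 1 := p.1.2
  simp only [blockRow, Matrix.of_apply]
  rw [dif_pos hp]

lemma eq_of_sum_mul_eq (hM : ∀ n, (hankelMatrix M n).det ≠ 0) {n : ℕ}
    {a b : ℕ → Matrix (Fin N) (Fin N) ℂ}
    (h : ∀ k < n, ∑ l ∈ Finset.range n, a l * M (l + k) = ∑ l ∈ Finset.range n, b l * M (l + k))
    {k : ℕ} (hk : k < n) : a k = b k := by
  -- The Hankel matrix of index `m` has `m + 1` block rows, whence the shift; `hk` excludes `n = 0`.
  obtain ⟨n, rfl⟩ : ∃ m, n = m + 1 := ⟨n - 1, by omega⟩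
  have h1 : blockRow n a * hankelMatrix M n = blockRow n b * hankelMatrix M n := by
    rw [blockRow_mul_hankelMatrix, blockRow_mul_hankelMatrix]
    ext r p
    simp only [blockRow, Matrix.of_apply]
    rw [h p.1 p.1.2]
  have hu : IsUnit (hankelMatrix M n).det := (hM n).isUnit
  have h2 : blockRow n a = blockRow n b := by
    rw [← Matrix.mul_nonsing_inv_cancel_right _ (blockRow n a) hu, h1,
      Matrix.mul_nonsing_inv_cancel_right _ _ hu]
  exact blockRow_injective h2 hk

lemma exists_sum_mul_eq (hM : ∀ n, (hankelMatrix M n).det ≠ 0) (n : ℕ)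
    (R : ℕ → Matrix (Fin N) (Fin N) ℂ) :
    ∃ a : ℕ → Matrix (Fin N) (Fin N) ℂ,
      ∀ k < n, ∑ l ∈ Finset.range n, a l * M (l + k) = R k := by
  rcases n with _ | n
  · exact ⟨0, by simp⟩
  have hu : IsUnit (hankelMatrix M n).det := (hM n).isUnit
  obtain ⟨a, ha⟩ := exists_blockRow_eq (blockRow n R * (hankelMatrix M n)⁻¹)
  refine ⟨a, fun k hk => ?_⟩
  refine blockRow_injective (n := n) (a := fun k => ∑ l ∈ Finset.range (n + 1), a l * M (l + k))
    ?_ hk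
  rw [← blockRow_mul_hankelMatrix, ha, Matrix.nonsing_inv_mul_cancel_right _ _ hu]

/-- The coefficients below the leading one solve a Hankel system with `n` block rows. If the norm
were singular, a nonzero row combination of the polynomial would be orthogonal to all degrees up to
`n`, against invertibility of the next Hankel matrix. -/
lemma exists_isLeftOrthogonal (hM : ∀ n, (hankelMatrix M n).det ≠ 0) (n : ℕ) :
    ∃ a V, IsLeftOrthogonal M n a V ∧ V.det ≠ 0 := by
  obtain ⟨b, hb⟩ := exists_sum_mul_eq hM n fun k => -M (n + k)
  set a : ℕ → Matrix (Fin N) (Fin N) ℂ := Function.update b n 1 with ha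
  have han : a n = 1 := by simp [ha]
  have horth : ∀ k < n, ∑ l ∈ Finset.range (n + 1), a l * M (l + k) = 0 := by
    intro k hk
    rw [Finset.sum_range_succ, han, one_mul]
    have : ∑ l ∈ Finset.range n, a l * M (l + k) = ∑ l ∈ Finset.range n, b l * M (l + k) :=
      Finset.sum_congr rfl fun l hl => by
        rw [ha, Function.update_of_ne (Finset.mem_range.1 hl).ne]
    rw [this, hb k hk, neg_add_cancel]
  refine ⟨a, _, ⟨han, horth, rfl⟩, fun hdet => ?_⟩
  obtain ⟨v, hv, hv0⟩ := Matrix.exists_vecMul_eq_zero_iff.2 hdet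
  -- Repeating the row `v` in every row keeps the argument within square matrices; the leading
  -- coefficient `U * 1` must then vanish, so `v = 0`.
  set U : Matrix (Fin N) (Fin N) ℂ := Matrix.of fun _ => v with hU
  have hUV : U * ∑ l ∈ Finset.range (n + 1), a l * M (l + n) = 0 := by
    ext r s
    exact congrFun hv0 s
  have hzero : ∀ k < n + 1, ∑ l ∈ Finset.range (n + 1), U * a l * M (l + k) =
      ∑ l ∈ Finset.range (n + 1), (fun _ => (0 : Matrix (Fin N) (Fin N) ℂ)) l * M (l + k) := by
    intro k hk
    simp only [Matrix.mul_assoc, ← Matrix.mul_sum, Matrix.zero_mul, Finset.sum_const_zero]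
    rcases (Nat.lt_succ_iff_lt_or_eq.1 hk) with h | rfl
    · rw [horth k h, Matrix.mul_zero]
    · exact hUV
  have h1 := eq_of_sum_mul_eq hM hzero n.lt_succ_self
  simp only [han, Matrix.mul_one] at h1
  apply hv
  ext s
  exact congrFun (congrFun h1 s) s

lemma IsLeftOrthogonal.eq (hM : ∀ n, (hankelMatrix M n).det ≠ 0) {n : ℕ}
    {a b : ℕ → Matrix (Fin N) (Fin N) ℂ} {V V' : Matrix (Fin N) (Fin N) ℂ}
    (h : IsLeftOrthogonal M n a V) (h' : IsLeftOrthogonal M n b V') {k : ℕ} (hk : k ≤ n) :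
    a k = b k := by
  rcases hk.lt_or_eq with hk | rfl
  · refine eq_of_sum_mul_eq hM (fun k hk => ?_) hk
    have h1 := h.2.1 k hk
    have h2 := h'.2.1 k hk
    rw [Finset.sum_range_succ, h.1] at h1
    rw [Finset.sum_range_succ, h'.1] at h2
    exact add_right_cancel (h1.trans h2.symm)
  · rw [h.1, h'.1]

/-- The left and the right norms agree. -/
lemma IsLeftOrthogonal.norm_eq {n : ℕ} {a b : ℕ → Matrix (Fin N) (Fin N) ℂ}
    {V V' : Matrix (Fin N) (Fin N) ℂ} (h : IsLeftOrthogonal M n a V)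
    (h' : IsLeftOrthogonal (fun k => (M k).transpose) n b V') : V = V'.transpose := by
  -- The double sum is the integral of `P^L W P^R`. Summed over `l` first, left orthogonality leaves
  -- only `k = n`; summed over `k` first, right orthogonality leaves only `l = n`.
  have e1 : ∑ k ∈ Finset.range (n + 1), ∑ l ∈ Finset.range (n + 1),
      a l * M (l + k) * (b k).transpose = V := by
    rw [Finset.sum_range_succ]
    simp only [← Matrix.sum_mul]
    rw [h.2.2, h'.1, Finset.sum_eq_zero fun k hk => by
      rw [h.2.1 k (Finset.mem_range.1 hk), Matrix.zero_mul]]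
    simp
  have e2 : ∀ l, ∑ k ∈ Finset.range (n + 1), a l * M (l + k) * (b k).transpose =
      a l * (∑ k ∈ Finset.range (n + 1), b k * (M (k + l)).transpose).transpose := by
    intro l
    rw [Matrix.transpose_sum, Matrix.mul_sum]
    refine Finset.sum_congr rfl fun k _ => ?_
    rw [Matrix.transpose_mul, Matrix.transpose_transpose, Matrix.mul_assoc, add_comm l k]
  rw [← e1, Finset.sum_comm, Finset.sum_congr rfl fun l _ => e2 l, Finset.sum_range_succ,
    h'.2.2, h.1, Finset.sum_eq_zero fun k hk => by
      rw [h'.2.1 k (Finset.mem_range.1 hk), Matrix.transpose_zero, Matrix.mul_zero]]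
  simp

end

/-! ### The biorthogonal polynomials of a weight and their Riemann–Hilbert problems -/

section

variable {N : ℕ} {γ : Loop} {W : ℂ → Matrix (Fin N) (Fin N) ℂ}

lemma transpose_matrixIntegral (F : ℂ → Matrix (Fin N) (Fin N) ℂ) :
    (γ.matrixIntegral F).transpose = γ.matrixIntegral fun z => (F z).transpose :=
  rfl

lemma moment_transpose (k : ℕ) :
    moment γ (fun z => (W z).transpose) k = (moment γ W k).transpose :=
  rfl

lemma matrixPoly_transpose (m : ℕ) (a : ℕ → Matrix (Fin N) (Fin N) ℂ) (z : ℂ) :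
    (matrixPoly m a z).transpose = matrixPoly m (fun l => (a l).transpose) z := by
  simp [matrixPoly, Matrix.transpose_sum]

lemma polyVal_eq_transpose_matrixPoly {P : (Matrix (Fin N) (Fin N) ℂ)[X]} {n : ℕ}
    (hP : P.natDegree ≤ n) (z : ℂ) :
    polyVal P z = (matrixPoly (n + 1) (fun l => (P.coeff l).transpose) z).transpose := by
  simp [matrixPoly_transpose, polyVal_eq_matrixPoly hP]

lemma matrixIntegral_pow_smul_polyVal_mul (hW : ∀ i j, IsDensity γ fun z => W z i j)
    {P : (Matrix (Fin N) (Fin N) ℂ)[X]} {n : ℕ} (hP : P.natDegree ≤ n) (k : ℕ) :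
    (γ.matrixIntegral fun z => z ^ k • (polyVal P z * W z)) =
      ∑ l ∈ Finset.range (n + 1), P.coeff l * moment γ W (l + k) := by
  ext i j
  rw [← loopIntegral_pow_mul_matrixPoly_mul hW]
  simp only [polyVal_eq_matrixPoly hP]
  rfl

/-- Transposition moves the polynomial to the left of the weight, so right orthogonality becomes
left orthogonality for transposed coefficients and moments. -/
lemma matrixIntegral_pow_smul_mul_polyVal (hW : ∀ i j, IsDensity γ fun z => W z i j)
    {P : (Matrix (Fin N) (Fin N) ℂ)[X]} {n : ℕ} (hP : P.natDegree ≤ n) (k : ℕ) :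
    (γ.matrixIntegral fun z => z ^ k • (W z * polyVal P z)) =
      (∑ l ∈ Finset.range (n + 1),
        (P.coeff l).transpose * (moment γ W (l + k)).transpose).transpose := by
  ext i j
  have h := loopIntegral_pow_mul_matrixPoly_mul (W := fun z => (W z).transpose)
    (fun i j => hW j i) (n + 1) (fun l => (P.coeff l).transpose) k j i
  simp only [moment_transpose] at h
  rw [Matrix.transpose_apply, ← h]
  have e : ∀ z, (matrixPoly (n + 1) (fun l => (P.coeff l).transpose) z * (W z).transpose) j i =
      (W z * polyVal P z) i j := fun z => by
    rw [polyVal_eq_transpose_matrixPoly hP, ← Matrix.transpose_apply (_ * _), Matrix.transpose_mul,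
      Matrix.transpose_transpose]
  simp only [e]
  rfl

/-- Biorthogonality as a system of linear equations for the coefficients. -/
lemma isBiorthogonal_iff (hW : ∀ i j, IsDensity γ fun z => W z i j)
    {PL PR : ℕ → (Matrix (Fin N) (Fin N) ℂ)[X]} {C : ℕ → Matrix (Fin N) (Fin N) ℂ} :
    IsBiorthogonal γ W PL PR C ↔ ∀ n, (PL n).natDegree ≤ n ∧ (PR n).natDegree ≤ n ∧
      (C n).det ≠ 0 ∧ IsLeftOrthogonal (moment γ W) n (PL n).coeff (C n)⁻¹ ∧
      IsLeftOrthogonal (fun k => (moment γ W k).transpose) n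
        (fun l => ((PR n).coeff l).transpose) ((C n)⁻¹).transpose := by
  refine forall_congr' fun n => ⟨?_, ?_⟩
  · rintro ⟨⟨hL, hL1⟩, ⟨hR, hR1⟩, hC, h⟩
    have h1 := fun k hk => (h k hk).1
    have h2 := fun k hk => congrArg Matrix.transpose (h k hk).2
    simp only [matrixIntegral_pow_smul_polyVal_mul hW hL] at h1
    simp only [matrixIntegral_pow_smul_mul_polyVal hW hR, Matrix.transpose_transpose] at h2
    refine ⟨hL, hR, hC, ⟨hL1, fun k hk => ?_, ?_⟩, by simp [hR1], fun k hk => ?_, ?_⟩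
    · rw [h1 k hk.le, if_neg hk.ne']
    · rw [h1 n le_rfl, if_pos rfl]
    · rw [h2 k hk.le, if_neg hk.ne', Matrix.transpose_zero]
    · rw [h2 n le_rfl, if_pos rfl]
  · rintro ⟨hL, hR, hC, h1, h2⟩
    refine ⟨⟨hL, h1.1⟩, ⟨hR, Matrix.transpose_injective (by simpa using h2.1)⟩, hC,
      fun k hk => ?_⟩
    rw [matrixIntegral_pow_smul_polyVal_mul hW hL, matrixIntegral_pow_smul_mul_polyVal hW hR]
    rcases hk.lt_or_eq with hk | rfl
    · rw [if_neg hk.ne', h1.2.1 k hk, h2.2.1 k hk, Matrix.transpose_zero]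
      exact ⟨rfl, rfl⟩
    · rw [if_pos rfl, h1.2.2, h2.2.2, Matrix.transpose_transpose]
      exact ⟨rfl, rfl⟩

/-- The polynomial with coefficients `a_0, …, a_n`. -/
def polyOfCoeff (n : ℕ) (a : ℕ → Matrix (Fin N) (Fin N) ℂ) : (Matrix (Fin N) (Fin N) ℂ)[X] :=
  ∑ i ∈ Finset.range (n + 1), Polynomial.monomial i (a i)

lemma coeff_polyOfCoeff {n k : ℕ} (a : ℕ → Matrix (Fin N) (Fin N) ℂ) (hk : k < n + 1) :
    (polyOfCoeff n a).coeff k = a k := by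
  simp [polyOfCoeff, Polynomial.finsetSum_coeff, Polynomial.coeff_monomial, Nat.lt_succ_iff.1 hk]

lemma natDegree_polyOfCoeff_le (n : ℕ) (a : ℕ → Matrix (Fin N) (Fin N) ℂ) :
    (polyOfCoeff n a).natDegree ≤ n :=
  Polynomial.natDegree_sum_le_of_forall_le _ _ fun _ hi =>
    (Polynomial.natDegree_monomial_le _).trans (Nat.lt_succ_iff.1 (Finset.mem_range.1 hi))

lemma IsLeftOrthogonal.congr {M : ℕ → Matrix (Fin N) (Fin N) ℂ} {n : ℕ}
    {a b : ℕ → Matrix (Fin N) (Fin N) ℂ} {V : Matrix (Fin N) (Fin N) ℂ}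
    (h : IsLeftOrthogonal M n a V) (hab : ∀ k < n + 1, b k = a k) : IsLeftOrthogonal M n b V := by
  have e : ∀ k, ∑ l ∈ Finset.range (n + 1), b l * M (l + k) =
      ∑ l ∈ Finset.range (n + 1), a l * M (l + k) := fun k =>
    Finset.sum_congr rfl fun l hl => by rw [hab l (Finset.mem_range.1 hl)]
  refine ⟨by rw [hab n n.lt_succ_self, h.1], fun k hk => by rw [e, h.2.1 k hk], by rw [e, h.2.2]⟩

lemma IsRegular.det_transpose (h : IsRegular γ W) (n : ℕ) :
    (hankelMatrix (fun k => (moment γ W k).transpose) n).det ≠ 0 := by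
  rw [hankelMatrix_transpose, Matrix.det_transpose]
  exact h n

/-- A regular weight has exactly one system of biorthogonal polynomials. -/
theorem existsUnique_isBiorthogonal (hW : ∀ i j, IsDensity γ fun z => W z i j)
    (hreg : IsRegular γ W) :
    ∃! d : (ℕ → (Matrix (Fin N) (Fin N) ℂ)[X]) × (ℕ → (Matrix (Fin N) (Fin N) ℂ)[X]) ×
      (ℕ → Matrix (Fin N) (Fin N) ℂ), IsBiorthogonal γ W d.1 d.2.1 d.2.2 := by
  have hM : ∀ n, (hankelMatrix (moment γ W) n).det ≠ 0 := hreg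
  have hM' := hreg.det_transpose
  simp only [isBiorthogonal_iff hW]
  refine existsUnique_of_exists_of_unique ?_ ?_
  · choose a V ha hV using exists_isLeftOrthogonal hM
    choose b V' hb _ using exists_isLeftOrthogonal hM'
    refine ⟨⟨fun n => polyOfCoeff n (a n), fun n => polyOfCoeff n fun l => (b n l).transpose,
      fun n => (V n)⁻¹⟩,
      fun n => ⟨natDegree_polyOfCoeff_le _ _, natDegree_polyOfCoeff_le _ _, ?_, ?_, ?_⟩⟩
    · exact (Matrix.isUnit_nonsing_inv_det _ (hV n).isUnit).ne_zero
    · dsimp only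
      rw [Matrix.nonsing_inv_nonsing_inv _ (hV n).isUnit]
      exact (ha n).congr fun k hk => coeff_polyOfCoeff _ hk
    · dsimp only
      -- Equality of the two norms is what allows a single `C n` to normalise both families.
      rw [Matrix.nonsing_inv_nonsing_inv _ (hV n).isUnit, (ha n).norm_eq (hb n),
        Matrix.transpose_transpose]
      exact (hb n).congr fun k hk => by rw [coeff_polyOfCoeff _ hk, Matrix.transpose_transpose]
  · rintro ⟨PL, PR, C⟩ ⟨PL', PR', C'⟩ h h'
    have hL : PL = PL' := funext fun n => Polynomial.ext fun k => by
      obtain ⟨hd, -, -, ho, -⟩ := h n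
      obtain ⟨hd', -, -, ho', -⟩ := h' n
      rcases le_or_gt k n with hk | hk
      · exact ho.eq hM ho' hk
      · rw [Polynomial.coeff_eq_zero_of_natDegree_lt (hd.trans_lt hk),
          Polynomial.coeff_eq_zero_of_natDegree_lt (hd'.trans_lt hk)]
    have hR : PR = PR' := funext fun n => Polynomial.ext fun k => by
      obtain ⟨-, hd, -, -, ho⟩ := h n
      obtain ⟨-, hd', -, -, ho'⟩ := h' n
      rcases le_or_gt k n with hk | hk
      · exact Matrix.transpose_injective (ho.eq hM' ho' hk)
      · rw [Polynomial.coeff_eq_zero_of_natDegree_lt (hd.trans_lt hk),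
          Polynomial.coeff_eq_zero_of_natDegree_lt (hd'.trans_lt hk)]
    have hC : C = C' := funext fun n => by
      have hc : (C n).det ≠ 0 := (h n).2.2.1
      have hc' : (C' n).det ≠ 0 := (h' n).2.2.1
      obtain ⟨-, -, -, ho, -⟩ := h n
      obtain ⟨-, -, -, ho', -⟩ := h' n
      simp only [← hL] at ho'
      have e : (C n)⁻¹ = (C' n)⁻¹ := ho.2.2.symm.trans ho'.2.2
      rw [← Matrix.nonsing_inv_nonsing_inv _ hc.isUnit, e,
        Matrix.nonsing_inv_nonsing_inv _ hc'.isUnit]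
    rw [hL, hR, hC]

theorem solvesLeftRHP_YL (hW : ∀ i j, IsDensity γ fun z => W z i j)
    {PL PR : ℕ → (Matrix (Fin N) (Fin N) ℂ)[X]} {C : ℕ → Matrix (Fin N) (Fin N) ℂ}
    (h : IsBiorthogonal γ W PL PR C) (n : ℕ) : SolvesLeftRHP γ W n (YL γ W PL C n) := by
  rw [isBiorthogonal_iff hW] at h
  rcases n with _ | n
  · obtain ⟨hd, -, -, ho, -⟩ := h 0
    convert solvesLeftRHP_zero hW ho using 2 with z
    simp only [YL, secondKindL, polyVal_eq_matrixPoly hd]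
  · obtain ⟨hd, -, -, ho, -⟩ := h (n + 1)
    obtain ⟨hd', -, hc, ho', -⟩ := h n
    convert solvesLeftRHP_succ hW ho ho' (Matrix.mul_nonsing_inv _ hc.isUnit) using 2 with z
    simp only [YL, secondKindL, polyVal_eq_matrixPoly hd, polyVal_eq_matrixPoly hd']

theorem solvesRightRHP_YR (hW : ∀ i j, IsDensity γ fun z => W z i j)
    {PL PR : ℕ → (Matrix (Fin N) (Fin N) ℂ)[X]} {C : ℕ → Matrix (Fin N) (Fin N) ℂ}
    (h : IsBiorthogonal γ W PL PR C) (n : ℕ) : SolvesRightRHP γ W n (YR γ W PR C n) := by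
  rw [isBiorthogonal_iff hW] at h
  have hW' : ∀ i j, IsDensity γ fun z => (W z).transpose i j := fun i j => hW j i
  rcases n with _ | n
  · obtain ⟨-, hd, -, -, ho⟩ := h 0
    convert (solvesLeftRHP_zero (W := fun z => (W z).transpose) hW' ho).transpose using 2 with z
    simp only [YR, secondKindR, polyVal_eq_transpose_matrixPoly hd, Matrix.fromBlocks_transpose,
      transpose_matrixIntegral, Matrix.transpose_smul, Matrix.transpose_mul,
      Matrix.transpose_transpose, Matrix.transpose_zero, Matrix.transpose_one]
  · obtain ⟨-, hd, -, -, ho⟩ := h (n + 1)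
    obtain ⟨-, hd', hc, -, ho'⟩ := h n
    have hC : (C n).transpose * ((C n)⁻¹).transpose = 1 := by
      rw [← Matrix.transpose_mul, Matrix.nonsing_inv_mul _ hc.isUnit, Matrix.transpose_one]
    convert (solvesLeftRHP_succ (W := fun z => (W z).transpose) hW' ho ho' hC).transpose
      using 2 with z
    simp only [YR, secondKindR, polyVal_eq_transpose_matrixPoly hd,
      polyVal_eq_transpose_matrixPoly hd', Matrix.fromBlocks_transpose,
      transpose_matrixIntegral, Matrix.transpose_smul, Matrix.transpose_mul, Matrix.transpose_neg,
      Matrix.transpose_transpose]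

end

end MatrixBessel

end

theorem mainTheorem1 {N : ℕ} (γ : MatrixBessel.Loop) (W : ℂ → Matrix (Fin N) (Fin N) ℂ)
    (hBessel : MatrixBessel.IsBesselType γ W) (hRegular : MatrixBessel.IsRegular γ W) :
    (∃! d : (ℕ → (Matrix (Fin N) (Fin N) ℂ)[X]) × (ℕ → (Matrix (Fin N) (Fin N) ℂ)[X]) ×
        (ℕ → Matrix (Fin N) (Fin N) ℂ),
      MatrixBessel.IsBiorthogonal γ W d.1 d.2.1 d.2.2) ∧
    ∀ (PL PR : ℕ → (Matrix (Fin N) (Fin N) ℂ)[X]) (C : ℕ → Matrix (Fin N) (Fin N) ℂ),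
      MatrixBessel.IsBiorthogonal γ W PL PR C →
      ∀ n : ℕ,
        (MatrixBessel.SolvesLeftRHP γ W n (MatrixBessel.YL γ W PL C n) ∧
          ∀ Y : ℂ → Matrix (Fin N ⊕ Fin N) (Fin N ⊕ Fin N) ℂ,
            MatrixBessel.SolvesLeftRHP γ W n Y →
              Set.EqOn Y (MatrixBessel.YL γ W PL C n) γ.traceᶜ) ∧
        (MatrixBessel.SolvesRightRHP γ W n (MatrixBessel.YR γ W PR C n) ∧
          ∀ Y : ℂ → Matrix (Fin N ⊕ Fin N) (Fin N ⊕ Fin N) ℂ,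
            MatrixBessel.SolvesRightRHP γ W n Y →
              Set.EqOn Y (MatrixBessel.YR γ W PR C n) γ.traceᶜ) := by
  have hW := hBessel.isDensity
  refine ⟨MatrixBessel.existsUnique_isBiorthogonal hW hRegular, fun PL PR C h n => ?_⟩
  have hL := MatrixBessel.solvesLeftRHP_YL hW h n
  have hR := MatrixBessel.solvesRightRHP_YR hW h n
  -- Uniqueness for each problem uses the constructed solution of the other one as the partner in
  -- the pairing.
  exact ⟨⟨hL, fun Y hY => hY.eqOn hL hR⟩, hR, fun Y hY => hY.eqOn hR hL⟩
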